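/- **Normal o-graphs.** An oriented virtual link diagram is considered up to planar isotopy and Reidemeister type moves involving virtual crossings; so it is given by a finite set of signed real crossings, each with an over-strand and an under-strand, and by oriented edges joining the outgoing half-edges to the incoming ones (as well as closed curves without crossings). Such a class is a *normal o-graph*. An *integral* normal o-graph has an integer weight on each edge; when an edge is cut into segments by marked points, the weight of the edge is the sum of the weights of its segments. **Circuits.** A normal o-graph represents a branched polyhedron $P$, whose 0-cells and 1-cells are the crossings and the edges. Along each edge run three lines, numbered $1,2,3$; the boundaries of the 2-cells are the circuits obtained by joining them at the crossings. The oriented boundary of a 2-cell follows lines $1,2$ in the direction of the edge and line $3$ in the opposite direction. Write $o_i,u_i$ for the line $i$ of the over- and the under-strand at a crossing, on the half-edge which the boundary uses: it arrives on an incoming half-edge if $i=1,2$ and on an outgoing one if $i=3$; it leaves on an outgoing half-edge if $i=1,2$ and on an incoming one if $i=3$. At a positive crossing arriving and leaving lines are joined by $o_1\to u_2,\ o_2\to o_2,\ o_3\to u_3,\ u_1\to u_1,\ u_2\to o_3,\ u_3\to o_1$, and at a negative crossing by $o_1\to u_3,\ o_2\to o_2,\ o_3\to u_2,\ u_1\to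 u_1,\ u_2\to o_1,\ u_3\to o_3$. A *dot* lies at each of the corners $u_2\to o_3$, $u_3\to o_1$ of positive crossings and $o_1\to u_3$, $o_3\to u_2$ of negative ones. **Closed and framed normal o-graphs.** A normal o-graph is *closed* if the boundary of the thickening $M(P)$ is a 2-sphere on which the vector field transverse to $P$ is tangent along a single circle. Combinatorially: going straight through all crossings one obtains a single curve; the number of circuits is the number of crossings plus one; and the boundary surface is connected, i.e. all sides (top, bottom) of 2-cells are related by the relation generated, along each edge, by top of line 3 $\sim$ top of line 2, bottom of line 3 $\sim$ bottom of line 1, top of line 1 $\sim$ bottom of line 2. A *framed integral normal o-graph* is a closed integral normal o-graph whose weight cochain $x$ satisfies $\delta x=c_P$, where $(\delta x)(\Delta)$ is the sum of the weights along $\partial\Delta$ with sign $+$ on lines $1,2$ and $-$ on line $3$, and $c_P(\Delta)=-(1-n_\Delta/2)$ with $n_\Delta$ the number of dots on $\partial\Delta$. A *framed normal o-graph* is the image of a framed integral normal o-graph under reduction of the weights mod 2. All moves below are defined on framed integral normal o-graphs; the corresponding *framed* move is the relation on framed normal o-graphs obtained by reducing the weights mod 2 before and after the move. **Local pictures.**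 A local picture with numbered strands is described by the signs of its crossings $0,1,\dots$ and, for each strand (separated by $\mid$), the succession of its passages, $o_i$ or $u_i$ meaning over or under at the crossing $i$ ($\emptyset$ if there is none). Weights are listed successively for the segments of each strand ($0$ alone: all weights are zero). A move replaces a local picture inside an arbitrary normal o-graph by another one, joining the ends of the strands to the outside in the same way; weights on the same edge are added. **The 16 integral MP moves** (all weights before the move are $0$; the weights after the move are given): - A1: $(+,+)\; u_1\mid u_0\mid o_0 o_1\ \longrightarrow\ (+,+,-)\; u_1 u_2\mid o_1 u_0 o_2\mid o_0$; weights $0$. - A2: $(+,-)\; u_1\mid u_0\mid o_0 o_1\ \longrightarrow\ (+,-,+)\; u_2 u_1\mid o_1 u_0 o_2\mid o_0$; weights $0,0,0\mid 0,0,-1,1\mid 0,0$. - A3: $(-,-)\; u_1\mid o_1 o_0\mid u_0\ \longrightarrow\ (-,-,+)\; u_2 u_1\mid o_0\mid o_2 u_0 o_1$; weights $0$. - A4: $(-,+)\; u_1\mid u_0\mid o_1 o_0\ \longrightarrow\ (-,+,-)\; u_1 u_2\mid o_2 u_0 o_1\mid o_0$; weights $0,-1,1\mid 0,0,0,0\mid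 0,0$. - B1: $(-,-)\; u_1 u_0\mid o_1\mid o_0\ \longrightarrow\ (+,-,-)\; u_2\mid u_1 o_2 u_0\mid o_1 o_0$; weights $0$. - B2: $(+,-)\; u_1 u_0\mid o_1\mid o_0\ \longrightarrow\ (-,+,-)\; u_2\mid u_1 o_2 u_0\mid o_0 o_1$; weights $0,0\mid 0,0,-1,1\mid 0,0,0$. - B3: $(+,+)\; u_0 u_1\mid o_1\mid o_0\ \longrightarrow\ (-,+,+)\; u_2\mid u_0 o_2 u_1\mid o_0 o_1$; weights $0$. - B4: $(-,+)\; u_0 u_1\mid o_0\mid o_1\ \longrightarrow\ (+,-,+)\; u_2\mid o_1 o_0\mid u_0 o_2 u_1$; weights $0,0\mid 0,-1,1\mid 0,0,0,0$. - C1: $(-,+)\; u_1\mid u_0 o_1\mid o_0\ \longrightarrow\ (-,+,+)\; u_1 u_2\mid o_2 u_0\mid o_1 o_0$; weights $0$. - C2: $(-,-)\; u_1\mid u_0 o_1\mid o_0\ \longrightarrow\ (-,-,-)\; u_2 u_1\mid o_2 u_0\mid o_1 o_0$; weights $0$. - C3: $(+,+)\; u_1\mid u_0 o_1\mid o_0\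 \longrightarrow\ (+,-,+)\; u_1 u_2\mid o_2 u_0\mid o_0 o_1$; weights $-1,1,0\mid 0,0,0\mid 0,0,0$. - C4: $(+,-)\; u_1\mid u_0 o_1\mid o_0\ \longrightarrow\ (+,+,-)\; u_2 u_1\mid o_2 u_0\mid o_0 o_1$; weights $0$. - D1: $(+,-)\; u_1\mid o_1 u_0\mid o_0\ \longrightarrow\ (+,-,-)\; u_2 u_1\mid u_0 o_2\mid o_0 o_1$; weights $0$. - D2: $(+,+)\; u_1\mid o_1 u_0\mid o_0\ \longrightarrow\ (+,+,+)\; u_1 u_2\mid u_0 o_2\mid o_0 o_1$; weights $0$. - D3: $(-,-)\; u_1\mid o_1 u_0\mid o_0\ \longrightarrow\ (-,+,-)\; u_2 u_1\mid u_0 o_2\mid o_1 o_0$; weights $0,0,0\mid 0,0,0\mid -1,1,0$. - D4: $(-,+)\; u_1\mid o_0\mid o_1 u_0\ \longrightarrow\ (-,-,+)\; u_1 u_2\mid o_1 o_0\mid u_0 o_2$; weights $0$. **The generating moves.** - *Primary integral MP move* (all weights $0$): $(+,+)\; o_0\mid o_1u_0\mid u_1\ \longrightarrow\ (+,+,+)\;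 o_0o_1\mid u_0o_2\mid u_1u_2$. - *Integral H-move*: at a crossing of any sign, increase by $1$ the weights of both incoming half-edges and decrease by $1$ those of both outgoing half-edges. - *Integral pure sliding moves* I, II, III, IV: the first picture consists of two strands $e_1,e_2$ without crossings, which are disjoint segments (possibly of the same edge) of weights $k,l$. The move is allowed if the line $i$ of $e_1$ and the line $j$ of $e_2$ belong to the same circuit, where $(i,j)=(3,2),(3,1),(1,2),(3,3)$, respectively. Follow the oriented boundary of this 2-cell after it leaves $e_1$ on line $i$ until it first arrives at $e_2$ on line $j$; let $p\in\frac12\mathbb Z$ be the sum of the signed weights of the segments strictly in between, minus half the number of dots on the way. Put $a=-p-\frac12$ for I, II and $a=-p-1$ for III, IV (an integer). The picture is replaced by - I: $(+,-)\; o_0o_1\mid u_0u_1$, weights $0,0,k\mid a,0,l-a$; - II: $(-,+)\; u_0u_1\mid o_0o_1$, weights $0,0,k\mid a,0,l-a$; - III: $(-,+)\; o_1o_0\mid u_0u_1$, weights $k,0,0\mid a,1,l-1-a$; - IV: $(+,-)\; u_0u_1\mid o_1o_0$, weights $0,0,k\mid l+1+a,-1,-a$. **Statement.** For each of the 16 types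 of MP moves there is a finite word, depending only on the type, in the primary framed MP move, the framed pure sliding moves I--IV, the framed H-move and their inverses, such that whenever a framed normal o-graph $\Gamma'$ is obtained from a framed normal o-graph $\Gamma$ by a framed MP move of this type, $\Gamma'$ is obtained from $\Gamma$ by performing successively moves of the kinds listed in the word, all intermediate objects being framed normal o-graphs. -/

import Mathlib

namespace OGraph

/-! ### Oriented virtual link diagrams and normal o-graphs

An oriented virtual link diagram is only considered modulo planar isotopy and the Reidemeister
type moves involving virtual crossings, i.e. only the following combinatorial data matter:
the set of real crossings with their signs, and the way in which the outgoing half-edges of the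
real crossings are joined to incoming half-edges.  Edges may moreover carry finitely many marked
points, which cut them into segments; inserting or erasing such points does not change the normal
o-graph, and the weight of an edge is the sum of the weights of its segments. -/

/-- The sign of a real crossing. -/
inductive Sign
  | pos
  | neg
  deriving DecidableEq

/-- The two strands passing through a real crossing. -/
inductive Strand
  | upper
  | lower
  deriving DecidableEq

/-- The ports of a diagram with crossings `X` and marked points `M`.  A port is both a place where
a segment may end (`inl (x, s)`: the incoming half of the strand `s` at the crossing `x`) and a
place where a segment starts (`inl (x, s)`: the outgoing half of the same strand).  Segments are
named after the port at which they start. -/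
abbrev Port (X M : Type) : Type := X × Strand ⊕ M

/-- An oriented virtual link diagram with `A`-weighted segments. The segment starting at `p` ends
at `next p`. -/
structure Diagram (A : Type) where
  X : Type
  M : Type
  finX : Finite X
  finM : Finite M
  sign : X → Sign
  next : Equiv.Perm (Port X M)
  weight : Port X M → A

namespace Diagram

variable {A B : Type}

/-- `D` and `D'` differ by a renaming of crossings and marked points. -/
def Iso (D D' : Diagram A) : Prop :=
  ∃ (f : D.X ≃ D'.X) (g : D.M ≃ D'.M),
    let ι : Port D.X D.M → Port D'.X D'.M := Sum.map (Prod.map f id) g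
    (∀ x, D'.sign (f x) = D.sign x) ∧ (∀ p, D'.next (ι p) = ι (D.next p)) ∧
      ∀ p, D'.weight (ι p) = D.weight p

/-- `D'` is obtained from `D` by inserting one new marked point `μ` in a segment `e`, whose weight
is distributed on the two resulting segments. -/
def Subdivides [Add A] (D D' : Diagram A) : Prop :=
  ∃ (f : D.X ≃ D'.X) (g : Option D.M ≃ D'.M) (e : Port D.X D.M),
    let ι : Port D.X D.M → Port D'.X D'.M := Sum.map (Prod.map f id) (fun m => g (some m))
    let μ : Port D'.X D'.M := Sum.inr (g none)
    (∀ x, D'.sign (f x) = D.sign x) ∧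
      D'.next (ι e) = μ ∧ D'.next μ = ι (D.next e) ∧ (∀ p, p ≠ e → D'.next (ι p) = ι (D.next p)) ∧
      D'.weight (ι e) + D'.weight μ = D.weight e ∧ ∀ p, p ≠ e → D'.weight (ι p) = D.weight p

/-- Two diagrams present the same normal o-graph if they are related by the equivalence relation
generated by `SameStep`. -/
def SameStep [Add A] (D D' : Diagram A) : Prop := Iso D D' ∨ Subdivides D D'

/-- Change of coefficients of the weights. -/
def map (φ : A → B) (D : Diagram A) : Diagram B :=
  { D with weight := fun p => φ (D.weight p) }

end Diagram

/-- Normal o-graphs with weights in `A` on the edges. -/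
def NormalOGraph (A : Type) [Add A] : Type 1 := Quot (Diagram.SameStep (A := A))

/-- The normal o-graph presented by a diagram. -/
def NormalOGraph.mk {A : Type} [Add A] (D : Diagram A) : NormalOGraph A := Quot.mk _ D

theorem Diagram.SameStep.map {A B : Type} [Add A] [Add B] (φ : A → B)
    (hφ : ∀ a b, φ (a + b) = φ a + φ b) {D D' : Diagram A} (h : Diagram.SameStep D D') :
    Diagram.SameStep (D.map φ) (D'.map φ) := by
  rcases h with ⟨f, g, h1, h2, h3⟩ | ⟨f, g, e, h1, h2, h3, h4, h5, h6⟩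
  · exact Or.inl ⟨f, g, h1, h2, fun p => congrArg φ (h3 p)⟩
  · exact Or.inr ⟨f, g, e, h1, h2, h3, h4, (hφ _ _).symm.trans (congrArg φ h5),
      fun p hp => congrArg φ (h6 p hp)⟩

/-- Reduction modulo 2 of the weights of an integral normal o-graph. -/
def NormalOGraph.reduce : NormalOGraph ℤ → NormalOGraph (ZMod 2) :=
  Quot.map (Diagram.map (fun k : ℤ => (k : ZMod 2)))
    (fun _ _ h => h.map _ (fun a b => Int.cast_add a b))

/-! ### The branched polyhedron of a diagram

A segment stands for a part of a triple line of the branched polyhedron, with its canonical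
orientation.  Three sheets meet along it: the *first* and the *second* line (`0`, `1 : Line`) stand
for the two sheets inducing its orientation, the *third* line (`2 : Line`) for the sheet inducing
the opposite orientation, numbered by the right-hand screw order.  The vector field crosses the
first sheet and then the second one, and it crosses the third one directly.

In the dual picture a crossing is a tetrahedron with ordered vertices `0 < 1 < 2 < 3`, its four
half-edges are the faces, and a sheet is a dual edge; along the face with vertices `a < b < c` the
first, second and third line are dual to `ab`, `bc` and `ac`.  With `F_i` the face opposite to the
vertex `i`, at a positive crossing the over-strand goes from `F_0` to `F_1` and the under-strand
from `F_2` to `F_3`; at a negative crossing both are reversed. -/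

/-- The three lines along a segment. -/
abbrev Line := Fin 3

open Sign Strand in
/-- The six sheets at a true vertex.  The boundary of a sheet, oriented by the sheet, arrives at
the vertex along the incoming half of a strand if it is on the first or second line, and along the
outgoing half, backwards, if it is on the third line; it leaves along the outgoing half on the
first or second line, or along the incoming half, backwards, on the third line.
`corner ε (s, i) = (s', j)` says that the boundary arriving on the line `i` of the strand `s` at a
vertex of sign `ε` leaves on the line `j` of the strand `s'`. -/
def corner : Sign → Strand × Line → Strand × Line
  | pos, (upper, 0) => (lower, 1)
  | pos, (upper, 1) => (upper, 1)
  | pos, (upper, 2) => (lower, 2)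
  | pos, (lower, 0) => (lower, 0)
  | pos, (lower, 1) => (upper, 2)
  | pos, (lower, 2) => (upper, 0)
  | neg, (upper, 0) => (lower, 2)
  | neg, (upper, 1) => (upper, 1)
  | neg, (upper, 2) => (lower, 1)
  | neg, (lower, 0) => (lower, 0)
  | neg, (lower, 1) => (upper, 0)
  | neg, (lower, 2) => (upper, 2)

namespace Diagram

variable {A : Type} (D : Diagram A)

/-- The positions on the circuit diagram: a line along a segment. The boundary of the sheet
traverses it in the direction of the segment for the first two lines, and backwards for the
third one. -/
abbrev Position : Type := Port D.X D.M × Line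

/-- The position following a given one along the oriented boundary of its 2-cell. -/
def step (a : D.Position) : D.Position :=
  let leave : Port D.X D.M → Line → D.Position :=
    fun q j => if j = 2 then (D.next.symm q, 2) else (q, j)
  match (if a.2 = 2 then a.1 else D.next a.1) with
  | Sum.inl (x, s) =>
      leave (Sum.inl (x, (corner (D.sign x) (s, a.2)).1)) (corner (D.sign x) (s, a.2)).2
  | Sum.inr m => leave (Sum.inr m) a.2

/-- The 2-cells of the branched polyhedron: the circuits of the circuit diagram. -/
def TwoCell : Type := Quot (fun a b : D.Position => D.step a = b)

/-- The number of solid dots (points where the reference vector field is tangent to the boundary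
of the 2-cell) between a position and the following one: one dot if the boundary passes from one of
the first two lines to the third line or conversely, none otherwise. -/
def dot (a : D.Position) : ℕ := if (a.2 = 2 ↔ (D.step a).2 = 2) then 0 else 1

/-- The two sides of a 2-cell: `top` is the side to which the vector field points. -/
inductive Side
  | top
  | bottom

/-- The boundary surface of the thickened polyhedron has one face for each side of each 2-cell.
Sides of 2-cells are adjacent if they are consecutive along one of the three edges of the boundary
surface parallel to a segment. -/
inductive BoundaryAdj : D.Position × Side → D.Position × Side → Prop
  | along (a : D.Position) (σ : Side) : BoundaryAdj (a, σ) (D.step a, σ)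
  | above (e : Port D.X D.M) : BoundaryAdj ((e, 2), Side.top) ((e, 1), Side.top)
  | below (e : Port D.X D.M) : BoundaryAdj ((e, 2), Side.bottom) ((e, 0), Side.bottom)
  | between (e : Port D.X D.M) : BoundaryAdj ((e, 0), Side.top) ((e, 1), Side.bottom)

/-- The diagram presents a closed branched polyhedron: the boundary of the thickened polyhedron is
a sphere (it is connected, and its Euler characteristic, twice that of the polyhedron, is `2`;
the polyhedron has as many 0-cells as crossings and twice as many 1-cells), on which the tangency
locus, which runs straight through all crossings, is a single circle. -/
def IsClosed : Prop :=
  (∀ a b, Relation.EqvGen D.BoundaryAdj a b) ∧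
    Nat.card D.TwoCell = Nat.card D.X + 1 ∧
    ∀ p q, D.next.SameCycle p q

end Diagram

namespace Diagram

variable (D : Diagram ℤ)

/-- The value of the cochain of weights on a position, with the sign of the direction in which the
boundary of the 2-cell traverses it. -/
def signedWeight (a : D.Position) : ℤ := if a.2 = 2 then -D.weight a.1 else D.weight a.1

/-- The value of the coboundary of the weights on the 2-cell through the position `a`. -/
noncomputable def coboundary (a : D.Position) : ℤ :=
  ∑ m ∈ Finset.range (Function.minimalPeriod D.step a), D.signedWeight (D.step^[m] a)

/-- The number of solid dots on the boundary of the 2-cell through the position `a`. -/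
noncomputable def dots (a : D.Position) : ℕ :=
  ∑ m ∈ Finset.range (Function.minimalPeriod D.step a), D.dot (D.step^[m] a)

/-- The value of the Euler cochain on the 2-cell through the position `a`. -/
noncomputable def eulerCochain (a : D.Position) : ℚ := -(1 - (D.dots a : ℚ) / 2)

/-- The diagram presents a framed integral normal o-graph: it is closed and the coboundary of the
weights is the Euler cochain. -/
def IsFramed : Prop := D.IsClosed ∧ ∀ a, (D.coboundary a : ℚ) = D.eulerCochain a

/-- The boundary of a 2-cell, leaving the position `a`, arrives for the first time at the position
`b` after `n` steps, and the rotation number on the way is `p`: the signed weights of the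
positions strictly in between, and `-1/2` for each solid dot. -/
def RotationBetween (a b : D.Position) (p : ℚ) : Prop :=
  ∃ n : ℕ, D.step^[n] a = b ∧ (∀ m < n, D.step^[m] a ≠ b) ∧
    p = (∑ m ∈ Finset.Ioo 0 n, (D.signedWeight (D.step^[m] a) : ℚ))
      - (∑ m ∈ Finset.range n, (D.dot (D.step^[m] a) : ℚ)) / 2

end Diagram

/-- Framed integral normal o-graphs. -/
def FramedIntegralNormalOGraph : Type 1 :=
  {Γ : NormalOGraph ℤ // ∃ D : Diagram ℤ, D.IsFramed ∧ NormalOGraph.mk D = Γ}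

/-- Framed normal o-graphs: the images of the framed integral ones under reduction modulo 2. -/
def FramedNormalOGraph : Type 1 :=
  {Γ : NormalOGraph (ZMod 2) // ∃ G : FramedIntegralNormalOGraph, NormalOGraph.reduce G.1 = Γ}

/-- The projection from framed integral normal o-graphs to framed normal o-graphs. -/
def FramedIntegralNormalOGraph.proj (G : FramedIntegralNormalOGraph) : FramedNormalOGraph :=
  ⟨NormalOGraph.reduce G.1, G, rfl⟩

/-! ### Local replacement -/

/-- A diagram with `n` distinguished marked points `0, …, n - 1`.  It is used in two ways: as the
outside of a local picture with `n` strands (the `k`-th distinguished point stands for the place of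
the `k`-th strand), and as the local picture itself (the `k`-th strand is cut out of the curve
through the `k`-th distinguished point by cutting at this point). -/
structure Tangle (A : Type) (n : ℕ) where
  X : Type
  M : Type
  finX : Finite X
  finM : Finite M
  sign : X → Sign
  next : Equiv.Perm (Port X (M ⊕ Fin n))
  weight : Port X (M ⊕ Fin n) → A

/-- Exchange of the distinguished points of the two sides of a glued diagram. -/
def swapHoles (M N : Type) (n : ℕ) : Equiv.Perm ((M ⊕ Fin n) ⊕ (N ⊕ Fin n)) where
  toFun
    | Sum.inl (Sum.inl m) => Sum.inl (Sum.inl m)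
    | Sum.inl (Sum.inr k) => Sum.inr (Sum.inr k)
    | Sum.inr (Sum.inl m) => Sum.inr (Sum.inl m)
    | Sum.inr (Sum.inr k) => Sum.inl (Sum.inr k)
  invFun
    | Sum.inl (Sum.inl m) => Sum.inl (Sum.inl m)
    | Sum.inl (Sum.inr k) => Sum.inr (Sum.inr k)
    | Sum.inr (Sum.inl m) => Sum.inr (Sum.inl m)
    | Sum.inr (Sum.inr k) => Sum.inl (Sum.inr k)
  left_inv := by rintro ((m | k) | (m | k)) <;> rfl
  right_inv := by rintro ((m | k) | (m | k)) <;> rfl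

/-- The ports of the disjoint union of two pictures. -/
def portSum (X Y M N : Type) : Port (X ⊕ Y) (M ⊕ N) ≃ Port X M ⊕ Port Y N :=
  (Equiv.sumCongr (Equiv.sumProdDistrib X Y Strand) (Equiv.refl (M ⊕ N))).trans
    (Equiv.sumSumSumComm (X × Strand) (Y × Strand) M N)

/-- Insertion of the local picture `T` in the outside `C`: a segment of `C` ending at its `k`-th
distinguished point is continued by the `k`-th strand of `T`, and the end of this strand by the
segment of `C` starting at the `k`-th distinguished point. In the result, the `k`-th strand of `T`
starts at the marked point `inr (inr k)` and ends at the marked point `inl (inr k)`. -/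
def Tangle.glue {A : Type} {n : ℕ} (C T : Tangle A n) : Diagram A where
  X := C.X ⊕ T.X
  M := (C.M ⊕ Fin n) ⊕ (T.M ⊕ Fin n)
  finX := by have := C.finX; have := T.finX; infer_instance
  finM := by have := C.finM; have := T.finM; infer_instance
  sign := Sum.elim C.sign T.sign
  next := Equiv.sumCongr (Equiv.refl _) (swapHoles C.M T.M n) *
    (portSum C.X T.X (C.M ⊕ Fin n) (T.M ⊕ Fin n)).symm.permCongr (Equiv.sumCongr C.next T.next)
  weight p := Sum.elim C.weight T.weight (portSum C.X T.X (C.M ⊕ Fin n) (T.M ⊕ Fin n) p)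

/-- The first segment of the `k`-th strand of `T` in `C.glue T`. -/
def Tangle.firstSegment {A : Type} {n : ℕ} (C T : Tangle A n) (k : Fin n) :
    Port (C.glue T).X (C.glue T).M :=
  Sum.inr (Sum.inr (Sum.inr k))

/-- The local picture with `c` crossings of the given signs and `n` strands, the `k`-th of which
runs successively through the crossings listed in `word k`; the successive segments of the `k`-th
strand carry the weights listed in `wt k` (missing entries are `0`). Every strand of every crossing
has to occur exactly once in the words. -/
def Tangle.ofWords {n c : ℕ} (sign : Fin c → Sign) (word : Fin n → List (Fin c × Strand))
    (wt : Fin n → List ℤ) : Tangle ℤ n where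
  X := Fin c
  M := Empty
  finX := inferInstance
  finM := inferInstance
  sign := sign
  next := (List.ofFn fun k : Fin n =>
    List.formPerm (Sum.inr (Sum.inr k) :: (word k).map Sum.inl :
      List (Port (Fin c) (Empty ⊕ Fin n)))).prod
  weight
    | Sum.inl x => ∑ k, if x ∈ word k then (wt k).getD ((word k).idxOf x + 1) 0 else 0
    | Sum.inr (Sum.inl m) => m.elim
    | Sum.inr (Sum.inr k) => (wt k).getD 0 0

/-- The integral move replacing the local picture `L` by the local picture `R`. -/
def IntegralMove {n : ℕ} (L R : Tangle ℤ n) (G G' : FramedIntegralNormalOGraph) : Prop :=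
  ∃ C : Tangle ℤ n, G.1 = NormalOGraph.mk (C.glue L) ∧ G'.1 = NormalOGraph.mk (C.glue R)

/-- The framed move obtained by projection of an integral move. -/
def Framed (R : FramedIntegralNormalOGraph → FramedIntegralNormalOGraph → Prop) :
    FramedNormalOGraph → FramedNormalOGraph → Prop :=
  Relation.Map R FramedIntegralNormalOGraph.proj FramedIntegralNormalOGraph.proj

/-! ### The 16 MP moves

The moves are dual to the 2-3 moves on triangulations with ordered vertices: two tetrahedra sharing
a face are replaced by three tetrahedra sharing an edge, and all five vertices are ordered by the
branching.  These are 20 moves, of which exactly 16 join the ends of the three strands in the same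
way before and after. The weights are zero for the moves in which the new triangular region is not
cyclically oriented (all but `A2`, `A4`, `B2`, `B4`, `C3`, `D3`). -/

/-- The names of the 16 MP moves. -/
inductive MPType
  | A1 | A2 | A3 | A4 | B1 | B2 | B3 | B4 | C1 | C2 | C3 | C4 | D1 | D2 | D3 | D4

/-- The two local pictures of an MP move, with three strands; the weights before the move are
zero. -/
structure MPData where
  leftSign : Fin 2 → Sign
  leftWord : Fin 3 → List (Fin 2 × Strand)
  rightSign : Fin 3 → Sign
  rightWord : Fin 3 → List (Fin 3 × Strand)
  rightWeight : Fin 3 → List ℤ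

open Strand in
/-- The 16 MP moves. -/
def MPType.data : MPType → MPData
  | .A1 => {
      leftSign := ![.pos, .pos]
      leftWord := ![[(1, lower)], [(0, lower)], [(0, upper), (1, upper)]]
      rightSign := ![.pos, .pos, .neg]
      rightWord := ![[(1, lower), (2, lower)], [(1, upper), (0, lower), (2, upper)], [(0, upper)]]
      rightWeight := fun _ => [] }
  | .A2 => {
      leftSign := ![.pos, .neg]
      leftWord := ![[(1, lower)], [(0, lower)], [(0, upper), (1, upper)]]
      rightSign := ![.pos, .neg, .pos]
      rightWord := ![[(2, lower), (1, lower)], [(1, upper), (0, lower), (2, upper)], [(0, upper)]]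
      rightWeight := ![[0, 0, 0], [0, 0, -1, 1], [0, 0]] }
  | .A3 => {
      leftSign := ![.neg, .neg]
      leftWord := ![[(1, lower)], [(1, upper), (0, upper)], [(0, lower)]]
      rightSign := ![.neg, .neg, .pos]
      rightWord := ![[(2, lower), (1, lower)], [(0, upper)], [(2, upper), (0, lower), (1, upper)]]
      rightWeight := fun _ => [] }
  | .A4 => {
      leftSign := ![.neg, .pos]
      leftWord := ![[(1, lower)], [(0, lower)], [(1, upper), (0, upper)]]
      rightSign := ![.neg, .pos, .neg]
      rightWord := ![[(1, lower), (2, lower)], [(2, upper), (0, lower), (1, upper)], [(0, upper)]]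
      rightWeight := ![[0, -1, 1], [0, 0, 0, 0], [0, 0]] }
  | .B1 => {
      leftSign := ![.neg, .neg]
      leftWord := ![[(1, lower), (0, lower)], [(1, upper)], [(0, upper)]]
      rightSign := ![.pos, .neg, .neg]
      rightWord := ![[(2, lower)], [(1, lower), (2, upper), (0, lower)], [(1, upper), (0, upper)]]
      rightWeight := fun _ => [] }
  | .B2 => {
      leftSign := ![.pos, .neg]
      leftWord := ![[(1, lower), (0, lower)], [(1, upper)], [(0, upper)]]
      rightSign := ![.neg, .pos, .neg]
      rightWord := ![[(2, lower)], [(1, lower), (2, upper), (0, lower)], [(0, upper), (1, upper)]]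
      rightWeight := ![[0, 0], [0, 0, -1, 1], [0, 0, 0]] }
  | .B3 => {
      leftSign := ![.pos, .pos]
      leftWord := ![[(0, lower), (1, lower)], [(1, upper)], [(0, upper)]]
      rightSign := ![.neg, .pos, .pos]
      rightWord := ![[(2, lower)], [(0, lower), (2, upper), (1, lower)], [(0, upper), (1, upper)]]
      rightWeight := fun _ => [] }
  | .B4 => {
      leftSign := ![.neg, .pos]
      leftWord := ![[(0, lower), (1, lower)], [(0, upper)], [(1, upper)]]
      rightSign := ![.pos, .neg, .pos]
      rightWord := ![[(2, lower)], [(1, upper), (0, upper)], [(0, lower), (2, upper), (1, lower)]]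
      rightWeight := ![[0, 0], [0, -1, 1], [0, 0, 0, 0]] }
  | .C1 => {
      leftSign := ![.neg, .pos]
      leftWord := ![[(1, lower)], [(0, lower), (1, upper)], [(0, upper)]]
      rightSign := ![.neg, .pos, .pos]
      rightWord := ![[(1, lower), (2, lower)], [(2, upper), (0, lower)], [(1, upper), (0, upper)]]
      rightWeight := fun _ => [] }
  | .C2 => {
      leftSign := ![.neg, .neg]
      leftWord := ![[(1, lower)], [(0, lower), (1, upper)], [(0, upper)]]
      rightSign := ![.neg, .neg, .neg]
      rightWord := ![[(2, lower), (1, lower)], [(2, upper), (0, lower)], [(1, upper), (0, upper)]]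
      rightWeight := fun _ => [] }
  | .C3 => {
      leftSign := ![.pos, .pos]
      leftWord := ![[(1, lower)], [(0, lower), (1, upper)], [(0, upper)]]
      rightSign := ![.pos, .neg, .pos]
      rightWord := ![[(1, lower), (2, lower)], [(2, upper), (0, lower)], [(0, upper), (1, upper)]]
      rightWeight := ![[-1, 1, 0], [0, 0, 0], [0, 0, 0]] }
  | .C4 => {
      leftSign := ![.pos, .neg]
      leftWord := ![[(1, lower)], [(0, lower), (1, upper)], [(0, upper)]]
      rightSign := ![.pos, .pos, .neg]
      rightWord := ![[(2, lower), (1, lower)], [(2, upper), (0, lower)], [(0, upper), (1, upper)]]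
      rightWeight := fun _ => [] }
  | .D1 => {
      leftSign := ![.pos, .neg]
      leftWord := ![[(1, lower)], [(1, upper), (0, lower)], [(0, upper)]]
      rightSign := ![.pos, .neg, .neg]
      rightWord := ![[(2, lower), (1, lower)], [(0, lower), (2, upper)], [(0, upper), (1, upper)]]
      rightWeight := fun _ => [] }
  | .D2 => {
      leftSign := ![.pos, .pos]
      leftWord := ![[(1, lower)], [(1, upper), (0, lower)], [(0, upper)]]
      rightSign := ![.pos, .pos, .pos]
      rightWord := ![[(1, lower), (2, lower)], [(0, lower), (2, upper)], [(0, upper), (1, upper)]]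
      rightWeight := fun _ => [] }
  | .D3 => {
      leftSign := ![.neg, .neg]
      leftWord := ![[(1, lower)], [(1, upper), (0, lower)], [(0, upper)]]
      rightSign := ![.neg, .pos, .neg]
      rightWord := ![[(2, lower), (1, lower)], [(0, lower), (2, upper)], [(1, upper), (0, upper)]]
      rightWeight := ![[0, 0, 0], [0, 0, 0], [-1, 1, 0]] }
  | .D4 => {
      leftSign := ![.neg, .pos]
      leftWord := ![[(1, lower)], [(0, upper)], [(1, upper), (0, lower)]]
      rightSign := ![.neg, .neg, .pos]
      rightWord := ![[(1, lower), (2, lower)], [(1, upper), (0, upper)], [(0, lower), (2, upper)]]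
      rightWeight := fun _ => [] }

/-- The integral MP moves. -/
def IntegralMP (t : MPType) : FramedIntegralNormalOGraph → FramedIntegralNormalOGraph → Prop :=
  IntegralMove (Tangle.ofWords t.data.leftSign t.data.leftWord fun _ => [])
    (Tangle.ofWords t.data.rightSign t.data.rightWord t.data.rightWeight)

/-- The framed MP moves. -/
def FramedMP (t : MPType) : FramedNormalOGraph → FramedNormalOGraph → Prop :=
  Framed (IntegralMP t)

/-! ### The generating moves -/

open Strand in
/-- The primary integral MP move: all crossings are positive and all weights zero.  On the left the
second strand passes over the third one and then under the first one; on the right the first strand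
passes over the second one (crossing `0`), then over the third one (crossing `1`), and the second
strand then passes over the third one (crossing `2`). -/
def IntegralPrimaryMP : FramedIntegralNormalOGraph → FramedIntegralNormalOGraph → Prop :=
  IntegralMove
    (Tangle.ofWords (n := 3) (c := 2) (fun _ => Sign.pos)
      ![[(0, upper)], [(1, upper), (0, lower)], [(1, lower)]] fun _ => [])
    (Tangle.ofWords (n := 3) (c := 3) (fun _ => Sign.pos)
      ![[(0, upper), (1, upper)], [(0, lower), (2, upper)], [(1, lower), (2, lower)]] fun _ => [])

open Strand in
/-- The integral H-move: the weights of the two incoming half-edges of a crossing are increased by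
one, and those of the two outgoing half-edges are decreased by one. -/
def IntegralH (G G' : FramedIntegralNormalOGraph) : Prop :=
  ∃ ε : Sign, IntegralMove
    (Tangle.ofWords (n := 2) (c := 1) (fun _ => ε) ![[(0, upper)], [(0, lower)]] fun _ => [])
    (Tangle.ofWords (n := 2) (c := 1) (fun _ => ε) ![[(0, upper)], [(0, lower)]] fun _ => [1, -1])
    G G'

/-- The names of the four pure sliding moves. -/
inductive SlideType
  | I | II | III | IV

/-- The line on the left strand which is connected to `SlideType.rightLine` on the right strand,
for the pure sliding move to be possible. -/
def SlideType.leftLine : SlideType → Line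
  | I => 2
  | II => 2
  | III => 0
  | IV => 2

/-- See `SlideType.leftLine`. -/
def SlideType.rightLine : SlideType → Line
  | I => 1
  | II => 0
  | III => 1
  | IV => 2

/-- Two strands, the left one (number `0`) and the right one (number `1`), without crossings, and
with weights `k` and `l`. -/
def slideLeft (k l : ℤ) : Tangle ℤ 2 :=
  Tangle.ofWords (n := 2) (c := 0) Fin.elim0 (fun _ => []) ![[k], [l]]

open Sign Strand SlideType in
/-- The picture after a pure sliding move; the crossing `0` is the bottom one and the crossing `1`
the top one. Both strands go up in `I` and `II`; the left one goes down and the right one up in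
`III`, and conversely in `IV`. The integer `a` is determined by the rotation number of the framing
along the part of the boundary of the 2-cell outside the picture. -/
def slideRight (t : SlideType) (k l a : ℤ) : Tangle ℤ 2 :=
  match t with
  | I => Tangle.ofWords (n := 2) (c := 2) ![pos, neg]
      ![[(0, upper), (1, upper)], [(0, lower), (1, lower)]] ![[0, 0, k], [a, 0, l - a]]
  | II => Tangle.ofWords (n := 2) (c := 2) ![neg, pos]
      ![[(0, lower), (1, lower)], [(0, upper), (1, upper)]] ![[0, 0, k], [a, 0, l - a]]
  | III => Tangle.ofWords (n := 2) (c := 2) ![neg, pos]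
      ![[(1, upper), (0, upper)], [(0, lower), (1, lower)]] ![[k, 0, 0], [a, 1, l - 1 - a]]
  | IV => Tangle.ofWords (n := 2) (c := 2) ![pos, neg]
      ![[(0, lower), (1, lower)], [(1, upper), (0, upper)]] ![[0, 0, k], [l + 1 + a, -1, -a]]

/-- The integer `a` in terms of the rotation number `p` from the bottom of the left strand to the
bottom of the right strand. -/
def SlideType.IsShift (t : SlideType) (p : ℚ) (a : ℤ) : Prop :=
  match t with
  | I => (a : ℚ) = -p - 1 / 2
  | II => (a : ℚ) = -p - 1 / 2
  | III => (a : ℚ) = -p - 1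
  | IV => (a : ℚ) = -p - 1

/-- The integral pure sliding moves. The condition that the line `leftLine` of the left strand and
the line `rightLine` of the right strand belong to the same circuit is part of
`RotationBetween`. -/
def IntegralSlide (t : SlideType) (G G' : FramedIntegralNormalOGraph) : Prop :=
  ∃ (C : Tangle ℤ 2) (k l a : ℤ) (p : ℚ),
    (C.glue (slideLeft k l)).RotationBetween
        (C.firstSegment (slideLeft k l) 0, t.leftLine)
        (C.firstSegment (slideLeft k l) 1, t.rightLine) p ∧
      t.IsShift p a ∧
      G.1 = NormalOGraph.mk (C.glue (slideLeft k l)) ∧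
      G'.1 = NormalOGraph.mk (C.glue (slideRight t k l a))

/-- The names of the generating moves. -/
inductive Generator
  | primaryMP
  | slide (t : SlideType)
  | H

/-- The generating framed moves. -/
def Generator.move : Generator → FramedNormalOGraph → FramedNormalOGraph → Prop
  | primaryMP => Framed IntegralPrimaryMP
  | slide t => Framed (IntegralSlide t)
  | H => Framed IntegralH

/-- `Derives w Γ Γ'`: the framed normal o-graph `Γ'` is obtained from `Γ` by performing
successively the generating moves (`true`) or inverses of generating moves (`false`) listed in
`w`. -/
def Derives : List (Generator × Bool) → FramedNormalOGraph → FramedNormalOGraph → Prop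
  | [], Γ, Γ' => Γ = Γ'
  | (g, true) :: w, Γ, Γ' => ∃ Γ₁, g.move Γ Γ₁ ∧ Derives w Γ₁ Γ'
  | (g, false) :: w, Γ, Γ' => ∃ Γ₁, g.move Γ₁ Γ ∧ Derives w Γ₁ Γ'

end OGraph

namespace OGraph

/-! ### Orbits of an injective self-map of a finite type -/

section Orbits

variable {α β : Type*}

/-! A pure sliding move on two segments of the left picture of an MP move `t` creates two crossings
of opposite signs. If the segments are chosen well, one of the new crossings and the two old ones
form the right picture of another MP move `u`. Undoing `u` leaves its left picture and the second
new crossing, and this is the right picture of `t`, up to an H-move at that crossing in three cases.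
So `t` is a slide, then `u` inverted, then possibly H inverted. The primary move is `D2` with its
strands renumbered. From `D2` one obtains `A1`, `B3`, `C3`; from `A1`, `C4`; from `B3`, `C1`; from
`C4`, `D1` and (with H) `B2`; from `C1`, `D4` and (with H) `A4`; from `D1`, `A2` and `B1`; from
`D4`, `A3` and `B4`; from `A3`, `C2`; from `C2` (with H), `D3`.

Two points need more than pictures. First, a slide is not local: its shift `a` is read off from a
circuit of the whole diagram. In each case, however, the two lines are joined by a path inside the
left picture of `t`. If the path runs from the left strand to the right one, it gives the rotation
number at once. If it runs the other way, the complementary arc is known, since every circuit of a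
framed diagram has total rotation number `-1` (`Tangle.IsRun.rotationBetween`).

Second, all intermediate objects must be framed, and whether a slide preserves this is a global
question. It is avoided by propagating framedness backwards from the end of the sequence, which is
framed by assumption: MP moves and H-moves, read forwards, preserve framedness. This is what
`Tangle.Links` records. Preservation under a local replacement is `Tangle.HasShadow.isFramed_glue`:
seen from outside, a picture matters only through the way it joins entries of circuits to exits, the
rotation numbers inside, the ends of its strands and the adjacency of sides. An MP move changes none
of these, and it adds one crossing and one closed circuit of rotation number `-1`. The hypotheses
are finite and are checked by computation.

The argument runs with integral weights throughout. A framed move is by definition the projection of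
an integral one, so the reduction mod 2 enters only at the end. -/

theorem iterate_of_eqvGen [Finite α] {s : α → α} (hs : s.Injective) {a b : α}
    (h : Relation.EqvGen (fun x y => s x = y) a b) : ∃ n, s^[n] a = b := by
  induction h with
  | rel x y h => exact ⟨1, h⟩
  | refl x => exact ⟨0, rfl⟩
  | symm x y _ ih =>
    obtain ⟨n, rfl⟩ := ih
    obtain ⟨m, hm, hp⟩ := hs.mem_periodicPts x
    -- With `m` a period of `x`, running `m * n` steps returns to `x`; after the first `n` of them,
    -- `m * n - n` remain.
    refine ⟨m * n - n, ?_⟩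
    rw [← Function.iterate_add_apply, Nat.sub_add_cancel (Nat.le_mul_of_pos_left n hm)]
    exact (hp.mul_const n)
  | trans x y z _ _ ih₁ ih₂ =>
    obtain ⟨n, rfl⟩ := ih₁
    obtain ⟨m, rfl⟩ := ih₂
    exact ⟨m + n, Function.iterate_add_apply s m n x⟩

theorem quot_mk_eq_iff [Finite α] {s : α → α} (hs : s.Injective) {a b : α} :
    Quot.mk (fun x y => s x = y) a = Quot.mk (fun x y => s x = y) b ↔ ∃ n, s^[n] a = b := by
  rw [Quot.eq]
  refine ⟨iterate_of_eqvGen hs, ?_⟩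
  rintro ⟨n, rfl⟩
  induction n with
  | zero => exact Relation.EqvGen.refl _
  | succ n ih =>
    refine ih.trans _ _ _ (Relation.EqvGen.rel _ _ ?_)
    rw [Function.iterate_succ_apply']

theorem quot_mk_iterate {s : α → α} (a : α) (n : ℕ) :
    Quot.mk (fun x y => s x = y) (s^[n] a) = Quot.mk (fun x y => s x = y) a := by
  induction n with
  | zero => rfl
  | succ n ih =>
    rw [← ih, Function.iterate_succ_apply']
    exact (Quot.sound (r := fun x y => s x = y) rfl).symm

open Classical in
-- The iterates before the minimal period list the orbit once each. A sum over all points with an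
-- indicator of the orbit, unlike a sum over iterates, can be regrouped when the dynamical system
-- changes.
theorem sum_range_minimalPeriod [Fintype α] {s : α → α} (hs : s.Injective) (φ : α → ℤ) (a : α) :
    ∑ m ∈ Finset.range (Function.minimalPeriod s a), φ (s^[m] a) =
      ∑ b, if Quot.mk (fun x y => s x = y) b = Quot.mk (fun x y => s x = y) a then φ b else 0 := by
  rw [← Finset.sum_filter]
  refine Finset.sum_bij (fun m _ => s^[m] a) ?_ ?_ ?_ ?_
  · intro m _
    simp [quot_mk_iterate]
  · intro m hm n hn h
    exact Function.iterate_injOn_Iio_minimalPeriod (by simpa using hm) (by simpa using hn) h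
  · intro b hb
    obtain ⟨n, rfl⟩ := (quot_mk_eq_iff hs).1 (Finset.mem_filter.1 hb).2.symm
    refine ⟨n % Function.minimalPeriod s a, ?_, Function.iterate_mod_minimalPeriod_eq⟩
    rw [Finset.mem_range]
    exact Nat.mod_lt _ (Function.minimalPeriod_pos_of_mem_periodicPts (hs.mem_periodicPts a))
  · intros; rfl

/-- A relation is connected if it generates the universal equivalence relation. -/
def Connected (r : α → α → Prop) : Prop := ∀ a b, Relation.EqvGen r a b

theorem eqvGen_lift {r : α → α → Prop} {r' : β → β → Prop} (h : α → β)
    (hr : ∀ a b, r a b → Relation.EqvGen r' (h a) (h b)) {a b : α} (hab : Relation.EqvGen r a b) :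
    Relation.EqvGen r' (h a) (h b) := by
  induction hab with
  | rel x y hxy => exact hr x y hxy
  | refl x => exact Relation.EqvGen.refl _
  | symm x y _ ih => exact ih.symm
  | trans x y z _ _ ih₁ ih₂ => exact ih₁.trans _ _ _ ih₂

/-- A map that sends related points to connected ones and meets every class of the target carries
connectedness over. It need not be injective or surjective, so segments may be merged and whole
strands contracted. -/
theorem Connected.transfer {r : α → α → Prop} {r' : β → β → Prop} (hc : Connected r) (h : α → β)
    (hr : ∀ a b, r a b → Relation.EqvGen r' (h a) (h b))
    (hs : ∀ b, ∃ a, Relation.EqvGen r' b (h a)) : Connected r' := by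
  intro b b'
  obtain ⟨a, ha⟩ := hs b
  obtain ⟨a', ha'⟩ := hs b'
  exact ha.trans _ _ _ ((eqvGen_lift h hr (hc a a')).trans _ _ _ ha'.symm)

/-- Puts the condition of a single curve in the same form as the connectedness of the boundary
surface, so that `Connected.transfer` serves both. -/
theorem connected_next_iff {α : Type*} (f : Equiv.Perm α) :
    (∀ p q, f.SameCycle p q) ↔ Connected (fun p q => f p = q) := by
  constructor
  · intro h p q
    obtain ⟨n, rfl⟩ := h p q
    have key : ∀ (n : ℕ) (p : α), Relation.EqvGen (fun p q => f p = q) p ((f ^ n) p) := by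
      intro n p
      induction n with
      | zero => exact Relation.EqvGen.refl _
      | succ n ih =>
        refine ih.trans _ _ _ (Relation.EqvGen.rel _ _ ?_)
        rw [pow_succ', Equiv.Perm.mul_apply]
    cases n with
    | ofNat n => exact key n p
    | negSucc n =>
      have := key (n + 1) ((f ^ (Int.negSucc n)) p)
      rw [zpow_negSucc] at this ⊢
      simpa using this.symm
  · intro h p q
    induction h p q with
    | rel x y hxy => exact ⟨1, by simpa using hxy⟩
    | refl x => exact Equiv.Perm.SameCycle.refl _ _
    | symm x y _ ih => exact ih.symm
    | trans x y z _ _ ih₁ ih₂ => exact ih₁.trans ih₂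

end Orbits

/-! ### First return maps -/

/-- `R` is the first return map of `s` to the subset `ι`, and `out` sends a point to the first
point of the subset on its orbit. -/
structure IsReturn {α β : Type*} (s : α → α) (R : β → β) (ι : β → α) (out : α → Option β) :
    Prop where
  out_incl : ∀ b, out (ι b) = some b
  out_step_incl : ∀ b, out (s (ι b)) = some (R b)
  out_step : ∀ a, a ∉ Set.range ι → out (s a) = out a
  reach : ∀ a b, out a = some b → ∃ n, s^[n] a = ι b

namespace IsReturn

variable {α β : Type*} {s : α → α} {R : β → β} {ι : β → α} {out : α → Option β}

/-- The orbit of the first return map contained in an orbit, if there is one. -/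
def quotMap (h : IsReturn s R ι out) :
    Quot (fun x y => s x = y) → Option (Quot (fun x y => R x = y)) :=
  Quot.lift (fun a => (out a).map (Quot.mk _)) (by
    rintro a _ rfl
    by_cases ha : a ∈ Set.range ι
    · obtain ⟨b, rfl⟩ := ha
      simp only [h.out_incl, h.out_step_incl, Option.map_some]
      exact congrArg some (Quot.sound rfl)
    · simp only [h.out_step a ha])

theorem quotMap_mk (h : IsReturn s R ι out) (a : α) :
    h.quotMap (Quot.mk _ a) = (out a).map (Quot.mk _) := rfl

theorem mk_eq_of_out (h : IsReturn s R ι out) {a : α} {b : β} (ha : out a = some b) :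
    Quot.mk (fun x y => s x = y) a = Quot.mk (fun x y => s x = y) (ι b) := by
  obtain ⟨n, hn⟩ := h.reach a b ha
  rw [← hn, quot_mk_iterate]

/-- The orbit containing an orbit of the first return map. -/
def quotIncl (h : IsReturn s R ι out) :
    Quot (fun x y => R x = y) → Quot (fun x y => s x = y) :=
  Quot.lift (fun b => Quot.mk _ (ι b)) (by
    rintro b _ rfl
    refine (Quot.sound (r := fun x y => s x = y) (rfl : s (ι b) = s (ι b))).trans ?_
    exact h.mk_eq_of_out (h.out_step_incl b))

theorem quotMap_quotIncl (h : IsReturn s R ι out) (r) : h.quotMap (h.quotIncl r) = some r := by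
  induction r using Quot.ind with
  | mk b => simp [quotIncl, quotMap_mk, h.out_incl]

/-- `quotMap` is a partial inverse of `quotIncl`: orbits of the return map are the same as orbits
that meet the subset. -/
theorem quotMap_eq_some (h : IsReturn s R ι out) {q r} :
    h.quotMap q = some r ↔ q = h.quotIncl r := by
  constructor
  · induction q using Quot.ind with
    | mk a =>
      intro hq
      rw [quotMap_mk, Option.map_eq_some_iff] at hq
      obtain ⟨b, hb, rfl⟩ := hq
      exact h.mk_eq_of_out hb
  · rintro rfl
    exact h.quotMap_quotIncl r

theorem quotIncl_injective (h : IsReturn s R ι out) : Function.Injective h.quotIncl := by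
  intro r r' hr
  have := h.quotMap_quotIncl r
  rw [hr, h.quotMap_quotIncl] at this
  exact (Option.some.inj this).symm

open Classical in
-- Each point of an orbit is charged to the first point of the subset which it reaches; `ψ` collects
-- these charges, and summing over the fibres of `out` gives the orbit sum.
theorem sum_quotIncl [Fintype α] [Fintype β] (h : IsReturn s R ι out) (φ : α → ℤ) (ψ : β → ℤ)
    (hψ : ∀ b, ψ b = ∑ a, if out a = some b then φ a else 0) (r) :
    (∑ a, if Quot.mk (fun x y => s x = y) a = h.quotIncl r then φ a else 0) =
      ∑ b, if Quot.mk (fun x y => R x = y) b = r then ψ b else 0 := by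
  have h1 : ∀ b, (if Quot.mk (fun x y => R x = y) b = r then ψ b else 0) =
      ∑ a, if out a = some b ∧ Quot.mk (fun x y => R x = y) b = r then φ a else 0 := by
    intro b
    by_cases hb : Quot.mk (fun x y => R x = y) b = r <;> simp [hb, hψ]
  simp only [h1]
  rw [Finset.sum_comm]
  refine Finset.sum_congr rfl fun a _ => ?_
  simp only [← h.quotMap_eq_some, quotMap_mk]
  cases out a with
  | none => simp
  | some b =>
    rw [Finset.sum_eq_single b]
    · simp
    · intro b' _ hb'
      simp [hb'.symm]
    · simp

theorem card_quot (h : IsReturn s R ι out) (hout : ∀ a, out a ≠ none) :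
    Nat.card (Quot (fun x y => s x = y)) = Nat.card (Quot (fun x y => R x = y)) := by
  refine (Nat.card_congr (Equiv.ofBijective h.quotIncl ⟨h.quotIncl_injective, ?_⟩)).symm
  intro q
  induction q using Quot.ind with
  | mk a =>
    obtain ⟨b, hb⟩ := Option.ne_none_iff_exists'.1 (hout a)
    exact ⟨Quot.mk _ b, (h.mk_eq_of_out hb).symm⟩

/-- All orbits missing the subset coincide with that of `a₀`, so `quotMap` is a bijection onto the
orbits of the return map with one element adjoined. -/
theorem card_quot_add_one [Finite β] (h : IsReturn s R ι out) (a₀ : α) (h₀ : out a₀ = none)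
    (hout : ∀ a, out a = none → ∃ n, s^[n] a₀ = a) :
    Nat.card (Quot (fun x y => s x = y)) = Nat.card (Quot (fun x y => R x = y)) + 1 := by
  have : Finite (Quot (fun x y => R x = y)) := inferInstance
  rw [← Finite.card_option]
  refine Nat.card_congr (Equiv.ofBijective h.quotMap ⟨?_, ?_⟩)
  · intro q q' hq
    cases hr : h.quotMap q with
    | some r =>
      exact (h.quotMap_eq_some.1 hr).trans (h.quotMap_eq_some.1 (hq.symm.trans hr)).symm
    | none =>
      have key : ∀ q, h.quotMap q = none → q = Quot.mk _ a₀ := by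
        intro q hq
        induction q using Quot.ind with
        | mk a =>
          rw [quotMap_mk, Option.map_eq_none_iff] at hq
          obtain ⟨n, rfl⟩ := hout a hq
          exact quot_mk_iterate a₀ n
      exact (key q hr).trans (key q' (hq.symm.trans hr)).symm
  · intro r
    cases r with
    | none => exact ⟨Quot.mk _ a₀, by simp [quotMap_mk, h₀]⟩
    | some r => exact ⟨_, h.quotMap_quotIncl r⟩

end IsReturn


/-! ### The circuits of a diagram -/

/-- Passing through a port along the boundary of a 2-cell. -/
def turn {X M : Type} (sign : X → Sign) : Port X M × Line → Port X M × Line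
  | (Sum.inl (x, s), i) =>
      (Sum.inl (x, (corner (sign x) (s, i)).1), (corner (sign x) (s, i)).2)
  | (Sum.inr m, i) => (Sum.inr m, i)

/-- The port at which the boundary of a 2-cell arrives along a segment, with the line. -/
def arrive {P : Type} (next : Equiv.Perm P) (a : P × Line) : P × Line :=
  (if a.2 = 2 then a.1 else next a.1, a.2)

/-- The segment along which the boundary of a 2-cell leaves a port, with the line. -/
def leave {P : Type} (next : Equiv.Perm P) (a : P × Line) : P × Line :=
  if a.2 = 2 then (next.symm a.1, 2) else a

theorem corner_injective (ε : Sign) : Function.Injective (corner ε) := by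
  rintro ⟨s, i⟩ ⟨s', i'⟩
  revert i i'
  cases ε <;> cases s <;> cases s' <;> decide

theorem turn_injective {X M : Type} (sign : X → Sign) :
    Function.Injective (turn (M := M) sign) := by
  rintro ⟨⟨x, s⟩ | m, i⟩ ⟨⟨x', s'⟩ | m', i'⟩ h
  · simp only [turn, Prod.mk.injEq, Sum.inl.injEq] at h
    obtain ⟨⟨rfl, h1⟩, h2⟩ := h
    have := corner_injective _ (Prod.ext h1 h2)
    simp_all
  · simp [turn] at h
  · simp [turn] at h
  · simpa [turn] using h

theorem arrive_injective {P : Type} (next : Equiv.Perm P) : Function.Injective (arrive next) := by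
  rintro ⟨p, i⟩ ⟨p', i'⟩ h
  simp only [arrive, Prod.mk.injEq] at h
  obtain ⟨h, rfl⟩ := h
  by_cases hi : i = 2 <;> simp_all

theorem leave_injective {P : Type} (next : Equiv.Perm P) : Function.Injective (leave next) := by
  rintro ⟨p, i⟩ ⟨p', i'⟩ h
  by_cases hi : i = 2 <;> by_cases hi' : i' = 2 <;> simp_all [leave]

theorem leave_snd {P : Type} (next : Equiv.Perm P) (a : P × Line) : (leave next a).2 = a.2 := by
  by_cases h : a.2 = 2 <;> simp [leave, h]

namespace Diagram

/-- Arriving at a port, turning there and leaving are three injective maps. This yields injectivity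
of `step`, and hence its orbits are cycles. -/
theorem step_eq {A : Type} (D : Diagram A) (a : D.Position) :
    D.step a = leave D.next (turn D.sign (arrive D.next a)) := by
  obtain ⟨p, i⟩ := a
  unfold step arrive
  generalize (if (p, i).2 = 2 then (p, i).1 else D.next (p, i).1) = q
  rcases q with ⟨x, s⟩ | m <;> simp only [turn, leave] <;> split_ifs with h <;> simp_all

theorem step_injective {A : Type} (D : Diagram A) : Function.Injective D.step := by
  have : D.step = leave D.next ∘ turn D.sign ∘ arrive D.next := funext D.step_eq
  rw [this]
  exact (leave_injective _).comp ((turn_injective _).comp (arrive_injective _))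

instance {A : Type} (D : Diagram A) : Finite D.X := D.finX
instance {A : Type} (D : Diagram A) : Finite D.M := D.finM

end Diagram

instance : Finite Strand :=
  Finite.of_injective (fun s : Strand => decide (s = Strand.upper)) (by
    intro s s'; cases s <;> cases s' <;> simp)

/-! ### Framedness as a condition on orbits, and its invariance under renaming and subdivision -/

namespace Diagram

noncomputable instance {A : Type} (D : Diagram A) : Fintype D.Position := Fintype.ofFinite _

/-- Twice the rotation number of a step along the boundary of a 2-cell. -/
def rot (D : Diagram ℤ) (a : D.Position) : ℤ := 2 * D.signedWeight a - D.dot a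

/-- Doubling clears the half dots: `δx = -(1 - n/2)` becomes `2 δx - n = -2`, an integral condition
on the sum of `rot` along the circuit. -/
theorem coboundary_eq_eulerCochain_iff (D : Diagram ℤ) (a : D.Position) :
    ((D.coboundary a : ℚ) = D.eulerCochain a) ↔
      ∑ m ∈ Finset.range (Function.minimalPeriod D.step a), D.rot (D.step^[m] a) = -2 := by
  have h : ∑ m ∈ Finset.range (Function.minimalPeriod D.step a), D.rot (D.step^[m] a) =
      2 * D.coboundary a - D.dots a := by
    simp only [rot, coboundary, dots, Finset.sum_sub_distrib, Finset.mul_sum, Nat.cast_sum]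
  rw [h, eulerCochain]
  constructor
  · intro h
    have : (2 * D.coboundary a - D.dots a : ℚ) = -2 := by rw [h]; ring
    exact_mod_cast this
  · intro h
    have : (2 * D.coboundary a - D.dots a : ℚ) = -2 := by exact_mod_cast h
    linarith

open Classical in
/-- Every circuit has rotation number `-1`. -/
def Balanced (D : Diagram ℤ) : Prop :=
  ∀ q : D.TwoCell, (∑ a, if Quot.mk (fun a b => D.step a = b) a = q then D.rot a else 0) = -2

/-- All four conditions are now statements about orbits or generated equivalence relations, which
first return maps can transport. -/
theorem isFramed_iff (D : Diagram ℤ) : D.IsFramed ↔ Connected D.BoundaryAdj ∧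
    Nat.card D.TwoCell = Nat.card D.X + 1 ∧ Connected (fun p q => D.next p = q) ∧ D.Balanced := by
  unfold IsFramed IsClosed
  rw [connected_next_iff, and_assoc, and_assoc]
  refine and_congr Iff.rfl (and_congr Iff.rfl (and_congr Iff.rfl ?_))
  simp only [coboundary_eq_eulerCochain_iff, sum_range_minimalPeriod D.step_injective]
  constructor
  · intro h q
    induction q using Quot.ind with
    | mk a => exact h a
  · intro h a
    exact h (Quot.mk _ a)

theorem eqvGen_boundaryAdj_iterate {A : Type} (D : Diagram A) (a : D.Position) (σ : Side) (n : ℕ) :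
    Relation.EqvGen D.BoundaryAdj (a, σ) (D.step^[n] a, σ) := by
  induction n with
  | zero => exact Relation.EqvGen.refl _
  | succ n ih =>
    rw [Function.iterate_succ_apply']
    exact ih.trans _ _ _ (Relation.EqvGen.rel _ _ (BoundaryAdj.along _ _))

open Classical in
/-- Invariance of framedness for a diagram `D'` whose segments are grouped by `κ'` into the
segments of a diagram `D`. -/
theorem isFramed_iff_of_isReturn {D D' : Diagram ℤ} (hX : Nat.card D.X = Nat.card D'.X)
    (κ : Port D.X D.M → Port D'.X D'.M) (κ' : Port D'.X D'.M → Port D.X D.M)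
    (ret : D.Position → D'.Position)
    (hret : IsReturn D'.step D.step ret (fun a => some (κ' a.1, a.2)))
    (hrot : ∀ b, D.rot b = ∑ a, if some (κ' a.1, a.2) = some b then D'.rot a else 0)
    (hκ : ∀ p, κ' (κ p) = p)
    (hn : ∀ p, Relation.EqvGen (fun p q => D'.next p = q) (κ p) (κ (D.next p)))
    (hn' : ∀ p, Relation.EqvGen (fun p q => D.next p = q) (κ' p) (κ' (D'.next p)))
    (hs : ∀ p, Relation.EqvGen (fun p q => D'.next p = q) p (κ (κ' p))) :
    D.IsFramed ↔ D'.IsFramed := by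
  have hcard : Nat.card D'.TwoCell = Nat.card D.TwoCell := hret.card_quot (by simp)
  have hlink : ∀ (p : Port D.X D.M) (j : Line) (σ : Side),
      Relation.EqvGen D'.BoundaryAdj ((κ p, j), σ) (ret (p, j), σ) := by
    intro p j σ
    obtain ⟨n, hn⟩ := hret.reach (κ p, j) (p, j) (by simp [hκ])
    rw [← hn]
    exact D'.eqvGen_boundaryAdj_iterate _ _ _
  have hout : ∀ a, ∃ n, D'.step^[n] a = ret (κ' a.1, a.2) := fun a => hret.reach a _ rfl
  have hbd : Connected D.BoundaryAdj ↔ Connected D'.BoundaryAdj := by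
    constructor
    · intro h
      refine h.transfer (fun b => (ret b.1, b.2)) ?_ ?_
      · intro a b hab
        cases hab with
        | along a σ =>
          obtain ⟨n, hn⟩ := hret.reach (D'.step (ret a)) (D.step a) (hret.out_step_incl a)
          refine (Relation.EqvGen.rel _ _ (BoundaryAdj.along (ret a) σ)).trans _ _ _ ?_
          simp only [← hn]
          exact D'.eqvGen_boundaryAdj_iterate _ _ _
        | above e =>
          exact ((hlink e 2 _).symm _ _).trans _ _ _
            ((Relation.EqvGen.rel _ _ (BoundaryAdj.above (κ e))).trans _ _ _ (hlink e 1 _))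
        | below e =>
          exact ((hlink e 2 _).symm _ _).trans _ _ _
            ((Relation.EqvGen.rel _ _ (BoundaryAdj.below (κ e))).trans _ _ _ (hlink e 0 _))
        | between e =>
          exact ((hlink e 0 _).symm _ _).trans _ _ _
            ((Relation.EqvGen.rel _ _ (BoundaryAdj.between (κ e))).trans _ _ _ (hlink e 1 _))
      · rintro ⟨a, σ⟩
        obtain ⟨n, hn⟩ := hout a
        refine ⟨((κ' a.1, a.2), σ), ?_⟩
        simp only [← hn]
        exact D'.eqvGen_boundaryAdj_iterate _ _ _
    · intro h
      refine h.transfer (fun b => ((κ' b.1.1, b.1.2), b.2)) ?_ ?_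
      · intro a b hab
        cases hab with
        | along a σ =>
          by_cases ha : a ∈ Set.range ret
          · obtain ⟨b, rfl⟩ := ha
            have h1 := Option.some.inj (hret.out_incl b)
            have h2 := Option.some.inj (hret.out_step_incl b)
            simp only [h1, h2]
            exact Relation.EqvGen.rel _ _ (BoundaryAdj.along b σ)
          · have h1 := Option.some.inj (hret.out_step a ha)
            simp only [h1]
            exact Relation.EqvGen.refl _
        | above e => exact Relation.EqvGen.rel _ _ (BoundaryAdj.above (κ' e))
        | below e => exact Relation.EqvGen.rel _ _ (BoundaryAdj.below (κ' e))
        | between e => exact Relation.EqvGen.rel _ _ (BoundaryAdj.between (κ' e))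
      · rintro ⟨⟨p, j⟩, σ⟩
        refine ⟨((κ p, j), σ), ?_⟩
        simp only [hκ]
        exact Relation.EqvGen.refl _
  have hnext : Connected (fun p q => D.next p = q) ↔ Connected (fun p q => D'.next p = q) := by
    constructor
    · intro h
      refine h.transfer κ ?_ fun p => ⟨κ' p, hs p⟩
      rintro p _ rfl
      exact hn p
    · intro h
      refine h.transfer κ' ?_ fun p => ⟨κ p, by rw [hκ]; exact Relation.EqvGen.refl _⟩
      rintro p _ rfl
      exact hn' p
  have hbal : D.Balanced ↔ D'.Balanced := by
    have key := hret.sum_quotIncl D'.rot D.rot (fun b => by convert hrot b)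
    constructor
    · intro h q
      have : ∃ r, q = hret.quotIncl r := by
        cases hr : hret.quotMap q with
        | some r => exact ⟨r, hret.quotMap_eq_some.1 hr⟩
        | none =>
          induction q using Quot.ind with
          | mk a => simp [IsReturn.quotMap_mk] at hr
      obtain ⟨r, rfl⟩ := this
      exact (key r).trans (h r)
    · intro h r
      exact (key r).symm.trans (h _)
  rw [isFramed_iff, isFramed_iff, hbd, hcard, hX, hnext, hbal]

theorem turn_map {X Y M N : Type} {sX : X → Sign} {sY : Y → Sign} (f : X → Y) (g : M → N)
    (h : ∀ x, sY (f x) = sX x) (a : Port X M × Line) :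
    turn sY (Prod.map (Sum.map (Prod.map f id) g) id a) =
      Prod.map (Sum.map (Prod.map f id) g) id (turn sX a) := by
  obtain ⟨⟨x, s⟩ | m, i⟩ := a <;> simp [turn, h]

theorem step_rename {A B : Type} {D : Diagram A} {D' : Diagram B} (f : D.X ≃ D'.X) (g : D.M ≃ D'.M)
    (hsign : ∀ x, D'.sign (f x) = D.sign x)
    (hnext : ∀ p, D'.next (Sum.map (Prod.map f id) g p) = Sum.map (Prod.map f id) g (D.next p))
    (a : D.Position) :
    D'.step (Prod.map (Sum.map (Prod.map f id) g) id a) =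
      Prod.map (Sum.map (Prod.map f id) g) id (D.step a) := by
  have hsymm : ∀ p, D'.next.symm (Sum.map (Prod.map f id) g p) =
      Sum.map (Prod.map f id) g (D.next.symm p) := by
    intro p
    rw [Equiv.symm_apply_eq, hnext, Equiv.apply_symm_apply]
  have h1 : arrive D'.next (Prod.map (Sum.map (Prod.map f id) g) id a) =
      Prod.map (Sum.map (Prod.map f id) g) id (arrive D.next a) := by
    by_cases h : a.2 = 2 <;> simp [arrive, h, hnext]
  rw [step_eq, step_eq, h1, turn_map f g hsign]
  generalize turn D.sign (arrive D.next a) = c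
  by_cases h : c.2 = 2 <;> simp [leave, h, hsymm, Prod.map]

open Classical in
theorem Iso.isFramed_iff {D D' : Diagram ℤ} (h : Iso D D') : D.IsFramed ↔ D'.IsFramed := by
  obtain ⟨f, g, hsign, hnext, hweight⟩ := h
  set ι : Port D.X D.M ≃ Port D'.X D'.M :=
    Equiv.sumCongr (Equiv.prodCongr f (Equiv.refl _)) g with hι
  have hι' : ∀ p, Sum.map (Prod.map f id) g p = ι p := by
    rintro (⟨x, s⟩ | m) <;> rfl
  have hstep : ∀ b : D.Position, D'.step (ι b.1, b.2) = (ι (D.step b).1, (D.step b).2) := by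
    intro b
    simpa only [Prod.map, hι', id] using step_rename f g hsign hnext b
  simp only [hι'] at hnext hweight
  refine isFramed_iff_of_isReturn (Nat.card_congr f) ι ι.symm (fun b => (ι b.1, b.2)) ?_ ?_
    (by simp) ?_ ?_ ?_
  · refine ⟨by simp, by simp [hstep], ?_, ?_⟩
    · rintro ⟨p, j⟩ ha
      exact absurd ⟨(ι.symm p, j), by simp⟩ ha
    · rintro ⟨p, j⟩ b hb
      refine ⟨0, ?_⟩
      rw [← Option.some.inj hb]
      simp
  · intro b
    rw [Finset.sum_eq_single (ι b.1, b.2)]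
    · simp only [Equiv.symm_apply_apply, if_true]
      simp only [rot, signedWeight, dot, hstep, hweight]
    · rintro ⟨p, j⟩ _ hb
      rw [if_neg]
      rintro h
      apply hb
      rw [← Option.some.inj h]
      simp
    · simp
  · intro p
    exact Relation.EqvGen.rel _ _ (hnext p)
  · intro p
    refine Relation.EqvGen.rel _ _ ?_
    obtain ⟨p, rfl⟩ := ι.surjective p
    simp [hnext]
  · intro p
    simp only [Equiv.apply_symm_apply]
    exact Relation.EqvGen.refl _

open Classical in
-- On each line the two halves of the divided segment are passed consecutively, with no dot in
-- between, and their weights add up. Hence the circuits of `D` are first returns of those of `D'`.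
theorem Subdivides.isFramed_iff {D D' : Diagram ℤ} (h : Subdivides D D') :
    D.IsFramed ↔ D'.IsFramed := by
  obtain ⟨f, g, e, hsign, hn1, hn2, hn3, hw1, hw2⟩ := h
  set ι : Port D.X D.M → Port D'.X D'.M := Sum.map (Prod.map f id) (fun m => g (some m)) with hι
  set μ : Port D'.X D'.M := Sum.inr (g none) with hμ
  have hιinj : Function.Injective ι := by
    rintro (⟨x, s⟩ | m) (⟨x', s'⟩ | m') h <;> simp_all
  have hιμ : ∀ p, ι p ≠ μ := by
    rintro (⟨x, s⟩ | m) <;> simp [hι, hμ]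
  have hcases : ∀ q, q = μ ∨ ∃ p, q = ι p := by
    rintro (⟨x, s⟩ | m)
    · exact Or.inr ⟨Sum.inl (f.symm x, s), by simp [hι]⟩
    · obtain ⟨m, rfl⟩ := g.surjective m
      cases m with
      | none => exact Or.inl rfl
      | some m => exact Or.inr ⟨Sum.inr m, rfl⟩
  have hs1 : D'.next.symm μ = ι e := by rw [Equiv.symm_apply_eq, hn1]
  have hs2 : ∀ q, D'.next.symm (ι q) = if D.next.symm q = e then μ else ι (D.next.symm q) := by
    intro q
    rw [Equiv.symm_apply_eq]
    split_ifs with h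
    · rw [hn2, ← h, Equiv.apply_symm_apply]
    · rw [hn3 _ h, Equiv.apply_symm_apply]
  obtain ⟨κ', hκι, hκμ⟩ : ∃ κ' : Port D'.X D'.M → Port D.X D.M, (∀ p, κ' (ι p) = p) ∧ κ' μ = e := by
    refine ⟨fun q => if h : ∃ p, q = ι p then h.choose else e, fun p => ?_, ?_⟩
    · have h : ∃ p', ι p = ι p' := ⟨p, rfl⟩
      simp only [h, dif_pos]
      exact hιinj h.choose_spec.symm
    · have h : ¬ ∃ p, μ = ι p := by
        rintro ⟨p, hp⟩
        exact hιμ p hp.symm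
      simp only [h, dif_neg, not_false_eq_true]
  have hcard : Nat.card D.X = Nat.card D'.X := Nat.card_congr f
  -- The half that is passed last: `μ` on the first two lines, `ι e` on the third line, which runs
  -- backwards. The step and the dot after it are those of `D`.
  set ret : D.Position → D'.Position :=
    fun b => if b.1 = e ∧ b.2 ≠ 2 then (μ, b.2) else (ι b.1, b.2)
    with hret
  have hturn : ∀ b : D.Position, turn D'.sign (ι b.1, b.2) =
      (ι (turn D.sign b).1, (turn D.sign b).2) := turn_map f _ hsign
  have harr : ∀ b : D.Position, arrive D'.next (ret b) =
      (ι (arrive D.next b).1, (arrive D.next b).2) := by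
    rintro ⟨p, j⟩
    by_cases hj : j = 2
    · simp [hret, arrive, hj]
    · by_cases hp : p = e
      · simp [hret, arrive, hj, hp, hn2]
      · simp [hret, arrive, hj, hp, hn3]
  have hleave : ∀ c : D.Position, κ' (leave D'.next (ι c.1, c.2)).1 = (leave D.next c).1 := by
    rintro ⟨p, j⟩
    by_cases hj : j = 2
    · simp only [hj, leave, if_true, hs2]
      split_ifs with h
      · rw [hκμ, h]
      · rw [hκι]
    · simp [leave, hj, hκι]
  have hstep : ∀ b : D.Position, (κ' (D'.step (ret b)).1, (D'.step (ret b)).2) = D.step b := by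
    intro b
    rw [step_eq, step_eq, harr, hturn]
    exact Prod.ext (hleave _) (by rw [leave_snd, leave_snd])
  have hstep1 : ∀ j : Line, j ≠ 2 → D'.step (ι e, j) = (μ, j) := by
    intro j hj
    rw [step_eq]
    simp [arrive, hj, hn1, hμ, turn, leave]
  have hstep2 : D'.step (μ, 2) = (ι e, 2) := by
    rw [step_eq]
    have : turn D'.sign (μ, 2) = (μ, 2) := rfl
    simp [arrive, leave, this, hs1]
  have hposn : ∀ a : D'.Position, (∃ b, a = ret b) ∨ (∃ j : Line, j ≠ 2 ∧ a = (ι e, j)) ∨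
      a = (μ, 2) := by
    rintro ⟨q, j⟩
    rcases hcases q with rfl | ⟨p, rfl⟩
    · by_cases hj : j = 2
      · exact Or.inr (Or.inr (by rw [hj]))
      · exact Or.inl ⟨(e, j), by simp [hret, hj]⟩
    · by_cases hp : p = e ∧ j ≠ 2
      · exact Or.inr (Or.inl ⟨j, hp.2, by rw [hp.1]⟩)
      · exact Or.inl ⟨(p, j), by simp only [hret, if_neg hp]⟩
  have hout : ∀ b : D.Position, (κ' (ret b).1, (ret b).2) = b := by
    rintro ⟨p, j⟩
    by_cases hp : p = e ∧ j ≠ 2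
    · simp only [hret]
      rw [if_pos hp]
      exact Prod.ext (hκμ.trans hp.1.symm) rfl
    · simp only [hret, if_neg hp, hκι]
  have hnr1 : ∀ j : Line, j ≠ 2 → (ι e, j) ∉ Set.range ret := by
    rintro j hj ⟨b, hb⟩
    have h1 := hout b
    rw [hb, hκι] at h1
    rw [← h1] at hb
    simp only [hret, ne_eq, hj, not_false_eq_true, and_self, if_true, Prod.mk.injEq, and_true] at hb
    exact hιμ _ hb.symm
  have hnr2 : (μ, 2) ∉ Set.range ret := by
    rintro ⟨b, hb⟩
    have h1 := hout b
    rw [hb, hκμ] at h1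
    rw [← h1] at hb
    simp only [hret, ne_eq, not_true_eq_false, and_false, if_false, Prod.mk.injEq, and_true] at hb
    exact hιμ _ hb
  have hdot : ∀ b, D'.dot (ret b) = D.dot b := by
    intro b
    have h1 := congrArg Prod.snd (hout b)
    have h2 := congrArg Prod.snd (hstep b)
    simp only at h1 h2
    simp only [dot, h1, h2]
  refine isFramed_iff_of_isReturn hcard ι κ' ret ?_ ?_ hκι ?_ ?_ ?_
  · refine ⟨fun b => congrArg some (hout b), fun b => congrArg some (hstep b), ?_, ?_⟩
    · intro a ha
      rcases hposn a with ⟨b, rfl⟩ | ⟨j, hj, rfl⟩ | rfl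
      · exact absurd ⟨b, rfl⟩ ha
      · simp [hstep1 j hj, hκμ, hκι]
      · simp [hstep2, hκμ, hκι]
    · intro a b hb
      replace hb := Option.some.inj hb
      rcases hposn a with ⟨b', rfl⟩ | ⟨j, hj, rfl⟩ | rfl
      · rw [hout] at hb
        exact ⟨0, by rw [hb]; rfl⟩
      · rw [hκι] at hb
        exact ⟨1, by simp [hstep1 j hj, ← hb, hret, hj]⟩
      · rw [hκμ] at hb
        exact ⟨1, by simp [hstep2, ← hb, hret]⟩
  · rintro ⟨p, j⟩
    by_cases hp : p = e
    · subst hp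
      have h2 : ∀ q, (some (κ' q.1, q.2) = some (p, j)) ↔ (q = (ι p, j) ∨ q = (μ, j)) := by
        rintro ⟨q, i⟩
        rw [Option.some_inj, Prod.mk.injEq, Prod.mk.injEq, Prod.mk.injEq]
        rcases hcases q with rfl | ⟨q, rfl⟩
        · simp [hκμ, (hιμ _).symm]
        · simp [hκι, hιμ, hιinj.eq_iff]
      simp only [h2]
      have h3 : ((ι p, j) : D'.Position) ≠ (μ, j) := by
        intro h
        exact hιμ _ (congrArg Prod.fst h)
      rw [← Finset.sum_filter, Finset.filter_or, Finset.filter_eq', Finset.filter_eq',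
        if_pos (Finset.mem_univ _), if_pos (Finset.mem_univ _), Finset.sum_union (by simpa using h3),
        Finset.sum_singleton, Finset.sum_singleton]
      have h4 := hdot (p, j)
      by_cases hj : j = 2
      · subst hj
        have h5 : D'.dot (μ, 2) = 0 := by simp [dot, hstep2]
        have h6 : ret (p, 2) = (ι p, 2) := by simp [hret]
        rw [h6] at h4
        simp only [rot, signedWeight, if_true, h4, h5, ← hw1]
        push_cast
        ring
      · have h5 : D'.dot (ι p, j) = 0 := by simp [dot, hstep1 j hj]
        have h6 : ret (p, j) = (μ, j) := by simp [hret, hj]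
        rw [h6] at h4
        simp only [rot, signedWeight, if_neg hj, h4, h5, ← hw1]
        push_cast
        ring
    · have h6 : ret (p, j) = (ι p, j) := by simp [hret, hp]
      rw [Finset.sum_eq_single (ret (p, j))]
      · rw [if_pos (congrArg some (hout _))]
        simp only [rot, hdot]
        simp only [h6, signedWeight, hw2 p hp]
      · rintro a _ ha
        rw [if_neg]
        intro h
        rw [Option.some_inj, Prod.mk.injEq] at h
        rcases hposn a with ⟨b', rfl⟩ | ⟨j', hj', rfl⟩ | rfl
        · apply ha
          rw [← hout b']
          simp only [h.1, h.2]
        · exact hp ((hκι e).symm.trans h.1).symm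
        · exact hp (hκμ.symm.trans h.1).symm
      · simp
  · intro p
    by_cases hp : p = e
    · subst hp
      exact (Relation.EqvGen.rel (r := fun p q => D'.next p = q) _ _ hn1).trans _ _ _
        (Relation.EqvGen.rel _ _ hn2)
    · exact Relation.EqvGen.rel _ _ (hn3 p hp)
  · intro q
    rcases hcases q with rfl | ⟨p, rfl⟩
    · rw [hn2, hκμ, hκι]
      exact Relation.EqvGen.rel _ _ rfl
    · by_cases hp : p = e
      · subst hp
        rw [hn1, hκμ, hκι]
        exact Relation.EqvGen.refl _
      · rw [hn3 p hp, hκι, hκι]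
        exact Relation.EqvGen.rel _ _ rfl
  · intro q
    rcases hcases q with rfl | ⟨p, rfl⟩
    · rw [hκμ]
      exact (Relation.EqvGen.rel (r := fun p q => D'.next p = q) _ _ hn1).symm
    · rw [hκι]
      exact Relation.EqvGen.refl _

end Diagram

/-- Framedness of a normal o-graph asks for one framed diagram; by invariance, every diagram
presenting it is framed, in particular the one in which a local picture is visible. -/
theorem NormalOGraph.isFramed_iff_of_mk_eq {D D' : Diagram ℤ}
    (h : NormalOGraph.mk D = NormalOGraph.mk D') : D.IsFramed ↔ D'.IsFramed := by
  have h' := Quot.eqvGen_exact h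
  clear h
  induction h' with
  | rel D D' h => exact h.elim Diagram.Iso.isFramed_iff Diagram.Subdivides.isFramed_iff
  | refl => exact Iff.rfl
  | symm _ _ _ ih => exact ih.symm
  | trans _ _ _ _ _ ih₁ ih₂ => exact ih₁.trans ih₂


/-! ### Circuits through a local picture -/

namespace Tangle

variable {A : Type} {n : ℕ}

/-- The positions on the circuit diagram of a local picture. -/
abbrev Pos (T : Tangle A n) : Type := Port T.X (T.M ⊕ Fin n) × Line

instance (T : Tangle A n) : Finite T.X := T.finX
instance (T : Tangle A n) : Finite T.M := T.finM

/-- The distinguished point of a strand. -/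
def hole (T : Tangle A n) (k : Fin n) : Port T.X (T.M ⊕ Fin n) := Sum.inr (Sum.inr k)

/-- One step along the boundary of a 2-cell inside a local picture; `inr (k, j)` means that the
boundary leaves the picture along the line `j` of the `k`-th strand. -/
def lstep (T : Tangle A n) (a : T.Pos) : T.Pos ⊕ (Fin n × Line) :=
  match arrive T.next a with
  | (Sum.inl x, j) => Sum.inl (leave T.next (turn T.sign (Sum.inl x, j)))
  | (Sum.inr (Sum.inl m), j) => Sum.inl (leave T.next (Sum.inr (Sum.inl m), j))
  | (Sum.inr (Sum.inr k), j) => Sum.inr (k, j)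

/-- The first position inside the picture of the boundary of a 2-cell entering it. -/
def entry (T : Tangle A n) (e : Fin n × Line) : T.Pos := leave T.next (T.hole e.1, e.2)

/-- The last position inside the picture of the boundary of a 2-cell leaving it. -/
def last (T : Tangle A n) (e : Fin n × Line) : T.Pos :=
  if e.2 = 2 then (T.hole e.1, 2) else (T.next.symm (T.hole e.1), e.2)

theorem lstep_last (T : Tangle A n) (e : Fin n × Line) : T.lstep (T.last e) = Sum.inr e := by
  obtain ⟨k, j⟩ := e
  by_cases h : j = 2 <;> simp [lstep, last, arrive, h, hole]

theorem eq_last_of_lstep (T : Tangle A n) {a : T.Pos} {e : Fin n × Line}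
    (h : T.lstep a = Sum.inr e) : a = T.last e := by
  obtain ⟨p, j⟩ := a
  obtain ⟨k, i⟩ := e
  unfold lstep at h
  generalize hq : arrive T.next (p, j) = q at h
  rcases q with ⟨x | m | k', j'⟩ <;> simp only [reduceCtorEq, Sum.inr.injEq, Prod.mk.injEq] at h
  obtain ⟨rfl, rfl⟩ := h
  by_cases hj : j = 2
  · simp only [arrive, hj, if_true, Prod.mk.injEq] at hq
    obtain ⟨rfl, rfl⟩ := hq
    simp [last, hole, hj]
  · simp only [arrive, hj, if_false, Prod.mk.injEq] at hq
    obtain ⟨hq, rfl⟩ := hq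
    simp [last, hole, hj, ← hq]

section glue

variable (C T : Tangle A n)

/-- A port of the outside, as a port of the glued diagram. -/
def inC : Port C.X (C.M ⊕ Fin n) → Port (C.glue T).X (C.glue T).M :=
  Sum.map (Prod.map Sum.inl id) Sum.inl

/-- A port of the inside, as a port of the glued diagram. -/
def inT : Port T.X (T.M ⊕ Fin n) → Port (C.glue T).X (C.glue T).M :=
  Sum.map (Prod.map Sum.inr id) Sum.inr

/-- The end of a segment of the outside, as a port of the glued diagram. -/
def endC : Port C.X (C.M ⊕ Fin n) → Port (C.glue T).X (C.glue T).M
  | Sum.inl x => C.inC T (Sum.inl x)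
  | Sum.inr (Sum.inl m) => C.inC T (Sum.inr (Sum.inl m))
  | Sum.inr (Sum.inr k) => C.inT T (T.hole k)

/-- The end of a segment of the inside, as a port of the glued diagram. -/
def endT : Port T.X (T.M ⊕ Fin n) → Port (C.glue T).X (C.glue T).M
  | Sum.inl x => C.inT T (Sum.inl x)
  | Sum.inr (Sum.inl m) => C.inT T (Sum.inr (Sum.inl m))
  | Sum.inr (Sum.inr k) => C.inC T (C.hole k)

theorem glue_next_inC (p) : (C.glue T).next (C.inC T p) = C.endC T (C.next p) := by
  have h : (C.glue T).next (C.inC T p) = Sum.map id (swapHoles C.M T.M n)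
      ((portSum C.X T.X (C.M ⊕ Fin n) (T.M ⊕ Fin n)).symm (Sum.inl (C.next p))) := by
    rcases p with ⟨x, s⟩ | m | k <;> rfl
  rw [h]
  generalize C.next p = q
  rcases q with ⟨x, s⟩ | m | k <;> rfl

theorem glue_next_inT (p) : (C.glue T).next (C.inT T p) = C.endT T (T.next p) := by
  have h : (C.glue T).next (C.inT T p) = Sum.map id (swapHoles C.M T.M n)
      ((portSum C.X T.X (C.M ⊕ Fin n) (T.M ⊕ Fin n)).symm (Sum.inr (T.next p))) := by
    rcases p with ⟨x, s⟩ | m | k <;> rfl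
  rw [h]
  generalize T.next p = q
  rcases q with ⟨x, s⟩ | m | k <;> rfl

theorem glue_next_symm_endC (q) :
    (C.glue T).next.symm (C.endC T q) = C.inC T (C.next.symm q) := by
  rw [Equiv.symm_apply_eq, glue_next_inC, Equiv.apply_symm_apply]

theorem glue_next_symm_endT (q) :
    (C.glue T).next.symm (C.endT T q) = C.inT T (T.next.symm q) := by
  rw [Equiv.symm_apply_eq, glue_next_inT, Equiv.apply_symm_apply]

/-- A position of the outside, as a position of the glued diagram. -/
def posC (a : C.Pos) : (C.glue T).Position := (C.inC T a.1, a.2)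

/-- A position of the inside, as a position of the glued diagram. -/
def posT (a : T.Pos) : (C.glue T).Position := (C.inT T a.1, a.2)

theorem turn_inC (a : C.Pos) :
    turn (C.glue T).sign (C.posC T a) = C.posC T (turn C.sign a) := by
  obtain ⟨⟨x, s⟩ | m, i⟩ := a <;> rfl

theorem turn_inT (a : T.Pos) :
    turn (C.glue T).sign (C.posT T a) = C.posT T (turn T.sign a) := by
  obtain ⟨⟨x, s⟩ | m, i⟩ := a <;> rfl

theorem turn_fst_hole {X M : Type} (sign : X → Sign) (x : X × Strand) (i : Line) :
    ∃ y, (turn (M := M) sign (Sum.inl x, i)).1 = Sum.inl y := ⟨_, rfl⟩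

/-- The swapped distinguished points join the two sides: a boundary leaving the outside along a line
of strand `k` enters the inside along the same line of strand `k`. -/
theorem step_posC (a : C.Pos) : (C.glue T).step (C.posC T a) =
    Sum.elim (C.posC T) (fun e => C.posT T (T.entry e)) (C.lstep a) := by
  have key : ∀ c : C.Pos, (∀ k, c.1 ≠ C.hole k) →
      leave (C.glue T).next (C.posC T c) = C.posC T (leave C.next c) := by
    rintro ⟨x | m | k, j⟩ hc
    · have : (C.glue T).next.symm (C.inC T (Sum.inl x)) = C.inC T (C.next.symm (Sum.inl x)) :=
        glue_next_symm_endC C T (Sum.inl x)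
      by_cases hj : j = 2
      · simpa [leave, posC, hj] using this
      · simp [leave, posC, hj]
    · have : (C.glue T).next.symm (C.inC T (Sum.inr (Sum.inl m))) =
        C.inC T (C.next.symm (Sum.inr (Sum.inl m))) :=
        glue_next_symm_endC C T (Sum.inr (Sum.inl m))
      by_cases hj : j = 2
      · simpa [leave, posC, hj] using this
      · simp [leave, posC, hj]
    · exact absurd rfl (hc k)
  have harr : arrive (C.glue T).next (C.posC T a) =
      (if a.2 = 2 then C.inC T (arrive C.next a).1 else C.endC T (arrive C.next a).1, a.2) := by
    by_cases h : a.2 = 2 <;> simp [arrive, posC, h, glue_next_inC]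
  rw [Diagram.step_eq, harr]
  obtain ⟨p, j⟩ := a
  have h2 : (arrive C.next (p, j)).2 = j := rfl
  unfold lstep
  generalize arrive C.next (p, j) = c at h2
  obtain ⟨x | m | k, j⟩ := c <;> subst h2
  · have h3 : (if j = 2 then C.inC T (Sum.inl x) else C.endC T (Sum.inl x)) =
      C.inC T (Sum.inl x) := by split_ifs <;> rfl
    simp only [h3]
    obtain ⟨y, hy⟩ := turn_fst_hole (M := C.M ⊕ Fin n) C.sign x j
    refine (congrArg _ (turn_inC C T (Sum.inl x, j))).trans (key _ ?_)
    intro k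
    simp [hy, hole]
  · have h3 : (if j = 2 then C.inC T (Sum.inr (Sum.inl m)) else C.endC T (Sum.inr (Sum.inl m))) =
      C.inC T (Sum.inr (Sum.inl m)) := by split_ifs <;> rfl
    simp only [h3]
    exact (congrArg _ (turn_inC C T (Sum.inr (Sum.inl m), j))).trans (key _ (by simp [hole, turn]))
  · by_cases hj : j = 2
    · subst hj
      have := glue_next_symm_endT C T (T.hole k)
      exact Prod.ext this rfl
    · simp only [hj, if_false]
      have h4 : turn (C.glue T).sign (C.endC T (Sum.inr (Sum.inr k)), j) =
        (C.endC T (Sum.inr (Sum.inr k)), j) := rfl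
      rw [h4]
      simp [leave, hj, entry, posT, endC]

theorem step_posT (a : T.Pos) : (C.glue T).step (C.posT T a) =
    Sum.elim (C.posT T) (fun e => C.posC T (C.entry e)) (T.lstep a) := by
  have key : ∀ c : T.Pos, (∀ k, c.1 ≠ T.hole k) →
      leave (C.glue T).next (C.posT T c) = C.posT T (leave T.next c) := by
    rintro ⟨x | m | k, j⟩ hc
    · have : (C.glue T).next.symm (C.inT T (Sum.inl x)) = C.inT T (T.next.symm (Sum.inl x)) :=
        glue_next_symm_endT C T (Sum.inl x)
      by_cases hj : j = 2
      · simpa [leave, posT, hj] using this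
      · simp [leave, posT, hj]
    · have : (C.glue T).next.symm (C.inT T (Sum.inr (Sum.inl m))) =
        C.inT T (T.next.symm (Sum.inr (Sum.inl m))) :=
        glue_next_symm_endT C T (Sum.inr (Sum.inl m))
      by_cases hj : j = 2
      · simpa [leave, posT, hj] using this
      · simp [leave, posT, hj]
    · exact absurd rfl (hc k)
  have harr : arrive (C.glue T).next (C.posT T a) =
      (if a.2 = 2 then C.inT T (arrive T.next a).1 else C.endT T (arrive T.next a).1, a.2) := by
    by_cases h : a.2 = 2 <;> simp [arrive, posT, h, glue_next_inT]
  rw [Diagram.step_eq, harr]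
  obtain ⟨p, j⟩ := a
  have h2 : (arrive T.next (p, j)).2 = j := rfl
  unfold lstep
  generalize arrive T.next (p, j) = c at h2
  obtain ⟨x | m | k, j⟩ := c <;> subst h2
  · have h3 : (if j = 2 then C.inT T (Sum.inl x) else C.endT T (Sum.inl x)) =
      C.inT T (Sum.inl x) := by split_ifs <;> rfl
    simp only [h3]
    obtain ⟨y, hy⟩ := turn_fst_hole (M := T.M ⊕ Fin n) T.sign x j
    refine (congrArg _ (turn_inT C T (Sum.inl x, j))).trans (key _ ?_)
    intro k
    simp [hy, hole]
  · have h3 : (if j = 2 then C.inT T (Sum.inr (Sum.inl m)) else C.endT T (Sum.inr (Sum.inl m))) =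
      C.inT T (Sum.inr (Sum.inl m)) := by split_ifs <;> rfl
    simp only [h3]
    exact (congrArg _ (turn_inT C T (Sum.inr (Sum.inl m), j))).trans (key _ (by simp [hole, turn]))
  · by_cases hj : j = 2
    · subst hj
      have := glue_next_symm_endC C T (C.hole k)
      exact Prod.ext this rfl
    · simp only [hj, if_false]
      have h4 : turn (C.glue T).sign (C.endT T (Sum.inr (Sum.inr k)), j) =
        (C.endT T (Sum.inr (Sum.inr k)), j) := rfl
      rw [h4]
      simp [leave, hj, entry, posC, endT]

/-- The positions of a glued diagram are those of the outside and those of the inside. -/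
def posEquiv : C.Pos ⊕ T.Pos ≃ (C.glue T).Position where
  toFun := Sum.elim (C.posC T) (C.posT T)
  invFun
    | (Sum.inl (Sum.inl x, s), j) => Sum.inl (Sum.inl (x, s), j)
    | (Sum.inl (Sum.inr x, s), j) => Sum.inr (Sum.inl (x, s), j)
    | (Sum.inr (Sum.inl m), j) => Sum.inl (Sum.inr m, j)
    | (Sum.inr (Sum.inr m), j) => Sum.inr (Sum.inr m, j)
  left_inv := by rintro (⟨⟨x, s⟩ | m, j⟩ | ⟨⟨x, s⟩ | m, j⟩) <;> rfl
  right_inv := by rintro ⟨⟨x | x, s⟩ | m | m, j⟩ <;> rfl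

end glue

/-- The line of a position or of an exit. -/
def lineOf (T : Tangle A n) : T.Pos ⊕ (Fin n × Line) → Line := Sum.elim Prod.snd Prod.snd

/-- Twice the rotation number of a step inside a local picture. -/
def lrot (T : Tangle ℤ n) (a : T.Pos) : ℤ :=
  2 * (if a.2 = 2 then -T.weight a.1 else T.weight a.1) -
    if (a.2 = 2 ↔ T.lineOf (T.lstep a) = 2) then 0 else 1

theorem entry_snd (T : Tangle A n) (e) : (T.entry e).2 = e.2 := leave_snd _ _

theorem signedWeight_posC (C T : Tangle ℤ n) (a : C.Pos) : (C.glue T).signedWeight (C.posC T a) =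
    if a.2 = 2 then -C.weight a.1 else C.weight a.1 := by
  obtain ⟨⟨x, s⟩ | m, j⟩ := a <;> rfl

theorem signedWeight_posT (C T : Tangle ℤ n) (a : T.Pos) : (C.glue T).signedWeight (C.posT T a) =
    if a.2 = 2 then -T.weight a.1 else T.weight a.1 := by
  obtain ⟨⟨x, s⟩ | m, j⟩ := a <;> rfl

theorem dot_posC (C T : Tangle ℤ n) (a : C.Pos) : (C.glue T).dot (C.posC T a) =
    if (a.2 = 2 ↔ C.lineOf (C.lstep a) = 2) then 0 else 1 := by
  have h2 : ((C.glue T).step (C.posC T a)).2 = C.lineOf (C.lstep a) := by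
    rw [step_posC]
    cases C.lstep a with
    | inl a' => rfl
    | inr e => exact T.entry_snd e
  rw [Diagram.dot, h2]
  rfl

theorem dot_posT (C T : Tangle ℤ n) (a : T.Pos) : (C.glue T).dot (C.posT T a) =
    if (a.2 = 2 ↔ T.lineOf (T.lstep a) = 2) then 0 else 1 := by
  have h2 : ((C.glue T).step (C.posT T a)).2 = T.lineOf (T.lstep a) := by
    rw [step_posT]
    cases T.lstep a with
    | inl a' => rfl
    | inr e => exact C.entry_snd e
  rw [Diagram.dot, h2]
  rfl

/-- Crossing a distinguished point does not change the line, so no dot arises there, and the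
rotation of a step depends on the outside alone. -/
theorem rot_posC (C T : Tangle ℤ n) (a : C.Pos) : (C.glue T).rot (C.posC T a) = C.lrot a := by
  rw [Diagram.rot, signedWeight_posC, dot_posC, lrot]
  push_cast
  rfl

theorem rot_posT (C T : Tangle ℤ n) (a : T.Pos) : (C.glue T).rot (C.posT T a) = T.lrot a := by
  rw [Diagram.rot, signedWeight_posT, dot_posT, lrot]
  push_cast
  rfl

end Tangle
-- Shadows of local pictures, and framedness under local replacement
namespace Tangle

variable {A : Type} {n : ℕ}

/-- The exit of the boundary of a 2-cell from a local picture, if it is reached in `N` steps. -/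
def exitIn (T : Tangle A n) : ℕ → T.Pos → Option (Fin n × Line)
  | 0, _ => none
  | N + 1, a => Sum.elim (T.exitIn N) some (T.lstep a)

/-- The strand on which a port of a local picture lies, if its end is reached in `N` steps. -/
def endIn (T : Tangle A n) : ℕ → Port T.X (T.M ⊕ Fin n) → Option (Fin n)
  | 0, _ => none
  | N + 1, p => Sum.elim (fun x => T.endIn N (Sum.inl x))
      (Sum.elim (fun m => T.endIn N (Sum.inr (Sum.inl m))) some) (T.next p)

/-- Every port of the local picture lies on a strand, and the strands end at their own
distinguished points. -/
structure HasStrands (T : Tangle A n) (N : ℕ) : Prop where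
  hole : ∀ k, T.endIn N (T.hole k) = some k
  total : ∀ p, T.endIn N p ≠ none
  next : ∀ p, (∀ k, T.next p ≠ T.hole k) → T.endIn N (T.next p) = T.endIn N p

/-- The boundaries of 2-cells passing through a local picture: the one entering at `e` leaves at
`thr e`, and the one leaving at `e` has rotation number `ρ e / 2` inside the picture. -/
structure HasShadow (T : Tangle ℤ n) (N : ℕ) (thr : Fin n × Line → Fin n × Line)
    (ρ : Fin n × Line → ℤ) : Prop where
  step : ∀ a a', T.lstep a = Sum.inl a' → T.exitIn (N + 1) a' = T.exitIn (N + 1) a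
  entry : ∀ e, T.exitIn (N + 1) (T.entry e) = some (thr e)
  rot : ∀ e, ∀ [Fintype T.Pos], (∑ a, if T.exitIn (N + 1) a = some e then T.lrot a else 0) = ρ e

/-- The local picture contains exactly one closed circuit, of rotation number `-1`. -/
structure HasClosedCircuit (T : Tangle ℤ n) (N : ℕ) (a₀ : T.Pos) : Prop where
  base : T.exitIn (N + 1) a₀ = none
  reach : ∀ a, T.exitIn (N + 1) a = none → ∃ m, (fun b => Sum.elim id (fun _ => b) (T.lstep b))^[m] a₀ = a
  rot : ∀ [Fintype T.Pos], (∑ a, if T.exitIn (N + 1) a = none then T.lrot a else 0) = -2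

/-- Adjacency of the sides of circuits along the segments of a local picture; a circuit is
represented by its exit. -/
inductive CircuitAdj (T : Tangle A n) (N : ℕ) :
    Option (Fin n × Line) × Diagram.Side → Option (Fin n × Line) × Diagram.Side → Prop
  | above (p) : CircuitAdj T N (T.exitIn N (p, 2), .top) (T.exitIn N (p, 1), .top)
  | below (p) : CircuitAdj T N (T.exitIn N (p, 2), .bottom) (T.exitIn N (p, 0), .bottom)
  | between (p) : CircuitAdj T N (T.exitIn N (p, 0), .top) (T.exitIn N (p, 1), .bottom)

theorem exitIn_of_lstep (T : Tangle A n) {a : T.Pos} {e : Fin n × Line} (h : T.lstep a = Sum.inr e)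
    (N : ℕ) : T.exitIn (N + 1) a = some e := by
  simp [exitIn, h]

theorem exitIn_last (T : Tangle A n) (e : Fin n × Line) (N : ℕ) :
    T.exitIn (N + 1) (T.last e) = some e := T.exitIn_of_lstep (T.lstep_last e) N

theorem exists_iterate_of_exitIn (C T : Tangle A n) {N : ℕ} {a : T.Pos} {e : Fin n × Line}
    (h : T.exitIn N a = some e) :
    ∃ m, (C.glue T).step^[m] (C.posT T a) = C.posT T (T.last e) := by
  induction N generalizing a with
  | zero => simp [exitIn] at h
  | succ N ih =>
    cases hl : T.lstep a with
    | inl a' =>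
      simp only [exitIn, hl, Sum.elim_inl] at h
      obtain ⟨m, hm⟩ := ih h
      exact ⟨m + 1, by rw [Function.iterate_succ_apply, step_posT, hl]; exact hm⟩
    | inr e' =>
      simp only [exitIn, hl, Sum.elim_inr, Option.some.injEq] at h
      subst h
      exact ⟨0, by rw [T.eq_last_of_lstep hl]; rfl⟩

theorem step_posT_last (C T : Tangle A n) (e : Fin n × Line) :
    (C.glue T).step (C.posT T (T.last e)) = C.posC T (C.entry e) := by
  rw [step_posT, lstep_last]
  rfl

/-- The first return map to the outside of a local picture through which the boundaries of
2-cells pass according to `thr`. -/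
def returnMap (C : Tangle A n) (thr : Fin n × Line → Fin n × Line) (a : C.Pos) : C.Pos :=
  Sum.elim id (fun e => C.entry (thr e)) (C.lstep a)

/-- The first position outside on the circuit through a position of a glued diagram. -/
def outside (C T : Tangle A n) (N : ℕ) (a : (C.glue T).Position) : Option C.Pos :=
  Sum.elim some (fun t => (T.exitIn (N + 1) t).map C.entry) ((C.posEquiv T).symm a)

theorem outside_posC (C T : Tangle A n) (N : ℕ) (a : C.Pos) :
    C.outside T N (C.posC T a) = some a := by
  have : (C.posEquiv T).symm (C.posC T a) = Sum.inl a := (C.posEquiv T).symm_apply_apply (Sum.inl a)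
  simp [outside, this]

theorem outside_posT (C T : Tangle A n) (N : ℕ) (a : T.Pos) :
    C.outside T N (C.posT T a) = (T.exitIn (N + 1) a).map C.entry := by
  have : (C.posEquiv T).symm (C.posT T a) = Sum.inr a := (C.posEquiv T).symm_apply_apply (Sum.inr a)
  simp [outside, this]

theorem pos_cases (C T : Tangle A n) (a : (C.glue T).Position) :
    (∃ b, a = C.posC T b) ∨ ∃ t, a = C.posT T t := by
  obtain ⟨b | t, rfl⟩ := (C.posEquiv T).surjective a
  · exact Or.inl ⟨b, rfl⟩
  · exact Or.inr ⟨t, rfl⟩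

namespace HasShadow

variable {C T : Tangle ℤ n} {N : ℕ} {thr : Fin n × Line → Fin n × Line} {ρ : Fin n × Line → ℤ}

/-- The return map to the outside involves `T` only through `thr`; two pictures with the same `thr`
therefore have the same circuits as far as the outside can see. -/
theorem isReturn (h : T.HasShadow N thr ρ) (C : Tangle ℤ n) :
    IsReturn (C.glue T).step (C.returnMap thr) (C.posC T) (C.outside T N) where
  out_incl := C.outside_posC T N
  out_step_incl a := by
    rw [step_posC, returnMap]
    cases C.lstep a with
    | inl a' => exact C.outside_posC T N a'
    | inr e => simp [outside_posT, h.entry]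
  out_step a ha := by
    obtain ⟨b, rfl⟩ | ⟨t, rfl⟩ := C.pos_cases T a
    · exact absurd ⟨b, rfl⟩ ha
    · rw [step_posT]
      cases hl : T.lstep t with
      | inl a' => simp [outside_posT, h.step t a' hl]
      | inr e => simp [outside_posT, outside_posC, T.exitIn_of_lstep hl]
  reach a b hab := by
    obtain ⟨b, rfl⟩ | ⟨t, rfl⟩ := C.pos_cases T a
    · rw [outside_posC] at hab
      exact ⟨0, by rw [Option.some.inj hab]; rfl⟩
    · rw [outside_posT, Option.map_eq_some_iff] at hab
      obtain ⟨e, he, rfl⟩ := hab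
      obtain ⟨m, hm⟩ := C.exists_iterate_of_exitIn T he
      exact ⟨m + 1, by rw [Function.iterate_succ_apply', hm, step_posT_last]⟩

open Classical in
-- Rotation collected inside the picture before the exit `e` is charged to the position at which the
-- boundary re-enters the outside. The result depends on `T` only through `ρ`.
theorem sum_outside (h : T.HasShadow N thr ρ) (C : Tangle ℤ n) (b : C.Pos) :
    C.lrot b + (∑ e, if C.entry e = b then ρ e else 0) =
      ∑ a, if C.outside T N a = some b then (C.glue T).rot a else 0 := by
  let _ := Fintype.ofFinite T.Pos
  let _ := Fintype.ofFinite C.Pos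
  rw [← (C.posEquiv T).sum_comp, Fintype.sum_sum_type]
  have h1 : ∀ a, C.posEquiv T (Sum.inl a) = C.posC T a := fun _ => rfl
  have h2 : ∀ a, C.posEquiv T (Sum.inr a) = C.posT T a := fun _ => rfl
  simp only [h1, h2, outside_posC, outside_posT, rot_posC, rot_posT, Option.some_inj,
    Finset.sum_ite_eq', Finset.mem_univ, if_true]
  congr 1
  have h3 : ∀ e, (if C.entry e = b then ρ e else 0) =
      ∑ a, if T.exitIn (N + 1) a = some e ∧ C.entry e = b then T.lrot a else 0 := by
    intro e
    by_cases hb : C.entry e = b <;> simp [hb, ← h.rot]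
  simp only [h3]
  rw [Finset.sum_comm]
  refine Finset.sum_congr rfl fun a _ => ?_
  cases T.exitIn (N + 1) a with
  | none => simp
  | some e =>
    rw [Finset.sum_eq_single e]
    · simp
    · intro e' _ he'
      simp [he'.symm]
    · simp

/-- A boundary without exit never leaves the picture, so in the glued diagram it moves as it does
inside. The function iterated here rests at exits, which are not met. -/
theorem iterate_posT (h : T.HasShadow N thr ρ) (C : Tangle ℤ n) {a₀ : T.Pos}
    (h₀ : T.exitIn (N + 1) a₀ = none) (m : ℕ) :
    (C.glue T).step^[m] (C.posT T a₀) =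
      C.posT T ((fun b => Sum.elim id (fun _ => b) (T.lstep b))^[m] a₀) ∧
    T.exitIn (N + 1) ((fun b => Sum.elim id (fun _ => b) (T.lstep b))^[m] a₀) = none := by
  induction m with
  | zero => exact ⟨rfl, h₀⟩
  | succ m ih =>
    rw [Function.iterate_succ_apply', Function.iterate_succ_apply', ih.1, step_posT]
    generalize (fun b => Sum.elim id (fun _ => b) (T.lstep b))^[m] a₀ = a at ih
    cases hl : T.lstep a with
    | inl a' => exact ⟨rfl, (h.step a a' hl).trans ih.2⟩
    | inr e =>
      rw [T.exitIn_of_lstep hl] at ih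
      cases ih.2

end HasShadow

theorem strand_connected (C T : Tangle A n) {N : ℕ} {p} {k : Fin n} (h : T.endIn N p = some k) :
    Relation.EqvGen (fun p q => (C.glue T).next p = q) (C.inT T p) (C.inC T (C.hole k)) := by
  induction N generalizing p with
  | zero => simp [endIn] at h
  | succ N ih =>
    have h1 := C.glue_next_inT T p
    refine (Relation.EqvGen.rel (r := fun p q => (C.glue T).next p = q) _ _ h1).trans _ _ _ ?_
    unfold endIn at h
    generalize T.next p = q at h
    rcases q with x | m | k'
    · exact ih h
    · exact ih h
    · cases h
      exact Relation.EqvGen.refl _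

theorem portSum_inC (C T : Tangle A n) (p) :
    portSum C.X T.X (C.M ⊕ Fin n) (T.M ⊕ Fin n) (C.inC T p) = Sum.inl p := by
  rcases p with ⟨x, s⟩ | m <;> rfl

theorem portSum_inT (C T : Tangle A n) (p) :
    portSum C.X T.X (C.M ⊕ Fin n) (T.M ⊕ Fin n) (C.inT T p) = Sum.inr p := by
  rcases p with ⟨x, s⟩ | m <;> rfl

theorem port_cases (C T : Tangle A n) (q : Port (C.glue T).X (C.glue T).M) :
    (∃ p, q = C.inC T p) ∨ ∃ p, q = C.inT T p := by
  rcases q with ⟨x | x, s⟩ | m | m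
  · exact Or.inl ⟨Sum.inl (x, s), rfl⟩
  · exact Or.inr ⟨Sum.inl (x, s), rfl⟩
  · exact Or.inl ⟨Sum.inr m, rfl⟩
  · exact Or.inr ⟨Sum.inr m, rfl⟩

/-- Strand `k` starts and ends at distinguished points with the same number in both pictures, so
contracting each strand to its beginning maps one glued curve to the other. -/
theorem HasStrands.connected_next {C T T' : Tangle A n} {N N' : ℕ} (h : T.HasStrands N)
    (h' : T'.HasStrands N') (hc : Connected (fun p q => (C.glue T).next p = q)) :
    Connected (fun p q => (C.glue T').next p = q) := by
  have hlink : ∀ k, Relation.EqvGen (fun p q => (C.glue T').next p = q)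
      (C.inT T' (T'.hole k)) (C.inC T' (C.hole k)) := fun k => C.strand_connected T' (h'.hole k)
  let str : Port T.X (T.M ⊕ Fin n) → Fin n := fun p => (T.endIn N p).get
    (Option.isSome_iff_ne_none.2 (h.total p))
  have hstr : ∀ p, T.endIn N p = some (str p) := fun p => (Option.some_get _).symm
  let φ : Port (C.glue T).X (C.glue T).M → Port (C.glue T').X (C.glue T').M :=
    fun q => Sum.elim (C.inC T') (fun p => C.inT T' (T'.hole (str p)))
      (portSum C.X T.X (C.M ⊕ Fin n) (T.M ⊕ Fin n) q)
  have hφC : ∀ p, φ (C.inC T p) = C.inC T' p := by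
    intro p
    simp [φ, portSum_inC]
  have hφT : ∀ p, φ (C.inT T p) = C.inT T' (T'.hole (str p)) := by
    intro p
    simp [φ, portSum_inT]
  refine hc.transfer φ ?_ ?_
  · rintro q _ rfl
    obtain ⟨p, rfl⟩ | ⟨p, rfl⟩ := C.port_cases T q
    · have h1 := C.glue_next_inC T' p
      rw [hφC, glue_next_inC]
      refine (Relation.EqvGen.rel (r := fun p q => (C.glue T').next p = q) _ _ h1).trans _ _ _ ?_
      rcases C.next p with x | m | k
      · exact Relation.EqvGen.refl _
      · exact Relation.EqvGen.refl _
      · simp only [endC, hφT]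
        have := (hstr (T.hole k)).symm.trans (h.hole k)
        rw [Option.some.inj this]
        exact Relation.EqvGen.refl _
    · rw [hφT, glue_next_inT]
      have h2 := h.next p
      have h3 := hstr p
      have hN : ∃ M, N = M + 1 := Nat.exists_eq_succ_of_ne_zero (by
        rintro rfl
        exact h.total p rfl)
      obtain ⟨M, rfl⟩ := hN
      unfold endIn at h3
      generalize T.next p = q at h2 h3
      rcases q with x | m | k
      · have := h2 (by simp [Tangle.hole])
        rw [hstr, hstr, Option.some_inj] at this
        simp only [endT, hφT, this]
        exact Relation.EqvGen.refl _
      · have := h2 (by simp [Tangle.hole])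
        rw [hstr, hstr, Option.some_inj] at this
        simp only [endT, hφT, this]
        exact Relation.EqvGen.refl _
      · simp only [Sum.elim_inr, Option.some_inj] at h3
        simp only [endT, hφC, ← h3]
        exact hlink k
  · intro q
    obtain ⟨p, rfl⟩ | ⟨p, rfl⟩ := C.port_cases T' q
    · exact ⟨C.inC T p, by rw [hφC]; exact Relation.EqvGen.refl _⟩
    · obtain ⟨k, hk⟩ := Option.ne_none_iff_exists'.1 (h'.total p)
      exact ⟨C.inC T (C.hole k), by rw [hφC]; exact C.strand_connected T' hk⟩

/-- Outside positions are mapped to themselves, and an inside position to one of `T'` with the same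
exit. Adjacencies along segments of `T` become chains in `T'` by `hadj`, and by `hnone` a closed
circuit of `T'` is linked to circuits passing through. -/
theorem HasShadow.connected_boundaryAdj {C T T' : Tangle ℤ n} {N N' : ℕ}
    {thr : Fin n × Line → Fin n × Line} {ρ : Fin n × Line → ℤ} (h : T.HasShadow N thr ρ)
    (h' : T'.HasShadow N' thr ρ)
    (hcl : ∀ a, T'.exitIn (N' + 1) a = none → ∃ a₀, T'.HasClosedCircuit N' a₀)
    (hadj : ∀ x y, T.CircuitAdj (N + 1) x y → Relation.EqvGen (T'.CircuitAdj (N' + 1)) x y)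
    (hnone : ∀ a, T'.exitIn (N' + 1) a = none → ∀ σ, ∃ e τ,
      Relation.EqvGen (T'.CircuitAdj (N' + 1)) (none, σ) (some e, τ))
    (hc : Connected (C.glue T).BoundaryAdj) : Connected (C.glue T').BoundaryAdj := by
  classical
  -- With a common exit both positions run to the last position before it; without exit both lie on
  -- the unique closed circuit.
  have hsame : ∀ t t' : T'.Pos, T'.exitIn (N' + 1) t = T'.exitIn (N' + 1) t' → ∀ σ,
      Relation.EqvGen (C.glue T').BoundaryAdj (C.posT T' t, σ) (C.posT T' t', σ) := by
    intro t t' htt σ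
    cases ht : T'.exitIn (N' + 1) t with
    | none =>
      obtain ⟨a₀, h₀⟩ := hcl t ht
      obtain ⟨m, rfl⟩ := h₀.reach t ht
      obtain ⟨m', rfl⟩ := h₀.reach t' (htt.symm.trans ht)
      rw [← (h'.iterate_posT C h₀.base m).1, ← (h'.iterate_posT C h₀.base m').1]
      exact ((Diagram.eqvGen_boundaryAdj_iterate _ _ _ _).symm).trans _ _ _
        (Diagram.eqvGen_boundaryAdj_iterate _ _ _ _)
    | some e =>
      obtain ⟨m, hm⟩ := C.exists_iterate_of_exitIn T' ht
      obtain ⟨m', hm'⟩ := C.exists_iterate_of_exitIn T' (htt.symm.trans ht)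
      refine (Diagram.eqvGen_boundaryAdj_iterate _ _ σ m).trans _ _ _ ?_
      rw [hm, ← hm']
      exact (Diagram.eqvGen_boundaryAdj_iterate _ _ _ _).symm
  by_cases hE : Nonempty (C.glue T').Position
  swap
  · rintro ⟨a, _⟩
    exact absurd ⟨a⟩ hE
  obtain ⟨a₁⟩ := hE
  -- A representative in `T'` for each value of the exit; `a₁` is a dummy for values not attained.
  obtain ⟨rep, hrep⟩ : ∃ rep : Option (Fin n × Line) → (C.glue T').Position, ∀ t σ,
      Relation.EqvGen (C.glue T').BoundaryAdj (rep (T'.exitIn (N' + 1) t), σ) (C.posT T' t, σ) := by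
    refine ⟨fun o => if ho : ∃ t, T'.exitIn (N' + 1) t = o then C.posT T' ho.choose else a₁, ?_⟩
    intro t σ
    have ho : ∃ t', T'.exitIn (N' + 1) t' = T'.exitIn (N' + 1) t := ⟨t, rfl⟩
    simp only [ho, dif_pos]
    exact hsame _ _ ho.choose_spec σ
  have hlast : ∀ e σ, Relation.EqvGen (C.glue T').BoundaryAdj (rep (some e), σ)
      (C.posT T' (T'.last e), σ) := by
    intro e σ
    have := hrep (T'.last e) σ
    rwa [exitIn_last] at this
  have hadj' : ∀ x y, Relation.EqvGen (T'.CircuitAdj (N' + 1)) x y →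
      Relation.EqvGen (C.glue T').BoundaryAdj (rep x.1, x.2) (rep y.1, y.2) := by
    intro x y hxy
    refine eqvGen_lift (fun x => (rep x.1, x.2)) ?_ hxy
    intro x y hxy
    cases hxy with
    | above p =>
      exact (hrep _ _).trans _ _ _ ((Relation.EqvGen.rel _ _
        (Diagram.BoundaryAdj.above (C.inT T' p))).trans _ _ _ (hrep (p, 1) _).symm)
    | below p =>
      exact (hrep _ _).trans _ _ _ ((Relation.EqvGen.rel _ _
        (Diagram.BoundaryAdj.below (C.inT T' p))).trans _ _ _ (hrep (p, 0) _).symm)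
    | between p =>
      exact (hrep _ _).trans _ _ _ ((Relation.EqvGen.rel _ _
        (Diagram.BoundaryAdj.between (C.inT T' p))).trans _ _ _ (hrep (p, 1) _).symm)
  let φ : (C.glue T).Position × Diagram.Side → (C.glue T').Position × Diagram.Side :=
    fun a => (Sum.elim (C.posC T') (fun t => rep (T.exitIn (N + 1) t)) ((C.posEquiv T).symm a.1), a.2)
  have hφC : ∀ a σ, φ (C.posC T a, σ) = (C.posC T' a, σ) := by
    intro a σ
    have : (C.posEquiv T).symm (C.posC T a) = Sum.inl a :=
      (C.posEquiv T).symm_apply_apply (Sum.inl a)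
    simp [φ, this]
  have hφT : ∀ t σ, φ (C.posT T t, σ) = (rep (T.exitIn (N + 1) t), σ) := by
    intro t σ
    have : (C.posEquiv T).symm (C.posT T t) = Sum.inr t :=
      (C.posEquiv T).symm_apply_apply (Sum.inr t)
    simp [φ, this]
  refine hc.transfer φ ?_ ?_
  · intro x y hxy
    cases hxy with
    | along a σ =>
      obtain ⟨a, rfl⟩ | ⟨t, rfl⟩ := C.pos_cases T a
      · have h1 := Relation.EqvGen.rel (r := (C.glue T').BoundaryAdj) _ _
          (Diagram.BoundaryAdj.along (C.posC T' a) σ)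
        rw [step_posC] at h1 ⊢
        rw [hφC]
        cases hl : C.lstep a with
        | inl a' => simpa only [hl, Sum.elim_inl, hφC] using h1
        | inr e =>
          simp only [hl, Sum.elim_inr, hφT, h.entry] at h1 ⊢
          refine h1.trans _ _ _ ?_
          rw [← h'.entry]
          exact (hrep _ _).symm
      · rw [step_posT, hφT]
        cases hl : T.lstep t with
        | inl t' =>
          simp only [Sum.elim_inl, hφT, h.step t t' hl]
          exact Relation.EqvGen.refl _
        | inr e =>
          simp only [Sum.elim_inr, hφC, T.exitIn_of_lstep hl]
          refine (hlast e σ).trans _ _ _ ?_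
          rw [← C.step_posT_last T' e]
          exact Relation.EqvGen.rel _ _ (Diagram.BoundaryAdj.along _ _)
    | above p =>
      obtain ⟨p, rfl⟩ | ⟨p, rfl⟩ := C.port_cases T p
      · have h1 := hφC (p, 2) .top
        have h2 := hφC (p, 1) .top
        simp only [posC] at h1 h2
        rw [h1, h2]
        exact Relation.EqvGen.rel _ _ (Diagram.BoundaryAdj.above _)
      · have h1 := hφT (p, 2) .top
        have h2 := hφT (p, 1) .top
        simp only [posT] at h1 h2
        rw [h1, h2]
        exact hadj' _ _ (hadj _ _ (CircuitAdj.above p))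
    | below p =>
      obtain ⟨p, rfl⟩ | ⟨p, rfl⟩ := C.port_cases T p
      · have h1 := hφC (p, 2) .bottom
        have h2 := hφC (p, 0) .bottom
        simp only [posC] at h1 h2
        rw [h1, h2]
        exact Relation.EqvGen.rel _ _ (Diagram.BoundaryAdj.below _)
      · have h1 := hφT (p, 2) .bottom
        have h2 := hφT (p, 0) .bottom
        simp only [posT] at h1 h2
        rw [h1, h2]
        exact hadj' _ _ (hadj _ _ (CircuitAdj.below p))
    | between p =>
      obtain ⟨p, rfl⟩ | ⟨p, rfl⟩ := C.port_cases T p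
      · have h1 := hφC (p, 0) .top
        have h2 := hφC (p, 1) .bottom
        simp only [posC] at h1 h2
        rw [h1, h2]
        exact Relation.EqvGen.rel _ _ (Diagram.BoundaryAdj.between _)
      · have h1 := hφT (p, 0) .top
        have h2 := hφT (p, 1) .bottom
        simp only [posT] at h1 h2
        rw [h1, h2]
        exact hadj' _ _ (hadj _ _ (CircuitAdj.between p))
  · rintro ⟨a, σ⟩
    obtain ⟨a, rfl⟩ | ⟨t, rfl⟩ := C.pos_cases T' a
    · exact ⟨(C.posC T a, σ), by rw [hφC]; exact Relation.EqvGen.refl _⟩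
    · have h1 := (hrep t σ).symm
      cases ht : T'.exitIn (N' + 1) t with
      | none =>
        obtain ⟨e, τ, he⟩ := hnone t ht σ
        rw [ht] at h1
        refine ⟨(C.posT T (T.last e), τ), ?_⟩
        rw [hφT, exitIn_last]
        exact h1.trans _ _ _ (hadj' _ _ he)
      | some e =>
        rw [ht] at h1
        exact ⟨(C.posT T (T.last e), σ), by rw [hφT, exitIn_last]; exact h1⟩

open Classical in
/-- Replacing a local picture by one through which the boundaries of 2-cells pass in the same way,
with at most one additional closed circuit, preserves framedness. -/
theorem HasShadow.isFramed_glue {C T T' : Tangle ℤ n} {N N' : ℕ}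
    {thr : Fin n × Line → Fin n × Line} {ρ : Fin n × Line → ℤ} (h : T.HasShadow N thr ρ)
    (h' : T'.HasShadow N' thr ρ) (hs : T.HasStrands N) (hs' : T'.HasStrands N')
    (hno : ∀ a, T.exitIn (N + 1) a ≠ none)
    (hcl : (Nat.card T'.X = Nat.card T.X ∧ ∀ a, T'.exitIn (N' + 1) a ≠ none) ∨
      (Nat.card T'.X = Nat.card T.X + 1 ∧ ∃ a₀, T'.HasClosedCircuit N' a₀))
    (hadj : ∀ x y, T.CircuitAdj (N + 1) x y → Relation.EqvGen (T'.CircuitAdj (N' + 1)) x y)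
    (hnone : ∀ a, T'.exitIn (N' + 1) a = none → ∀ σ, ∃ e τ,
      Relation.EqvGen (T'.CircuitAdj (N' + 1)) (none, σ) (some e, τ))
    (hf : (C.glue T).IsFramed) : (C.glue T').IsFramed := by
  let _ := Fintype.ofFinite T'.Pos
  let _ := Fintype.ofFinite C.Pos
  rw [Diagram.isFramed_iff] at hf ⊢
  obtain ⟨hb, hcard, hnext, hbal⟩ := hf
  have hX : ∀ T : Tangle ℤ n, Nat.card (C.glue T).X = Nat.card C.X + Nat.card T.X :=
    fun T => Nat.card_sum
  have hr := h.isReturn C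
  have hr' := h'.isReturn C
  have hout : ∀ a, C.outside T N a ≠ none := by
    intro a
    obtain ⟨a, rfl⟩ | ⟨t, rfl⟩ := C.pos_cases T a
    · simp [outside_posC]
    · simpa [outside_posT] using hno t
  -- Only `C`, `thr` and `ρ` occur in these sums, so the balance of circuits meeting the outside
  -- passes from `T` to `T'`.
  have hbal' : ∀ r, (∑ b, if Quot.mk (fun x y => C.returnMap thr x = y) b = r then
      C.lrot b + (∑ e, if C.entry e = b then ρ e else 0) else 0) = -2 := by
    intro r
    rw [← hr.sum_quotIncl (C.glue T).rot _ (fun b => by convert h.sum_outside C b) r]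
    exact hbal _
  have hbal'' : ∀ r, (∑ a, if Quot.mk (fun x y => (C.glue T').step x = y) a = hr'.quotIncl r then
      (C.glue T').rot a else 0) = -2 := by
    intro r
    rw [hr'.sum_quotIncl (C.glue T').rot _ (fun b => by convert h'.sum_outside C b) r]
    exact hbal' r
  have hc := hr.card_quot hout
  refine ⟨h.connected_boundaryAdj h' ?_ hadj hnone hb, ?_, hs.connected_next hs' hnext, ?_⟩
  · intro a ha
    exact hcl.elim (fun hcl => absurd ha (hcl.2 a)) fun hcl => hcl.2
  · rw [Diagram.TwoCell, hc, hX] at hcard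
    rcases hcl with ⟨h1, h2⟩ | ⟨h1, a₀, h₀⟩
    · have hout' : ∀ a, C.outside T' N' a ≠ none := by
        intro a
        obtain ⟨a, rfl⟩ | ⟨t, rfl⟩ := C.pos_cases T' a
        · simp [outside_posC]
        · simpa [outside_posT] using h2 t
      rw [Diagram.TwoCell, hr'.card_quot hout', hcard, hX, h1]
    · have hk := hr'.card_quot_add_one (C.posT T' a₀) (by simp [outside_posT, h₀.base]) (by
        intro a ha
        obtain ⟨a, rfl⟩ | ⟨t, rfl⟩ := C.pos_cases T' a
        · simp [outside_posC] at ha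
        · rw [outside_posT, Option.map_eq_none_iff] at ha
          obtain ⟨m, rfl⟩ := h₀.reach t ha
          exact ⟨m, (h'.iterate_posT C h₀.base m).1⟩)
      rw [Diagram.TwoCell, hk, hcard, hX, h1]
      ring
  · intro q
    cases hq : hr'.quotMap q with
    | some r =>
      rw [hr'.quotMap_eq_some.1 hq]
      exact hbal'' r
    | none =>
      have hnn : ∃ t, T'.exitIn (N' + 1) t = none ∧ q = Quot.mk _ (C.posT T' t) := by
        induction q using Quot.ind with
        | mk a =>
          rw [IsReturn.quotMap_mk, Option.map_eq_none_iff] at hq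
          obtain ⟨a, rfl⟩ | ⟨t, rfl⟩ := C.pos_cases T' a
          · simp [outside_posC] at hq
          · rw [outside_posT, Option.map_eq_none_iff] at hq
            exact ⟨t, hq, rfl⟩
      obtain ⟨t, ht, rfl⟩ := hnn
      rcases hcl with ⟨h1, h2⟩ | ⟨h1, a₀, h₀⟩
      · exact absurd ht (h2 t)
      · have hmem : ∀ a, Quot.mk (fun x y => (C.glue T').step x = y) a =
            Quot.mk _ (C.posT T' t) ↔ C.outside T' N' a = none := by
          intro a
          constructor
          · intro ha
            have := congrArg hr'.quotMap ha
            rw [hq, IsReturn.quotMap_mk, Option.map_eq_none_iff] at this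
            exact this
          · intro ha
            obtain ⟨a, rfl⟩ | ⟨t', rfl⟩ := C.pos_cases T' a
            · simp [outside_posC] at ha
            · rw [outside_posT, Option.map_eq_none_iff] at ha
              obtain ⟨m, rfl⟩ := h₀.reach t ht
              obtain ⟨m', rfl⟩ := h₀.reach t' ha
              rw [← (h'.iterate_posT C h₀.base m).1, ← (h'.iterate_posT C h₀.base m').1,
                quot_mk_iterate, quot_mk_iterate]
        simp only [hmem]
        rw [← (C.posEquiv T').sum_comp, Fintype.sum_sum_type]
        have h1 : ∀ a, C.posEquiv T' (Sum.inl a) = C.posC T' a := fun _ => rfl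
        have h2 : ∀ a, C.posEquiv T' (Sum.inr a) = C.posT T' a := fun _ => rfl
        simp only [h1, h2, outside_posC, outside_posT, rot_posT, reduceCtorEq, if_false,
          Finset.sum_const_zero, zero_add, Option.map_eq_none_iff]
        rw [← h₀.rot]

end Tangle

/-! ### Decision procedures for local pictures given by words -/

instance : Fintype Strand := ⟨{.upper, .lower}, by rintro (_ | _) <;> simp⟩

/-- Merging of two classes of a partition, given by a list of labelled elements. -/
def mergeLabels {α : Type*} [DecidableEq α] (l : List (α × ℕ)) (x : α × α) : List (α × ℕ) :=
  match l.find? (fun y => y.1 = x.1), l.find? (fun y => y.1 = x.2) with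
  | some a, some b => l.map fun y => (y.1, if y.2 = b.2 then a.2 else y.2)
  | _, _ => l

/-- The invariant is soundness alone: equal labels imply connected elements. Completeness of the
labelling is never needed, since the checks succeed only by exhibiting equal labels. -/
theorem eqvGen_of_mergeLabels {α : Type*} [DecidableEq α] {r : α → α → Prop} (l : List (α × ℕ))
    (x : α × α) (hx : r x.1 x.2)
    (hl : ∀ y ∈ l, ∀ z ∈ l, y.2 = z.2 → Relation.EqvGen r y.1 z.1) :
    ∀ y ∈ mergeLabels l x, ∀ z ∈ mergeLabels l x, y.2 = z.2 → Relation.EqvGen r y.1 z.1 := by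
  unfold mergeLabels
  split
  · rename_i a b ha hb
    have ha1 : a.1 = x.1 := by simpa using List.find?_some ha
    have hb1 : b.1 = x.2 := by simpa using List.find?_some hb
    have ha2 := List.mem_of_find?_eq_some ha
    have hb2 := List.mem_of_find?_eq_some hb
    have hab : Relation.EqvGen r a.1 b.1 := by
      rw [ha1, hb1]
      exact Relation.EqvGen.rel _ _ hx
    have key : ∀ y ∈ l, Relation.EqvGen r y.1
        (if y.2 = b.2 then a.1 else y.1) := by
      intro y hy
      split_ifs with h
      · exact (hl y hy b hb2 h).trans _ _ _ hab.symm
      · exact Relation.EqvGen.refl _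
    simp only [List.mem_map]
    rintro _ ⟨y, hy, rfl⟩ _ ⟨z, hz, rfl⟩ hyz
    simp only at hyz ⊢
    split_ifs at hyz with h1 h2 h2
    · exact hl y hy z hz (h1.trans h2.symm)
    · exact (hl y hy b hb2 h1).trans _ _ _ ((hab.symm).trans _ _ _ (hl a ha2 z hz hyz))
    · exact (hl y hy a ha2 hyz).trans _ _ _ (hab.trans _ _ _ (hl b hb2 z hz h2.symm))
    · exact hl y hy z hz hyz
  · exact hl

/-- The classes of the equivalence relation generated by a list of pairs. -/
def labels {α : Type*} [DecidableEq α] (nodes : List α) (edges : List (α × α)) : List (α × ℕ) :=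
  edges.foldl mergeLabels nodes.zipIdx

/-- The initial labels are the places in the list of nodes, which distinguish its entries; each edge
then preserves soundness. -/
theorem eqvGen_of_labels {α : Type*} [DecidableEq α] {r : α → α → Prop} (nodes : List α)
    (edges : List (α × α)) (he : ∀ x ∈ edges, r x.1 x.2) {y z : α × ℕ} (hy : y ∈ labels nodes edges)
    (hz : z ∈ labels nodes edges) (hyz : y.2 = z.2) : Relation.EqvGen r y.1 z.1 := by
  have h0 : ∀ y ∈ nodes.zipIdx, ∀ z ∈ nodes.zipIdx, y.2 = z.2 → Relation.EqvGen r y.1 z.1 := by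
    intro y hy z hz hyz
    have h1 := List.mem_zipIdx_iff_getElem?.1 hy
    have h2 := List.mem_zipIdx_iff_getElem?.1 hz
    rw [hyz, h2] at h1
    rw [Option.some.inj h1]
    exact Relation.EqvGen.refl _
  unfold labels at hy hz
  generalize nodes.zipIdx = l at hy hz h0
  induction edges generalizing l with
  | nil => exact h0 y hy z hz hyz
  | cons x edges ih =>
    exact ih (fun x hx => he x (List.mem_cons_of_mem _ hx)) _ hy hz
      (eqvGen_of_mergeLabels l x (he x List.mem_cons_self) h0)

instance : DecidableEq Diagram.Side := fun a b =>
  match a, b with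
  | .top, .top => isTrue rfl
  | .bottom, .bottom => isTrue rfl
  | .top, .bottom => isFalse (by simp)
  | .bottom, .top => isFalse (by simp)

namespace Tangle

section

variable {n c : ℕ} (sign : Fin c → Sign) (word : Fin n → List (Fin c × Strand))
  (wt : Fin n → List ℤ)

instance : Fintype (ofWords sign word wt).X := inferInstanceAs (Fintype (Fin c))
instance : DecidableEq (ofWords sign word wt).X := inferInstanceAs (DecidableEq (Fin c))
instance : Fintype (ofWords sign word wt).M := inferInstanceAs (Fintype Empty)
instance : DecidableEq (ofWords sign word wt).M := inferInstanceAs (DecidableEq Empty)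

end

variable {A : Type} {n : ℕ}

/-- The pairs of adjacent sides of circuits at a port. -/
def portAdj (T : Tangle A n) (N : ℕ) (p : Port T.X (T.M ⊕ Fin n)) :
    List ((Option (Fin n × Line) × Diagram.Side) × (Option (Fin n × Line) × Diagram.Side)) :=
  [((T.exitIn N (p, 2), .top), (T.exitIn N (p, 1), .top)),
    ((T.exitIn N (p, 2), .bottom), (T.exitIn N (p, 0), .bottom)),
    ((T.exitIn N (p, 0), .top), (T.exitIn N (p, 1), .bottom))]

theorem circuitAdj_iff (T : Tangle A n) (N : ℕ) (x y) :
    T.CircuitAdj N x y ↔ ∃ p, (x, y) ∈ T.portAdj N p := by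
  constructor
  · rintro (p | p | p) <;> exact ⟨p, by simp [portAdj]⟩
  · rintro ⟨p, hp⟩
    simp only [portAdj, List.mem_cons, Prod.mk.injEq, List.not_mem_nil, or_false] at hp
    rcases hp with ⟨rfl, rfl⟩ | ⟨rfl, rfl⟩ | ⟨rfl, rfl⟩
    · exact CircuitAdj.above p
    · exact CircuitAdj.below p
    · exact CircuitAdj.between p

/-- The ports of a local picture, in a list. -/
def ofWordsPorts (n c : ℕ) : List (Port (Fin c) (Empty ⊕ Fin n)) :=
  (List.finRange c).flatMap (fun x => [Sum.inl (x, .upper), Sum.inl (x, .lower)]) ++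
    (List.finRange n).map fun k => Sum.inr (Sum.inr k)

/-- The sides of the circuits of a local picture, labelled by their connected components. -/
def circuitLabels {c : ℕ} (sign : Fin c → Sign) (word : Fin n → List (Fin c × Strand))
    (wt : Fin n → List ℤ) (N : ℕ) : List ((Option (Fin n × Line) × Diagram.Side) × ℕ) :=
  labels ((none :: ((List.finRange n).flatMap fun k => [some (k, 0), some (k, 1), some (k, 2)])).flatMap
      fun o => [(o, .top), (o, .bottom)])
    ((ofWordsPorts n c).flatMap ((ofWords sign word wt).portAdj N))

/-- The elements of a labelled list with the labels of two given elements agree. -/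
def sameLabel {α : Type*} [DecidableEq α] (l : List (α × ℕ)) (x y : α) : Bool :=
  l.any fun a => a.1 = x && l.any fun b => b.1 = y && a.2 = b.2

theorem eqvGen_of_sameLabel {c : ℕ} (sign : Fin c → Sign) (word : Fin n → List (Fin c × Strand))
    (wt : Fin n → List ℤ) (N : ℕ) {x y : Option (Fin n × Line) × Diagram.Side}
    (h : sameLabel (circuitLabels sign word wt N) x y) :
    Relation.EqvGen ((ofWords sign word wt).CircuitAdj N) x y := by
  simp only [sameLabel, List.any_eq_true, Bool.and_eq_true, decide_eq_true_eq] at h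
  obtain ⟨a, ha, rfl, b, hb, rfl, hab⟩ := h
  refine eqvGen_of_labels _ _ ?_ ha hb hab
  intro x hx
  obtain ⟨p, _, hp⟩ := List.mem_flatMap.1 hx
  exact (circuitAdj_iff _ _ _ _).2 ⟨p, hp⟩

section check

variable {c c' : ℕ} (sign : Fin c → Sign) (word : Fin n → List (Fin c × Strand))
  (wt : Fin n → List ℤ) (sign' : Fin c' → Sign) (word' : Fin n → List (Fin c' × Strand))
  (wt' : Fin n → List ℤ) (N : ℕ)

/-- The strands of a local picture given by words end at their distinguished points. -/
def CheckStrands : Prop :=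
  (∀ k, (ofWords sign word wt).endIn N ((ofWords sign word wt).hole k) = some k) ∧
    ∀ p, (ofWords sign word wt).endIn N p ≠ none ∧
      ((∀ k, (ofWords sign word wt).next p ≠ (ofWords sign word wt).hole k) →
        (ofWords sign word wt).endIn N ((ofWords sign word wt).next p) =
          (ofWords sign word wt).endIn N p)

instance : Decidable (CheckStrands sign word wt N) := by
  unfold CheckStrands
  infer_instance

theorem CheckStrands.hasStrands (h : CheckStrands sign word wt N) :
    (ofWords sign word wt).HasStrands N :=
  ⟨h.1, fun p => (h.2 p).1, fun p => (h.2 p).2⟩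

/-- The exits reached from successive positions agree. -/
def CheckStep : Prop :=
  ∀ a, Sum.elim (fun a' => decide ((ofWords sign word wt).exitIn (N + 1) a' =
    (ofWords sign word wt).exitIn (N + 1) a)) (fun _ => true) ((ofWords sign word wt).lstep a) = true

instance : Decidable (CheckStep sign word wt N) := by
  unfold CheckStep
  infer_instance

/-- The boundaries of 2-cells pass through two local pictures in the same way. -/
def CheckThrough : Prop :=
  ∀ e, (ofWords sign word wt).exitIn (N + 1) ((ofWords sign word wt).entry e) ≠ none ∧
    (ofWords sign' word' wt').exitIn (N + 1) ((ofWords sign' word' wt').entry e) =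
      (ofWords sign word wt).exitIn (N + 1) ((ofWords sign word wt).entry e) ∧
    (∑ a, if (ofWords sign' word' wt').exitIn (N + 1) a = some e then
        (ofWords sign' word' wt').lrot a else 0) =
      ∑ a, if (ofWords sign word wt).exitIn (N + 1) a = some e then
        (ofWords sign word wt).lrot a else 0

instance : Decidable (CheckThrough sign word wt sign' word' wt' N) := by
  unfold CheckThrough
  infer_instance

/-- All circuits of a local picture pass through it. -/
def CheckOpen : Prop := ∀ a, (ofWords sign word wt).exitIn (N + 1) a ≠ none

instance : Decidable (CheckOpen sign word wt N) := by
  unfold CheckOpen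
  infer_instance

/-- All closed circuits of a local picture run through `a₀` and have at most four positions. -/
def CheckCircuit (a₀ : (ofWords sign word wt).Pos) : Prop :=
  ∀ a, (ofWords sign word wt).exitIn (N + 1) a = none → ∃ m : Fin 4,
    (fun b => Sum.elim id (fun _ => b) ((ofWords sign word wt).lstep b))^[(m : ℕ)] a₀ = a

instance (a₀) : Decidable (CheckCircuit sign word wt N a₀) := by
  unfold CheckCircuit
  infer_instance

/-- A local picture contains exactly one closed circuit, which has rotation number `-1` and is
separated along the segments from circuits passing through the picture. -/
def CheckClosed : Prop :=
  (∃ a₀, (ofWords sign word wt).exitIn (N + 1) a₀ = none ∧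
    CheckCircuit sign word wt N a₀) ∧
    (∑ a, if (ofWords sign word wt).exitIn (N + 1) a = none then
        (ofWords sign word wt).lrot a else 0) = -2 ∧
    (∃ e, sameLabel (circuitLabels sign word wt (N + 1)) (none, .top) (some e, .top) ∨
      sameLabel (circuitLabels sign word wt (N + 1)) (none, .top) (some e, .bottom)) ∧
    ∃ e, sameLabel (circuitLabels sign word wt (N + 1)) (none, .bottom) (some e, .top) ∨
      sameLabel (circuitLabels sign word wt (N + 1)) (none, .bottom) (some e, .bottom)

instance : Decidable (CheckClosed sign word wt N) := by
  unfold CheckClosed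
  infer_instance

/-- Adjacent sides of circuits of the first local picture are connected in the second one. -/
def CheckSides : Prop :=
  ∀ p, ((ofWords sign word wt).portAdj (N + 1) p).all fun x =>
    sameLabel (circuitLabels sign' word' wt' (N + 1)) x.1 x.2

instance : Decidable (CheckSides sign word wt sign' word' wt' N) := by
  unfold CheckSides
  infer_instance

/-- The hypotheses of `HasShadow.isFramed_glue`, in decidable form. -/
def Check : Prop :=
  (CheckStrands sign word wt N ∧ CheckStrands sign' word' wt' N) ∧
    (CheckStep sign word wt N ∧ CheckStep sign' word' wt' N) ∧
    CheckThrough sign word wt sign' word' wt' N ∧ CheckOpen sign word wt N ∧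
    ((c' = c ∧ CheckOpen sign' word' wt' N) ∨ (c' = c + 1 ∧ CheckClosed sign' word' wt' N)) ∧
    CheckSides sign word wt sign' word' wt' N

instance : Decidable (Check sign word wt sign' word' wt' N) := by
  unfold Check
  infer_instance

theorem CheckStep.step {sign : Fin c → Sign} {word : Fin n → List (Fin c × Strand)}
    {wt : Fin n → List ℤ} {N : ℕ} (h : CheckStep sign word wt N) (a a')
    (ha : (ofWords sign word wt).lstep a = Sum.inl a') :
    (ofWords sign word wt).exitIn (N + 1) a' = (ofWords sign word wt).exitIn (N + 1) a := by
  have := h a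
  rw [ha] at this
  simpa using this

theorem Check.isFramed_glue (h : Check sign word wt sign' word' wt' N) (C : Tangle ℤ n)
    (hf : (C.glue (ofWords sign word wt)).IsFramed) :
    (C.glue (ofWords sign' word' wt')).IsFramed := by
  obtain ⟨⟨h1, h1'⟩, ⟨h2, h2'⟩, h3, h4, h5, h6⟩ := h
  have hcard : ∀ (c : ℕ) (sign : Fin c → Sign) (word : Fin n → List (Fin c × Strand))
    (wt : Fin n → List ℤ), Nat.card (ofWords sign word wt).X = c := fun c _ _ _ => Nat.card_fin c
  -- The default `e` in `getD` is irrelevant: by `h3` every entry has an exit. Both pictures receive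
  -- the same `thr` and `ρ`, computed from the first one.
  have hS : (ofWords sign word wt).HasShadow N
      (fun e => ((ofWords sign word wt).exitIn (N + 1) ((ofWords sign word wt).entry e)).getD e)
      (fun e => ∑ a, if (ofWords sign word wt).exitIn (N + 1) a = some e then
        (ofWords sign word wt).lrot a else 0) := by
    refine ⟨h2.step, fun e => ?_, fun e _ => ?_⟩
    · obtain ⟨x, hx⟩ := Option.ne_none_iff_exists'.1 (h3 e).1
      rw [hx, Option.getD_some]
    · congr!
  have hS' : (ofWords sign' word' wt').HasShadow N
      (fun e => ((ofWords sign word wt).exitIn (N + 1) ((ofWords sign word wt).entry e)).getD e)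
      (fun e => ∑ a, if (ofWords sign word wt).exitIn (N + 1) a = some e then
        (ofWords sign word wt).lrot a else 0) := by
    refine ⟨h2'.step, fun e => ?_, fun e _ => ?_⟩
    · obtain ⟨x, hx⟩ := Option.ne_none_iff_exists'.1 (h3 e).1
      rw [(h3 e).2.1, hx, Option.getD_some]
    · rw [← (h3 e).2.2]
      congr!
  refine hS.isFramed_glue hS' (h1.hasStrands) (h1'.hasStrands) h4 ?_ ?_ ?_ hf
  · rw [hcard, hcard]
    refine h5.imp id (And.imp_right ?_)
    rintro ⟨⟨a₀, h7, h8⟩, h9, _⟩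
    refine ⟨a₀, h7, fun a ha => ?_, fun {_} => ?_⟩
    · obtain ⟨m, hm⟩ := h8 a ha
      exact ⟨m, hm⟩
    · rw [← h9]
      congr!
  · intro x y hxy
    obtain ⟨p, hp⟩ := (circuitAdj_iff _ _ _ _).1 hxy
    exact eqvGen_of_sameLabel _ _ _ _ (List.all_eq_true.1 (h6 p) _ hp)
  · intro a ha σ
    rcases h5 with ⟨_, h7⟩ | ⟨_, _, _, ⟨e, h7⟩, ⟨e', h8⟩⟩
    · exact absurd ha (h7 a)
    · cases σ with
      | top =>
        rcases h7 with h | h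
        · exact ⟨e, _, eqvGen_of_sameLabel _ _ _ _ h⟩
        · exact ⟨e, _, eqvGen_of_sameLabel _ _ _ _ h⟩
      | bottom =>
        rcases h8 with h | h
        · exact ⟨e', _, eqvGen_of_sameLabel _ _ _ _ h⟩
        · exact ⟨e', _, eqvGen_of_sameLabel _ _ _ _ h⟩

end check

end Tangle

/-! ### MP moves and H-moves preserve framedness -/

theorem MPType.isFramed_glue (t : MPType) (C : Tangle ℤ 3)
    (hf : (C.glue (Tangle.ofWords t.data.leftSign t.data.leftWord fun _ => [])).IsFramed) :
    (C.glue (Tangle.ofWords t.data.rightSign t.data.rightWord t.data.rightWeight)).IsFramed := by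
  -- The larger picture has 9 ports, hence 27 positions, so the search for exits never runs out of
  -- steps.
  refine Tangle.Check.isFramed_glue _ _ _ _ _ _ 28 ?_ C hf
  cases t <;> decide +kernel

open Strand in
/-- The local picture with a single crossing, whose weights are changed by `w` times an H-move. -/
def hPicture (ε : Sign) (w : List ℤ) : Tangle ℤ 2 :=
  Tangle.ofWords (n := 2) (c := 1) (fun _ => ε) ![[(0, upper)], [(0, lower)]] fun _ => w

/-- At each corner the boundary arrives with contribution `+1` and leaves with `-1`: on the third
line both the half-edge and the sign are reversed. So no rotation number changes. -/
theorem hPicture_isFramed_glue (ε : Sign) (C : Tangle ℤ 2)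
    (hf : (C.glue (hPicture ε [])).IsFramed) : (C.glue (hPicture ε [1, -1])).IsFramed := by
  refine Tangle.Check.isFramed_glue _ _ _ _ _ _ 28 ?_ C hf
  cases ε <;> decide +kernel


/-! ### Reading the strands of a local picture -/

/-- `l` lists the points passed on the way from `p` to `q`. -/
def Walk {P L : Type*} (next : P → P) (incl : L → P) : P → List L → P → Prop
  | p, [], q => next p = q
  | p, x :: l, q => next p = incl x ∧ Walk next incl (incl x) l q

/-- A point listed on a strand has a predecessor different from itself. This shows that a marked
point on a strand is not a closed curve by itself and can be erased. -/
theorem Walk.exists_ne {P L : Type*} {next : P → P} {incl : L → P} {p q : P} {l : List L} {x : L}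
    (h : Walk next incl p l q) (hp : p ≠ incl x) (hx : x ∈ l) :
    ∃ r, r ≠ incl x ∧ next r = incl x := by
  induction l generalizing p with
  | nil => simp at hx
  | cons y l ih =>
    by_cases hy : incl y = incl x
    · exact ⟨p, hp, h.1.trans hy⟩
    · refine ih h.2 hy ?_
      rcases List.mem_cons.1 hx with rfl | hx
      · exact absurd rfl hy
      · exact hx

/-- The sequence of passages of a strand starting at `p`, with the weight of the first segment and
the weights of the segments following the passages; marked points are ignored. -/
def sdata {X M P : Type*} {A : Type*} [Add A] (wt : P → A) (incl : X ⊕ M → P) :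
    P → List (X ⊕ M) → A × List (X × A)
  | p, [] => (wt p, [])
  | p, Sum.inl x :: l => (wt p, (x, (sdata wt incl (incl (Sum.inl x)) l).1) ::
      (sdata wt incl (incl (Sum.inl x)) l).2)
  | p, Sum.inr m :: l => (wt p + (sdata wt incl (incl (Sum.inr m)) l).1,
      (sdata wt incl (incl (Sum.inr m)) l).2)

/-- The list of passages of a strand, with weights. -/
abbrev StrandData (X : Type) : Type := ℤ × List ((X × Strand) × ℤ)

/-- Renaming of crossings. -/
def StrandData.map {X Y : Type} (f : X → Y) (d : StrandData X) : StrandData Y :=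
  (d.1, d.2.map (Prod.map (Prod.map f id) id))

namespace Tangle

variable {n : ℕ}

/-- The port of a passage or a marked point. -/
def incl {X M : Type} {n : ℕ} : X × Strand ⊕ M → Port X (M ⊕ Fin n) := Sum.map id Sum.inl

/-- The `k`-th strand of `T` runs successively through the points in `W k`. -/
structure Reads {A : Type} (T : Tangle A n) (W : Fin n → List (T.X × Strand ⊕ T.M)) : Prop where
  walk : ∀ k, Walk T.next incl (T.hole k) (W k) (T.hole k)
  cover : ∀ x, ∃ k, x ∈ W k

/-- The passages of the strand `k` of `T`, with weights, if it runs through the points in `l`. -/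
def strandData (T : Tangle ℤ n) (k : Fin n) (l : List (T.X × Strand ⊕ T.M)) : StrandData T.X :=
  sdata T.weight incl (T.hole k) l

/-- Up to marked points, `T` consists of the crossings `Y` with the given signs, and of the given
strands. -/
def Presents (T : Tangle ℤ n) {Y : Type} (sign : Y → Sign) (d : Fin n → StrandData Y) : Prop :=
  ∃ f : T.X ≃ Y, (∀ x, sign (f x) = T.sign x) ∧ ∃ W, T.Reads W ∧
    ∀ k, (T.strandData k (W k)).map f = d k

section erase

variable (T : Tangle ℤ n) {M' : Type} (e : T.M ≃ Option M')

/-- The ports of `T` other than an erased marked point. -/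
def keep : Port T.X (M' ⊕ Fin n) → Port T.X (T.M ⊕ Fin n) :=
  Sum.map id (Sum.map (fun m => e.symm (some m)) id)

/-- The erased marked point. -/
def erased : Port T.X (T.M ⊕ Fin n) := Sum.inr (Sum.inl (e.symm none))

/-- The ports of `T` are the kept ones and the erased one. -/
def keepEquiv : Option (Port T.X (M' ⊕ Fin n)) ≃ Port T.X (T.M ⊕ Fin n) where
  toFun o := o.elim (T.erased e) (T.keep e)
  invFun
    | Sum.inl x => some (Sum.inl x)
    | Sum.inr (Sum.inl m) => (e m).map fun m => Sum.inr (Sum.inl m)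
    | Sum.inr (Sum.inr k) => some (Sum.inr (Sum.inr k))
  left_inv := by rintro (_ | x | m | k) <;> simp [erased, keep]
  right_inv := by
    rintro (x | m | k)
    · rfl
    · obtain ⟨o, rfl⟩ := e.symm.surjective m
      cases o <;> simp [erased, keep]
    · rfl

variable {T e}

theorem keep_injective : Function.Injective (T.keep e) := fun _ _ h =>
  Option.some.inj ((T.keepEquiv e).injective h)

theorem keep_ne_erased (p) : T.keep e p ≠ T.erased e := fun h =>
  Option.some_ne_none p ((T.keepEquiv e).injective h)

theorem exists_keep {q} (h : q ≠ T.erased e) : ∃ p, T.keep e p = q := by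
  obtain ⟨o, rfl⟩ := (T.keepEquiv e).surjective q
  cases o with
  | none => exact absurd rfl h
  | some p => exact ⟨p, rfl⟩

/-- The letters of a strand other than an erased marked point. -/
def eraseLetter (T : Tangle ℤ n) (e : T.M ≃ Option M') :
    T.X × Strand ⊕ T.M → Option (T.X × Strand ⊕ M')
  | Sum.inl x => some (Sum.inl x)
  | Sum.inr m => (e m).map Sum.inr

theorem keep_incl (x : T.X × Strand ⊕ M') :
    T.keep e (incl x) = incl (Sum.map id (fun m => e.symm (some m)) x) := by
  rcases x with x | m <;> rfl

theorem eraseLetter_cases (x : T.X × Strand ⊕ T.M) :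
    (∃ y : T.X × Strand ⊕ M', x = Sum.map id (fun m => e.symm (some m)) y ∧
      T.eraseLetter e x = some y) ∨ (x = Sum.inr (e.symm none) ∧ T.eraseLetter e x = none) := by
  rcases x with x | m
  · exact Or.inl ⟨Sum.inl x, rfl, rfl⟩
  · obtain ⟨o, rfl⟩ := e.symm.surjective m
    cases o with
    | none => exact Or.inr ⟨rfl, by simp [eraseLetter]⟩
    | some m => exact Or.inl ⟨Sum.inr m, rfl, by simp [eraseLetter]⟩

variable (T e)

variable [Finite M']

open Classical in
/-- Erasing a marked point. -/
@[reducible]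
noncomputable def erase : Tangle ℤ n where
  X := T.X
  M := M'
  finX := T.finX
  finM := inferInstance
  sign := T.sign
  next := Equiv.removeNone (((T.keepEquiv e).trans T.next).trans (T.keepEquiv e).symm)
  weight p := T.weight (T.keep e p) +
    if T.next (T.keep e p) = T.erased e then T.weight (T.erased e) else 0

variable {T e}

theorem erase_weight_of_eq {p} (h : T.next (T.keep e p) = T.erased e) :
    (T.erase e).weight p = T.weight (T.keep e p) + T.weight (T.erased e) := by
  exact congrArg (T.weight (T.keep e p) + ·) (if_pos h)

theorem erase_weight_of_ne {p} (h : T.next (T.keep e p) ≠ T.erased e) :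
    (T.erase e).weight p = T.weight (T.keep e p) := by
  exact (congrArg (T.weight (T.keep e p) + ·) (if_neg h)).trans (add_zero _)

theorem keep_erase_next {p} (h : T.next (T.keep e p) ≠ T.erased e) :
    T.keep e ((T.erase e).next p) = T.next (T.keep e p) := by
  obtain ⟨q, hq⟩ := exists_keep h
  have h1 : (((T.keepEquiv e).trans T.next).trans (T.keepEquiv e).symm) (some p) = some q := by
    simp only [Equiv.trans_apply]
    rw [Equiv.symm_apply_eq]
    exact hq.symm
  have h2 := Equiv.removeNone_some _ ⟨q, h1⟩
  rw [h1] at h2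
  rw [← hq]
  exact congrArg _ (Option.some.inj h2)

theorem keep_erase_next' {p} (h : T.next (T.keep e p) = T.erased e) :
    T.keep e ((T.erase e).next p) = T.next (T.erased e) := by
  have h1 : (((T.keepEquiv e).trans T.next).trans (T.keepEquiv e).symm) (some p) = none := by
    simp only [Equiv.trans_apply]
    rw [Equiv.symm_apply_eq]
    exact h
  have h2 := Equiv.removeNone_none _ h1
  have h3 := congrArg (T.keepEquiv e) h2
  simp only [Equiv.trans_apply, Equiv.apply_symm_apply] at h3
  exact h3

/-- Restoring the erased point subdivides the segment that ends at it, which carries the weights of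
both parts. A fixed point of `next` must be excluded, as it would be a whole closed curve. -/
theorem subdivides_erase (hn : T.next (T.erased e) ≠ T.erased e) (C : Tangle ℤ n) :
    Diagram.Subdivides (C.glue (T.erase e)) (C.glue T) := by
  obtain ⟨p₀, hp₀⟩ : ∃ p, T.keep e p = T.next.symm (T.erased e) := by
    refine exists_keep fun h => hn ?_
    rw [← h, Equiv.apply_symm_apply, h]
  have hp₁ : T.next (T.keep e p₀) = T.erased e := by rw [hp₀, Equiv.apply_symm_apply]
  let g : Option ((C.M ⊕ Fin n) ⊕ (M' ⊕ Fin n)) ≃ (C.M ⊕ Fin n) ⊕ (T.M ⊕ Fin n) :=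
    { toFun := fun o => o.elim (Sum.inr (Sum.inl (e.symm none)))
        (Sum.map id (Sum.map (fun m => e.symm (some m)) id))
      invFun := fun s => match s with
        | Sum.inl m => some (Sum.inl m)
        | Sum.inr (Sum.inl m) => (e m).map fun m => Sum.inr (Sum.inl m)
        | Sum.inr (Sum.inr k) => some (Sum.inr (Sum.inr k))
      left_inv := by rintro (_ | m | m | k) <;> simp
      right_inv := by
        rintro (m | m | k)
        · rfl
        · obtain ⟨o, rfl⟩ := e.symm.surjective m
          cases o <;> simp
        · rfl }
  refine ⟨Equiv.refl _, g, C.inT (T.erase e) p₀, ?_⟩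
  intro ι μ
  have hC : ∀ p, ι (C.inC (T.erase e) p) = C.inC T p := by
    rintro (⟨x, s⟩ | m) <;> rfl
  have hT : ∀ p, ι (C.inT (T.erase e) p) = C.inT T (T.keep e p) := by
    rintro (⟨x, s⟩ | m | k) <;> rfl
  have hμ : μ = C.inT T (T.erased e) := rfl
  have hEC : ∀ q, ι (C.endC (T.erase e) q) = C.endC T q := by
    rintro (⟨x, s⟩ | m | k) <;> rfl
  have hET : ∀ q, ι (C.endT (T.erase e) q) = C.endT T (T.keep e q) := by
    rintro (⟨x, s⟩ | m | k) <;> rfl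
  have hE : C.endT T (T.erased e) = C.inT T (T.erased e) := rfl
  have hwC : ∀ (T : Tangle ℤ n) p, (C.glue T).weight (C.inC T p) = C.weight p := by
    rintro T (⟨x, s⟩ | m) <;> rfl
  have hwT : ∀ (T : Tangle ℤ n) p, (C.glue T).weight (C.inT T p) = T.weight p := by
    rintro T (⟨x, s⟩ | m) <;> rfl
  refine ⟨fun _ => rfl, ?_, ?_, ?_, ?_, ?_⟩
  · rw [hT, glue_next_inT, hp₁, hμ, hE]
  · rw [hμ, glue_next_inT, glue_next_inT, hET, keep_erase_next' hp₁]
  · intro q hq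
    obtain ⟨p, rfl⟩ | ⟨p, rfl⟩ := C.port_cases _ q
    · rw [hC, glue_next_inC, glue_next_inC, hEC]
    · rw [hT, glue_next_inT, glue_next_inT, hET, keep_erase_next]
      intro h
      apply hq
      rw [keep_injective (T.next.injective (h.trans hp₁.symm))]
  · rw [hT, hμ, hwT, hwT, hwT, erase_weight_of_eq hp₁]
  · intro q hq
    obtain ⟨p, rfl⟩ | ⟨p, rfl⟩ := C.port_cases _ q
    · rw [hC, hwC, hwC]
    · rw [hT, hwT, hwT, erase_weight_of_ne]
      intro h
      apply hq
      rw [keep_injective (T.next.injective (h.trans hp₁.symm))]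

theorem walk_erase (hn : T.next (T.erased e) ≠ T.erased e) {p q} {l : List (T.X × Strand ⊕ T.M)}
    (h : Walk T.next incl (T.keep e p) l (T.keep e q)) :
    Walk (T.erase e).next incl p (l.filterMap (T.eraseLetter e)) q ∧
      sdata (T.erase e).weight incl p (l.filterMap (T.eraseLetter e)) =
        sdata T.weight incl (T.keep e p) l := by
  have hm : (incl (n := n) (Sum.inr (e.symm none) : T.X × Strand ⊕ T.M)) = T.erased e := rfl
  induction hN : l.length using Nat.strong_induction_on generalizing p l with
  -- The induction is strong because an erased letter is treated together with its successor.
  | _ N ih =>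
  subst hN
  cases l with
  | nil =>
    have h1 : T.next (T.keep e p) ≠ T.erased e := by
      rw [show T.next (T.keep e p) = _ from h]
      exact keep_ne_erased q
    refine ⟨keep_injective (T := T) (e := e) ((keep_erase_next h1).trans h), ?_⟩
    simp [sdata, if_neg h1]
  | cons x l =>
    obtain ⟨h1, h2⟩ := h
    obtain ⟨y, rfl, hy⟩ | ⟨rfl, hx⟩ := eraseLetter_cases (e := e) x
    · rw [← keep_incl] at h1 h2
      have h3 : T.next (T.keep e p) ≠ T.erased e := by
        rw [h1]
        exact keep_ne_erased _
      obtain ⟨h4, h5⟩ := ih l.length (by simp) h2 rfl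
      rw [List.filterMap_cons_some hy]
      refine ⟨⟨keep_injective (T := T) (e := e) ((keep_erase_next h3).trans h1), h4⟩, ?_⟩
      rcases y with y | m
      · simp only [sdata, Sum.map_inl, id, if_neg h3, add_zero]
        rw [h5, keep_incl]
        rfl
      · simp only [sdata, Sum.map_inr, if_neg h3, add_zero]
        rw [h5, keep_incl]
        rfl
    · rw [hm] at h1 h2
      rw [List.filterMap_cons_none hx]
      cases l with
      | nil =>
        refine ⟨keep_injective (T := T) (e := e) ((keep_erase_next' h1).trans h2), ?_⟩
        simp [sdata, if_pos h1, hm]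
      | cons y l =>
        obtain ⟨h2, h3⟩ := h2
        obtain ⟨z, rfl, hz⟩ | ⟨rfl, hx⟩ := eraseLetter_cases (e := e) y
        · rw [← keep_incl] at h2 h3
          obtain ⟨h4, h5⟩ := ih l.length (by simp) h3 rfl
          rw [List.filterMap_cons_some hz]
          refine ⟨⟨keep_injective (T := T) (e := e) ((keep_erase_next' h1).trans h2), h4⟩, ?_⟩
          rcases z with z | m
          · simp only [sdata, Sum.map_inl, id, if_pos h1, hm]
            rw [h5, keep_incl]
            rfl
          · simp only [sdata, Sum.map_inr, if_pos h1, hm]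
            rw [h5]
            simp only [add_assoc, keep_incl]
            rfl
        -- The erased point cannot follow itself.
        · exact absurd h2 hn

theorem Presents.erase {Y : Type} {sign : Y → Sign} {d : Fin n → StrandData Y}
    (h : T.Presents sign d) (e : T.M ≃ Option M') :
    (T.erase e).Presents sign d ∧
      ∀ C : Tangle ℤ n, NormalOGraph.mk (C.glue (T.erase e)) = NormalOGraph.mk (C.glue T) := by
  obtain ⟨f, hf, W, hW, hd⟩ := h
  have hn : T.next (T.erased e) ≠ T.erased e := by
    obtain ⟨k, hk⟩ := hW.cover (Sum.inr (e.symm none))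
    obtain ⟨r, h1, h2⟩ := (hW.walk k).exists_ne (by simp [hole, incl]) hk
    intro h3
    exact h1 (T.next.injective (h2.trans h3.symm))
  refine ⟨⟨f, hf, fun k => (W k).filterMap (T.eraseLetter e), ⟨fun k => ?_, fun x => ?_⟩,
    fun k => ?_⟩, fun C => Quot.sound (Or.inr (subdivides_erase hn C))⟩
  · exact (walk_erase (p := (T.erase e).hole k) (q := (T.erase e).hole k) hn (hW.walk k)).1
  · obtain ⟨k, hk⟩ := hW.cover (Sum.map id (fun m => e.symm (some m)) x)
    refine ⟨k, List.mem_filterMap.2 ⟨_, hk, ?_⟩⟩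
    rcases x with x | m
    · rfl
    · simp [eraseLetter]
  · rw [← hd k]
    exact congrArg _ (walk_erase (p := (T.erase e).hole k) (q := (T.erase e).hole k) hn
      (hW.walk k)).2

end erase

theorem Presents.exists_isEmpty {T : Tangle ℤ n} {Y : Type} {sign : Y → Sign}
    {d : Fin n → StrandData Y} (h : T.Presents sign d) :
    ∃ T' : Tangle ℤ n, IsEmpty T'.M ∧ T'.Presents sign d ∧
      ∀ C : Tangle ℤ n, NormalOGraph.mk (C.glue T') = NormalOGraph.mk (C.glue T) := by
  obtain ⟨N, ⟨e⟩⟩ := Finite.exists_equiv_fin T.M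
  induction N generalizing T with
  | zero => exact ⟨T, e.isEmpty, h, fun _ => rfl⟩
  | succ N ih =>
    obtain ⟨h1, h2⟩ := h.erase (e.trans (finSuccEquiv N))
    obtain ⟨T', h3, h4, h5⟩ := ih h1 (Equiv.refl _)
    exact ⟨T', h3, h4, fun C => (h5 C).trans (h2 C)⟩

end Tangle
-- Local pictures with the same strand data present the same normal o-graph
namespace Tangle

variable {n : ℕ}

/-- The renaming of ports of pictures without marked points. -/
def rename {X X' M M' : Type} [IsEmpty M] (g : X → X') :
    Port X (M ⊕ Fin n) → Port X' (M' ⊕ Fin n) :=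
  Sum.map (Prod.map g id) (Sum.map isEmptyElim id)

/-- Without marked points the letters of a strand are the recorded passages. So the data determine,
along the strand, the successor and the weight of every port, up to the renaming of crossings. -/
theorem walk_unique {X X' Y M M' : Type} [IsEmpty M] [IsEmpty M'] {f : X ≃ Y} {f' : X' ≃ Y}
    {next : Port X (M ⊕ Fin n) → Port X (M ⊕ Fin n)}
    {next' : Port X' (M' ⊕ Fin n) → Port X' (M' ⊕ Fin n)}
    {wt : Port X (M ⊕ Fin n) → ℤ} {wt' : Port X' (M' ⊕ Fin n) → ℤ}
    {p q : Port X (M ⊕ Fin n)} {l : List (X × Strand ⊕ M)} {l' : List (X' × Strand ⊕ M')}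
    (h : Walk next incl p l q)
    (h' : Walk next' incl (rename (f.trans f'.symm) p) l' (rename (f.trans f'.symm) q))
    (hd : StrandData.map f (sdata wt incl p l) =
      StrandData.map f' (sdata wt' incl (rename (f.trans f'.symm) p) l')) :
    ∀ r, r = p ∨ (∃ x ∈ l, r = incl x) →
      next' (rename (f.trans f'.symm) r) = rename (f.trans f'.symm) (next r) ∧
        wt' (rename (f.trans f'.symm) r) = wt r := by
  induction l generalizing p l' with
  | nil =>
    rcases l' with _ | ⟨x | m, l'⟩
    · rintro r (rfl | ⟨x, hx, -⟩)
      · exact ⟨h'.trans (congrArg _ h.symm), (congrArg Prod.fst hd).symm⟩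
      · simp at hx
    · exact absurd (congrArg (fun d => d.2.length) hd) (by simp [sdata, StrandData.map])
    · exact isEmptyElim m
  | cons x l ih =>
    rcases x with x | m
    · rcases l' with _ | ⟨x' | m, l'⟩
      · exact absurd (congrArg (fun d => d.2.length) hd) (by simp [sdata, StrandData.map])
      · simp only [sdata, StrandData.map, List.map_cons, Prod.mk.injEq, List.cons.injEq,
          Prod.map] at hd
        obtain ⟨h1, ⟨⟨h2, h3⟩, h4⟩, h5⟩ := hd
        have hx : rename (f.trans f'.symm) (incl (Sum.inl x) : Port X (M ⊕ Fin n)) =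
            (incl (Sum.inl x') : Port X' (M' ⊕ Fin n)) := by
          refine congrArg Sum.inl (Prod.ext ?_ h3)
          simp [h2]
        obtain ⟨h6, h7⟩ := h
        obtain ⟨h8, h9⟩ := h'
        rw [← hx] at h8 h9 h4 h5
        have h10 := ih h7 h9 (Prod.ext h4 h5)
        rintro r (rfl | ⟨y, hy, rfl⟩)
        · exact ⟨h8.trans (congrArg _ h6.symm), h1.symm⟩
        · rcases List.mem_cons.1 hy with rfl | hy
          · exact h10 _ (Or.inl rfl)
          · exact h10 _ (Or.inr ⟨y, hy, rfl⟩)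
      · exact isEmptyElim m
    · exact isEmptyElim m

/-- By `cover`, every port lies on one of the strands, so agreement along the strands is agreement
everywhere. -/
theorem Presents.iso {T T' : Tangle ℤ n} [IsEmpty T.M] [IsEmpty T'.M] {Y : Type} {sign : Y → Sign}
    {d : Fin n → StrandData Y} (h : T.Presents sign d) (h' : T'.Presents sign d) (C : Tangle ℤ n) :
    Diagram.Iso (C.glue T) (C.glue T') := by
  obtain ⟨f, hf, W, hW, hd⟩ := h
  obtain ⟨f', hf', W', hW', hd'⟩ := h'
  let φ : Port T.X (T.M ⊕ Fin n) → Port T'.X (T'.M ⊕ Fin n) := rename (f.trans f'.symm)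
  have key : ∀ r, T'.next (φ r) = φ (T.next r) ∧ T'.weight (φ r) = T.weight r := by
    intro r
    obtain ⟨k, hk⟩ : ∃ k, r = T.hole k ∨ ∃ x ∈ W k, r = incl x := by
      rcases r with x | m | k
      · obtain ⟨k, hk⟩ := hW.cover (Sum.inl x)
        exact ⟨k, Or.inr ⟨_, hk, rfl⟩⟩
      · exact isEmptyElim m
      · exact ⟨k, Or.inl rfl⟩
    exact walk_unique (hW.walk k) (hW'.walk k) ((hd k).trans (hd' k).symm) r hk
  have hC : ∀ p, Sum.map (Prod.map (Equiv.sumCongr (Equiv.refl C.X) (f.trans f'.symm)) id)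
      (Equiv.sumCongr (Equiv.refl (C.M ⊕ Fin n))
        (Equiv.sumCongr (Equiv.equivOfIsEmpty T.M T'.M) (Equiv.refl (Fin n)))) (C.inC T p) =
      C.inC T' p := by
    rintro (⟨x, s⟩ | m) <;> rfl
  have hT : ∀ p, Sum.map (Prod.map (Equiv.sumCongr (Equiv.refl C.X) (f.trans f'.symm)) id)
      (Equiv.sumCongr (Equiv.refl (C.M ⊕ Fin n))
        (Equiv.sumCongr (Equiv.equivOfIsEmpty T.M T'.M) (Equiv.refl (Fin n)))) (C.inT T p) =
      C.inT T' (φ p) := by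
    rintro (⟨x, s⟩ | m | m) <;> rfl
  have hEC : ∀ p, Sum.map (Prod.map (Equiv.sumCongr (Equiv.refl C.X) (f.trans f'.symm)) id)
      (Equiv.sumCongr (Equiv.refl (C.M ⊕ Fin n))
        (Equiv.sumCongr (Equiv.equivOfIsEmpty T.M T'.M) (Equiv.refl (Fin n)))) (C.endC T p) =
      C.endC T' p := by
    rintro (⟨x, s⟩ | m | k) <;> rfl
  have hET : ∀ p, Sum.map (Prod.map (Equiv.sumCongr (Equiv.refl C.X) (f.trans f'.symm)) id)
      (Equiv.sumCongr (Equiv.refl (C.M ⊕ Fin n))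
        (Equiv.sumCongr (Equiv.equivOfIsEmpty T.M T'.M) (Equiv.refl (Fin n)))) (C.endT T p) =
      C.endT T' (φ p) := by
    rintro (⟨x, s⟩ | m | k) <;> rfl
  have hwC : ∀ (T : Tangle ℤ n) p, (C.glue T).weight (C.inC T p) = C.weight p := by
    rintro T (⟨x, s⟩ | m) <;> rfl
  have hwT : ∀ (T : Tangle ℤ n) p, (C.glue T).weight (C.inT T p) = T.weight p := by
    rintro T (⟨x, s⟩ | m) <;> rfl
  refine ⟨Equiv.sumCongr (Equiv.refl _) (f.trans f'.symm), Equiv.sumCongr (Equiv.refl _)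
    (Equiv.sumCongr (Equiv.equivOfIsEmpty T.M T'.M) (Equiv.refl (Fin n))), ?_, ?_, ?_⟩
  · rintro (x | x)
    · rfl
    · exact (hf' _).symm.trans ((congrArg sign (by simp)).trans (hf x))
  · intro p
    obtain ⟨p, rfl⟩ | ⟨p, rfl⟩ := C.port_cases _ p
    · exact (congrArg _ (hC p)).trans ((C.glue_next_inC T' p).trans
        ((hEC _).symm.trans (congrArg _ (C.glue_next_inC T p).symm)))
    · refine (congrArg _ (hT p)).trans ((C.glue_next_inT T' _).trans ?_)
      rw [(key p).1]
      exact (hET _).symm.trans (congrArg _ (C.glue_next_inT T p).symm)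
  · intro p
    obtain ⟨p, rfl⟩ | ⟨p, rfl⟩ := C.port_cases _ p
    · exact (congrArg _ (hC p)).trans ((hwC T' p).trans (hwC T p).symm)
    · exact (congrArg _ (hT p)).trans ((hwT T' _).trans ((key p).2.trans (hwT T p).symm))

/-- Two local pictures with the same strands are interchangeable. -/
theorem Presents.mk_glue_eq {T T' : Tangle ℤ n} {Y : Type} {sign : Y → Sign}
    {d : Fin n → StrandData Y} (h : T.Presents sign d) (h' : T'.Presents sign d) (C : Tangle ℤ n) :
    NormalOGraph.mk (C.glue T) = NormalOGraph.mk (C.glue T') := by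
  obtain ⟨S, h1, h2, h3⟩ := h.exists_isEmpty
  obtain ⟨S', h1', h2', h3'⟩ := h'.exists_isEmpty
  rw [← h3, ← h3']
  exact Quot.sound (Or.inl (h2.iso h2' C))

end Tangle

/-! ### Local pictures inserted in larger local pictures -/

namespace Diagram

/-- A conjugacy of the circuits of two diagrams preserves rotation numbers. -/
theorem RotationBetween.of_conj {D D' : Diagram ℤ} (ι : D.Position → D'.Position)
    (hι : Function.Injective ι) (hstep : ∀ a, D'.step (ι a) = ι (D.step a))
    (hw : ∀ a, D'.signedWeight (ι a) = D.signedWeight a) (hd : ∀ a, D'.dot (ι a) = D.dot a)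
    {a b : D.Position} {p : ℚ} (h : D'.RotationBetween (ι a) (ι b) p) :
    D.RotationBetween a b p := by
  have hit : ∀ n, D'.step^[n] (ι a) = ι (D.step^[n] a) := fun n =>
    ((Function.Semiconj.iterate_right (f := ι) (ga := D.step) (gb := D'.step)
      (fun a => (hstep a).symm) n) a).symm
  obtain ⟨n, h1, h2, h3⟩ := h
  refine ⟨n, hι (by rw [← hit, h1]), fun m hm h => h2 m hm (by rw [hit, h]), ?_⟩
  rw [h3]
  simp only [hit, hw, hd]

/-- Opening a diagram at some of its marked points. -/
def cut {A : Type} {n : ℕ} {N : Type} (D : Diagram A) (e : D.M ≃ N ⊕ Fin n) : Tangle A n where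
  X := D.X
  M := N
  finX := D.finX
  finM := by
    have := D.finM
    have := Finite.of_equiv _ e
    exact Finite.sum_left (Fin n)
  sign := D.sign
  next := (Equiv.sumCongr (Equiv.refl _) e).permCongr D.next
  weight p := D.weight ((Equiv.sumCongr (Equiv.refl _) e).symm p)

theorem cut_next {A : Type} {n : ℕ} {N : Type} (D : Diagram A) (e : D.M ≃ N ⊕ Fin n)
    (p : Port D.X D.M) : (D.cut e).next (Sum.map id e p) = Sum.map id e (D.next p) := by
  have h : (Equiv.sumCongr (Equiv.refl _) e).symm (Sum.map id e p) = p :=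
    (Equiv.sumCongr (Equiv.refl (D.X × Strand)) e).symm_apply_apply p
  exact congrArg (fun q => Sum.map id e (D.next q)) h

end Diagram

/-- A local picture with `n` strands and `m` holes, in which a local picture with `m` strands can
be inserted. -/
structure Context (n m : ℕ) where
  X : Type
  finX : Finite X
  sign : X → Sign
  next : Equiv.Perm (Port X (Fin m ⊕ Fin n))
  weight : Port X (Fin m ⊕ Fin n) → ℤ

namespace Context

variable {n m : ℕ}

/-- A context as a local picture with marked points. -/
def inner (K : Context n m) : Tangle ℤ n where
  X := K.X
  M := Fin m
  finX := K.finX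
  finM := inferInstance
  sign := K.sign
  next := K.next
  weight := K.weight

/-- A context as an outside with marked points. -/
def outer (K : Context n m) : Tangle ℤ m where
  X := K.X
  M := Fin n
  finX := K.finX
  finM := inferInstance
  sign := K.sign
  next := (Equiv.sumCongr (Equiv.refl _) (Equiv.sumComm (Fin m) (Fin n))).permCongr K.next
  weight p := K.weight (Sum.map id Sum.swap p)

/-- The marked points of an extended outside. -/
def extMarks (M : Type) (n m : ℕ) :
    (M ⊕ Fin n) ⊕ (Fin m ⊕ Fin n) ≃ ((M ⊕ Fin n) ⊕ Fin n) ⊕ Fin m where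
  toFun
    | Sum.inl x => Sum.inl (Sum.inl x)
    | Sum.inr (Sum.inl h) => Sum.inr h
    | Sum.inr (Sum.inr k) => Sum.inl (Sum.inr k)
  invFun
    | Sum.inl (Sum.inl x) => Sum.inl x
    | Sum.inr h => Sum.inr (Sum.inl h)
    | Sum.inl (Sum.inr k) => Sum.inr (Sum.inr k)
  left_inv := by rintro (x | h | k) <;> rfl
  right_inv := by rintro ((x | k) | h) <;> rfl

/-- The marked points of a local picture inserted in a context. -/
def compMarks (M : Type) (n m : ℕ) :
    (Fin n ⊕ Fin m) ⊕ (M ⊕ Fin m) ≃ (Fin m ⊕ (M ⊕ Fin m)) ⊕ Fin n where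
  toFun
    | Sum.inr x => Sum.inl (Sum.inr x)
    | Sum.inl (Sum.inr h) => Sum.inl (Sum.inl h)
    | Sum.inl (Sum.inl k) => Sum.inr k
  invFun
    | Sum.inl (Sum.inr x) => Sum.inr x
    | Sum.inl (Sum.inl h) => Sum.inl (Sum.inr h)
    | Sum.inr k => Sum.inl (Sum.inl k)
  left_inv := by rintro ((k | h) | x) <;> rfl
  right_inv := by rintro ((h | x) | k) <;> rfl

/-- The outside obtained by inserting the context `K` in the outside `C`. -/
def ext (C : Tangle ℤ n) (K : Context n m) : Tangle ℤ m :=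
  (C.glue K.inner).cut (extMarks C.M n m)

/-- The local picture obtained by inserting the local picture `L` in the context `K`. -/
def comp (K : Context n m) (L : Tangle ℤ m) : Tangle ℤ n :=
  (K.outer.glue L).cut (compMarks L.M n m)

section

variable (C : Tangle ℤ n) (K : Context n m) (L : Tangle ℤ m)

/-- The crossings of an iterated insertion. -/
def isoX : ((ext C K).glue L).X ≃ (C.glue (K.comp L)).X := Equiv.sumAssoc C.X K.X L.X

/-- The marked points of an iterated insertion. -/
def isoM : ((ext C K).glue L).M ≃ (C.glue (K.comp L)).M where
  toFun
    | Sum.inl (Sum.inl (Sum.inl x)) => Sum.inl x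
    | Sum.inl (Sum.inl (Sum.inr k)) => Sum.inr (Sum.inr k)
    | Sum.inl (Sum.inr h) => Sum.inr (Sum.inl (Sum.inl h))
    | Sum.inr x => Sum.inr (Sum.inl (Sum.inr x))
  invFun
    | Sum.inl x => Sum.inl (Sum.inl (Sum.inl x))
    | Sum.inr (Sum.inr k) => Sum.inl (Sum.inl (Sum.inr k))
    | Sum.inr (Sum.inl (Sum.inl h)) => Sum.inl (Sum.inr h)
    | Sum.inr (Sum.inl (Sum.inr x)) => Sum.inr x
  left_inv := by rintro (((x | k) | h) | x) <;> rfl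
  right_inv := by rintro (x | (h | x) | k) <;> rfl

/-- The ports of an iterated insertion. -/
def isoPort : Port ((ext C K).glue L).X ((ext C K).glue L).M →
    Port (C.glue (K.comp L)).X (C.glue (K.comp L)).M :=
  Sum.map (Prod.map (isoX C K L) id) (isoM C K L)

theorem isoPort_injective : Function.Injective (isoPort C K L) :=
  ((isoX C K L).injective.prodMap Function.injective_id).sumMap (isoM C K L).injective

theorem sign_isoX (x) : (C.glue (K.comp L)).sign (isoX C K L x) = ((ext C K).glue L).sign x := by
  rcases x with (x | x) | x <;> rfl

/-- The ports of an iterated insertion are those of the outside, of the context and of the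
inside. -/
theorem ext_glue_cases (p : Port ((ext C K).glue L).X ((ext C K).glue L).M) :
    (∃ q, p = (ext C K).inC L (Sum.map id (extMarks C.M n m) (C.inC K.inner q))) ∨
    (∃ q, p = (ext C K).inC L (Sum.map id (extMarks C.M n m) (C.inT K.inner q))) ∨
      ∃ q, p = (ext C K).inT L q := by
  rcases p with ⟨(x | x) | x, s⟩ | ((x | k) | h) | x
  · exact Or.inl ⟨Sum.inl (x, s), rfl⟩
  · exact Or.inr (Or.inl ⟨Sum.inl (x, s), rfl⟩)
  · exact Or.inr (Or.inr ⟨Sum.inl (x, s), rfl⟩)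
  · exact Or.inl ⟨Sum.inr x, rfl⟩
  · exact Or.inr (Or.inl ⟨Sum.inr (Sum.inr k), rfl⟩)
  · exact Or.inr (Or.inl ⟨Sum.inr (Sum.inl h), rfl⟩)
  · exact Or.inr (Or.inr ⟨Sum.inr x, rfl⟩)

theorem isoPort_inC (q) :
    isoPort C K L ((ext C K).inC L (Sum.map id (extMarks C.M n m) (C.inC K.inner q))) =
      C.inC (K.comp L) q := by
  rcases q with ⟨x, s⟩ | x <;> rfl

theorem isoPort_inK (q) :
    isoPort C K L ((ext C K).inC L (Sum.map id (extMarks C.M n m) (C.inT K.inner q))) =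
      C.inT (K.comp L)
        (Sum.map id (compMarks L.M n m) (K.outer.inC L (Sum.map id Sum.swap q))) := by
  rcases q with ⟨x, s⟩ | h | k <;> rfl

theorem isoPort_inT (q) : isoPort C K L ((ext C K).inT L q) =
    C.inT (K.comp L) (Sum.map id (compMarks L.M n m) (K.outer.inT L q)) := by
  rcases q with ⟨x, s⟩ | x <;> rfl

theorem outer_next (q) : K.outer.next (Sum.map id Sum.swap q) = Sum.map id Sum.swap (K.next q) := by
  have h : (Equiv.sumCongr (Equiv.refl _) (Equiv.sumComm (Fin m) (Fin n))).symm
      (Sum.map id Sum.swap q) = q :=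
    (Equiv.sumCongr (Equiv.refl (K.X × Strand)) (Equiv.sumComm (Fin m) (Fin n))).symm_apply_apply q
  exact congrArg (fun q => Sum.map id Sum.swap (K.next q)) h

theorem next_isoPort (p) : (C.glue (K.comp L)).next (isoPort C K L p) =
    isoPort C K L (((ext C K).glue L).next p) := by
  obtain ⟨q, rfl⟩ | ⟨q, rfl⟩ | ⟨q, rfl⟩ := ext_glue_cases C K L p
  · have h : (ext C K).next (Sum.map id (extMarks C.M n m) (C.inC K.inner q)) =
        Sum.map id (extMarks C.M n m) (C.endC K.inner (C.next q)) :=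
      (Diagram.cut_next _ _ _).trans (congrArg _ (C.glue_next_inC K.inner q))
    rw [isoPort_inC, Tangle.glue_next_inC, Tangle.glue_next_inC, h]
    generalize C.next q = r
    rcases r with ⟨x, s⟩ | x | k <;> rfl
  · have h : (ext C K).next (Sum.map id (extMarks C.M n m) (C.inT K.inner q)) =
        Sum.map id (extMarks C.M n m) (C.endT K.inner (K.next q)) :=
      (Diagram.cut_next _ _ _).trans (congrArg _ (C.glue_next_inT K.inner q))
    have h' : (K.comp L).next (Sum.map id (compMarks L.M n m)
        (K.outer.inC L (Sum.map id Sum.swap q))) =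
        Sum.map id (compMarks L.M n m) (K.outer.endC L (Sum.map id Sum.swap (K.next q))) :=
      (Diagram.cut_next _ _ _).trans (congrArg _
        ((K.outer.glue_next_inC L _).trans (congrArg _ (outer_next K q))))
    rw [isoPort_inK, Tangle.glue_next_inC, Tangle.glue_next_inT, h, h']
    generalize K.next q = r
    rcases r with ⟨x, s⟩ | h | k <;> rfl
  · have h' : (K.comp L).next (Sum.map id (compMarks L.M n m) (K.outer.inT L q)) =
        Sum.map id (compMarks L.M n m) (K.outer.endT L (L.next q)) :=
      (Diagram.cut_next _ _ _).trans (congrArg _ (K.outer.glue_next_inT L q))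
    rw [isoPort_inT, Tangle.glue_next_inT, Tangle.glue_next_inT, h']
    generalize L.next q = r
    rcases r with ⟨x, s⟩ | x | h <;> rfl

theorem weight_isoPort (p) :
    (C.glue (K.comp L)).weight (isoPort C K L p) = ((ext C K).glue L).weight p := by
  obtain ⟨q, rfl⟩ | ⟨q, rfl⟩ | ⟨q, rfl⟩ := ext_glue_cases C K L p
  · rcases q with ⟨x, s⟩ | x <;> rfl
  · rcases q with ⟨x, s⟩ | x | x <;> rfl
  · rcases q with ⟨x, s⟩ | x <;> rfl

/-- Insertion is associative. This lets a move act on part of a picture: the remainder of the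
picture is absorbed in the outside. -/
theorem mk_ext_glue :
    NormalOGraph.mk ((ext C K).glue L) = NormalOGraph.mk (C.glue (K.comp L)) :=
  Quot.sound (Or.inl ⟨isoX C K L, isoM C K L, sign_isoX C K L, next_isoPort C K L,
    weight_isoPort C K L⟩)

/-- The marked point of `K.comp L` at the beginning of the `h`-th strand of `L`. -/
def start (h : Fin m) : Port (K.comp L).X ((K.comp L).M ⊕ Fin n) :=
  Sum.inr (Sum.inl (Sum.inr (Sum.inr h)))

/-- Rotation numbers between strands of an inserted picture can be computed from the viewpoint of
the original outside. -/
theorem rotationBetween_ext {h h' : Fin m} {i j : Line} {p : ℚ}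
    (H : (C.glue (K.comp L)).RotationBetween (C.posT (K.comp L) (K.start L h, i))
      (C.posT (K.comp L) (K.start L h', j)) p) :
    ((ext C K).glue L).RotationBetween ((ext C K).firstSegment L h, i)
      ((ext C K).firstSegment L h', j) p := by
  have hstep : ∀ a, (C.glue (K.comp L)).step (Prod.map (isoPort C K L) id a) =
      Prod.map (isoPort C K L) id (((ext C K).glue L).step a) :=
    Diagram.step_rename (isoX C K L) (isoM C K L) (sign_isoX C K L) (next_isoPort C K L)
  refine Diagram.RotationBetween.of_conj (Prod.map (isoPort C K L) id)
    ((isoPort_injective C K L).prodMap Function.injective_id) hstep ?_ ?_ H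
  · rintro ⟨p, i⟩
    simp only [Diagram.signedWeight, Prod.map, weight_isoPort, id]
  · intro a
    rw [Diagram.dot, Diagram.dot, hstep a]
    rfl

end

end Context

/-! ### Rotation numbers along paths inside a local picture -/

namespace Diagram

variable {D : Diagram ℤ} {a b : D.Position}

theorem RotationBetween.of_sum {n : ℕ} (hab : D.step^[n] a = b)
    (hne : ∀ m < n, D.step^[m] a ≠ b) (hw : D.signedWeight a = 0) :
    D.RotationBetween a b ((∑ m ∈ Finset.range n, D.rot (D.step^[m] a) : ℤ) / 2 : ℚ) := by
  refine ⟨n, hab, hne, ?_⟩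
  -- The rotation number omits the weight of the starting position, while `rot` includes it; the two
  -- agree as this weight is zero.
  have h1 : (∑ m ∈ Finset.Ioo 0 n, (D.signedWeight (D.step^[m] a) : ℚ)) =
      ∑ m ∈ Finset.range n, (D.signedWeight (D.step^[m] a) : ℚ) := by
    refine Finset.sum_subset (fun m hm => ?_) (fun m hm hm' => ?_)
    · exact Finset.mem_range.2 (Finset.mem_Ioo.1 hm).2
    · have : m = 0 := by
        simp only [Finset.mem_range, Finset.mem_Ioo] at hm hm'
        omega
      simp [this, hw]
  rw [h1]
  simp only [rot]
  push_cast
  rw [Finset.sum_sub_distrib, ← Finset.mul_sum]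
  ring

/-- The rotation number on the way back in a circuit of a framed diagram. -/
theorem RotationBetween.of_reverse (hD : D.IsFramed) {N : ℕ} (hN : 0 < N)
    (hba : D.step^[N] b = a) (hne : ∀ m < N, D.step^[m + 1] b ≠ b) (hw : D.signedWeight a = 0) :
    D.RotationBetween a b
      ((-2 - ∑ m ∈ Finset.range N, D.rot (D.step^[m] b) : ℤ) / 2 : ℚ) := by
  have hp := Function.minimalPeriod_pos_of_mem_periodicPts
    (D.step_injective.mem_periodicPts b)
  set P := Function.minimalPeriod D.step b with hP
  -- If the period were at most `N`, the boundary would return to `b` during the run, contrary to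
  -- `hne`. Hence the way from `a` to the first arrival at `b` has `P - N` steps.
  have hNP : N < P := by
    by_contra! h
    obtain ⟨m, hm⟩ : ∃ m, P = m + 1 := ⟨P - 1, by omega⟩
    refine hne m (by omega) ?_
    rw [← hm]
    exact Function.isPeriodicPt_minimalPeriod _ _
  have hit : ∀ m, D.step^[m] a = D.step^[N + m] b := by
    intro m
    rw [add_comm, Function.iterate_add_apply, hba]
  have hsum := (coboundary_eq_eulerCochain_iff D b).1 (hD.2 b)
  rw [← hP, ← Nat.add_sub_of_le hNP.le, Finset.sum_range_add] at hsum
  have h1 := RotationBetween.of_sum (D := D) (a := a) (b := b) (n := P - N) (by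
    rw [hit, Nat.add_sub_of_le hNP.le]
    exact Function.isPeriodicPt_minimalPeriod _ _) (by
    intro m hm h
    rw [hit] at h
    have h2 : Function.IsPeriodicPt D.step (N + m) b := h
    have := h2.minimalPeriod_le (by omega)
    omega) hw
  simp only [hit] at h1
  convert h1 using 4
  linarith

end Diagram

namespace Tangle

variable {n : ℕ}

/-- The position reached after some steps inside a local picture. -/
def run (T : Tangle ℤ n) : ℕ → T.Pos → Option T.Pos
  | 0, a => some a
  | N + 1, a => (T.run N a).bind fun b => (T.lstep b).elim some fun _ => none

/-- Twice the rotation number of some steps inside a local picture. -/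
def runRot (T : Tangle ℤ n) : ℕ → T.Pos → ℤ
  | 0, _ => 0
  | N + 1, a => T.runRot N a + (T.run N a).elim 0 T.lrot

theorem iterate_of_run (C T : Tangle ℤ n) {N : ℕ} {a b : T.Pos} (h : T.run N a = some b) :
    (C.glue T).step^[N] (C.posT T a) = C.posT T b := by
  induction N generalizing b with
  | zero => rw [← Option.some.inj h]; rfl
  | succ N ih =>
    obtain ⟨c, hc, hb⟩ := Option.bind_eq_some_iff.1 h
    rw [Function.iterate_succ_apply', ih hc, step_posT]
    rcases hl : T.lstep c with d | e
    · rw [hl] at hb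
      rw [← Option.some.inj hb]
      rfl
    · rw [hl] at hb
      simp at hb

theorem run_isSome {T : Tangle ℤ n} {N : ℕ} {a b : T.Pos} (h : T.run N a = some b) {m : ℕ}
    (hm : m ≤ N) : ∃ c, T.run m a = some c := by
  induction N generalizing b with
  | zero => exact ⟨b, by rw [Nat.le_zero.1 hm]; exact h⟩
  | succ N ih =>
    rcases hm.lt_or_eq with hm | rfl
    · obtain ⟨c, hc, hb⟩ := Option.bind_eq_some_iff.1 h
      exact ih hc (by omega)
    · exact ⟨b, h⟩

theorem sum_of_run (C T : Tangle ℤ n) {N : ℕ} {a b : T.Pos} (h : T.run N a = some b) :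
    ∑ m ∈ Finset.range N, (C.glue T).rot ((C.glue T).step^[m] (C.posT T a)) = T.runRot N a := by
  induction N generalizing b with
  | zero => rfl
  | succ N ih =>
    obtain ⟨c, hc, hb⟩ := Option.bind_eq_some_iff.1 h
    rw [Finset.sum_range_succ, ih hc, iterate_of_run C T hc, rot_posT, runRot, hc]
    rfl

theorem posT_injective (C T : Tangle ℤ n) : Function.Injective (C.posT T) := fun _ _ h =>
  Sum.inr.inj ((C.posEquiv T).injective (a₁ := Sum.inr _) (a₂ := Sum.inr _) h)

/-- The rotation number between two positions of a framed diagram, if there is a path inside a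
local picture from the first to the second (`forward`) or conversely. -/
def rotation (T : Tangle ℤ n) (N : ℕ) (forward : Bool) (a b : T.Pos) : ℚ :=
  if forward then (T.runRot N a : ℚ) / 2 else ((-2 - T.runRot N b : ℤ) : ℚ) / 2

/-- There is a path of length `N` in the local picture from `a` to `b`, or conversely. -/
def IsRun (T : Tangle ℤ n) (N : ℕ) (forward : Bool) (a b : T.Pos) : Prop :=
  0 < N ∧ T.weight a.1 = 0 ∧ if forward then T.run N a = some b ∧ ∀ m < N, T.run m a ≠ some b
    else T.run N b = some a ∧ ∀ m < N, T.run (m + 1) b ≠ some b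

/-- A forward path gives the rotation number directly. For a backward path the complementary arc is
used, and it is only here that framedness enters, through the total `-2` of `rot` on the circuit. -/
theorem IsRun.rotationBetween {C T : Tangle ℤ n} {N : ℕ} {forward : Bool} {a b : T.Pos}
    (h : T.IsRun N forward a b) (hT : (C.glue T).IsFramed) :
    (C.glue T).RotationBetween (C.posT T a) (C.posT T b) (T.rotation N forward a b) := by
  obtain ⟨hN, hw, h⟩ := h
  have hw' : (C.glue T).signedWeight (C.posT T a) = 0 := by
    rw [signedWeight_posT, hw]
    simp
  cases forward
  · simp only [Bool.false_eq_true, if_false] at h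
    rw [rotation, if_neg (by simp), ← sum_of_run C T h.1]
    refine Diagram.RotationBetween.of_reverse hT hN (iterate_of_run C T h.1) ?_ hw'
    intro m hm
    obtain ⟨c, hc⟩ := run_isSome h.1 (m := m + 1) (by omega)
    rw [iterate_of_run C T hc]
    exact fun h1 => h.2 m hm (by rw [hc, posT_injective C T h1])
  · simp only [if_true] at h
    rw [rotation, if_pos rfl, ← sum_of_run C T h.1]
    refine Diagram.RotationBetween.of_sum (iterate_of_run C T h.1) ?_ hw'
    intro m hm
    obtain ⟨c, hc⟩ := run_isSome h.1 (m := m) (by omega)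
    rw [iterate_of_run C T hc]
    exact fun h1 => h.2 m hm (by rw [hc, posT_injective C T h1])

end Tangle

/-! ### Sequences of moves -/

/-- The framed integral normal o-graph presented by a diagram. -/
def Diagram.framed (D : Diagram ℤ) (h : D.IsFramed) : FramedIntegralNormalOGraph :=
  ⟨NormalOGraph.mk D, D, h, rfl⟩

theorem FramedIntegralNormalOGraph.isFramed {G : FramedIntegralNormalOGraph} {D : Diagram ℤ}
    (h : G.1 = NormalOGraph.mk D) : D.IsFramed := by
  obtain ⟨D', hD', h'⟩ := G.2
  exact (NormalOGraph.isFramed_iff_of_mk_eq (h'.trans h)).1 hD'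

theorem FramedIntegralNormalOGraph.eq_framed {G : FramedIntegralNormalOGraph} {D : Diagram ℤ}
    (h : G.1 = NormalOGraph.mk D) : G = D.framed (isFramed h) := Subtype.ext h

theorem Derives.append {w w' : List (Generator × Bool)} {Γ Γ' Γ'' : FramedNormalOGraph}
    (h : Derives w Γ Γ') (h' : Derives w' Γ' Γ'') : Derives (w ++ w') Γ Γ'' := by
  induction w generalizing Γ with
  | nil => exact (show Γ = Γ' from h) ▸ h'
  | cons x w ih =>
    obtain ⟨g, b⟩ := x
    cases b
    · obtain ⟨Γ₁, h1, h2⟩ := h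
      exact ⟨Γ₁, h1, ih h2⟩
    · obtain ⟨Γ₁, h1, h2⟩ := h
      exact ⟨Γ₁, h1, ih h2⟩

theorem Derives.exists_inverse (w : List (Generator × Bool)) :
    ∃ w', ∀ Γ Γ', Derives w Γ Γ' → Derives w' Γ' Γ := by
  induction w with
  | nil => exact ⟨[], fun Γ Γ' h => (show Γ = Γ' from h).symm⟩
  | cons x w ih =>
    obtain ⟨g, b⟩ := x
    obtain ⟨w', hw'⟩ := ih
    refine ⟨w' ++ [(g, !b)], fun Γ Γ' h => ?_⟩
    cases b
    · obtain ⟨Γ₁, h1, h2⟩ := h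
      exact (hw' _ _ h2).append ⟨Γ, h1, rfl⟩
    · obtain ⟨Γ₁, h1, h2⟩ := h
      exact (hw' _ _ h2).append ⟨Γ, h1, rfl⟩

namespace Tangle

variable {n m : ℕ}

/-- Replacing `T` by `T'` in a framed diagram is a composition of generating moves, if the result is
framed. -/
def Reaches (T T' : Tangle ℤ n) : Prop :=
  ∃ w, ∀ (C : Tangle ℤ n) (h : (C.glue T).IsFramed) (h' : (C.glue T').IsFramed),
    Derives w ((C.glue T).framed h).proj ((C.glue T').framed h').proj

/-- Replacing `T'` by `T` preserves framed diagrams, and its inverse is a composition of generating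
moves. -/
def Links (T T' : Tangle ℤ n) : Prop :=
  (∀ C : Tangle ℤ n, (C.glue T').IsFramed → (C.glue T).IsFramed) ∧ T.Reaches T'

variable {T T' T'' : Tangle ℤ n}

/-- The middle diagram must be framed before either word can be applied. This is deduced from the
last diagram through the first part of `Links`, never from the initial one. -/
theorem Reaches.trans (h : T.Reaches T') (h' : T'.Links T'') : T.Reaches T'' := by
  obtain ⟨w, hw⟩ := h
  obtain ⟨hf, w', hw'⟩ := h'
  exact ⟨w ++ w', fun C h h' => (hw C h (hf C h')).append (hw' C (hf C h') h')⟩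

theorem Reaches.congr_left (h : T'.Reaches T'')
    (hT : ∀ C : Tangle ℤ n, NormalOGraph.mk (C.glue T) = NormalOGraph.mk (C.glue T')) :
    T.Reaches T'' := by
  obtain ⟨w, hw⟩ := h
  refine ⟨w, fun C hC hC' => ?_⟩
  rw [show (C.glue T).framed hC = (C.glue T').framed
    ((NormalOGraph.isFramed_iff_of_mk_eq (hT C)).1 hC) from Subtype.ext (hT C)]
  exact hw C _ hC'

theorem Links.trans (h : T.Links T') (h' : T'.Links T'') : T.Links T'' :=
  ⟨fun C hC => h.1 C (h'.1 C hC), h.2.trans h'⟩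

theorem Reaches.symm (h : T.Reaches T') : T'.Reaches T := by
  obtain ⟨w, hw⟩ := h
  obtain ⟨w', hw'⟩ := Derives.exists_inverse w
  exact ⟨w', fun C h h' => hw' _ _ (hw C h' h)⟩

theorem Links.of_mk_eq
    (h : ∀ C : Tangle ℤ n, NormalOGraph.mk (C.glue T) = NormalOGraph.mk (C.glue T')) : T.Links T' :=
  ⟨fun C => (NormalOGraph.isFramed_iff_of_mk_eq (h C)).2, [], fun C _ _ =>
    congrArg FramedIntegralNormalOGraph.proj (Subtype.ext (h C))⟩

/-- The context is moved into the outside, over which `Links` quantifies. -/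
theorem Links.comp {L L' : Tangle ℤ m} (h : L.Links L') (K : Context n m) :
    (K.comp L).Links (K.comp L') := by
  obtain ⟨hf, w, hw⟩ := h
  have key : ∀ (C : Tangle ℤ n) (L : Tangle ℤ m), (C.glue (K.comp L)).IsFramed ↔
      ((Context.ext C K).glue L).IsFramed := fun C L =>
    (NormalOGraph.isFramed_iff_of_mk_eq (Context.mk_ext_glue C K L)).symm
  refine ⟨fun C hC => (key C L).2 (hf _ ((key C L').1 hC)), w, fun C h h' => ?_⟩
  have := hw (Context.ext C K) ((key C L).1 h) ((key C L').1 h')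
  rwa [show ((Context.ext C K).glue L).framed ((key C L).1 h) = (C.glue (K.comp L)).framed h from
      Subtype.ext (Context.mk_ext_glue C K L),
    show ((Context.ext C K).glue L').framed ((key C L').1 h') = (C.glue (K.comp L')).framed h' from
      Subtype.ext (Context.mk_ext_glue C K L')] at this

/-- A path inside the picture fixes the rotation number, hence `a`, for all outsides at once; the
non-local slide becomes a local replacement with constant weights. -/
theorem Reaches.comp_slide (K : Context n 2) {N : ℕ} {forward : Bool} (t : SlideType) (a : ℤ)
    (h : (K.comp (slideLeft 0 0)).IsRun N forward (K.start (slideLeft 0 0) 0, t.leftLine)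
      (K.start (slideLeft 0 0) 1, t.rightLine))
    (ha : t.IsShift ((K.comp (slideLeft 0 0)).rotation N forward
      (K.start (slideLeft 0 0) 0, t.leftLine) (K.start (slideLeft 0 0) 1, t.rightLine)) a) :
    (K.comp (slideLeft 0 0)).Reaches (K.comp (slideRight t 0 0 a)) :=
  ⟨[(.slide t, true)], fun C hC _ => ⟨_, ⟨_, _, ⟨Context.ext C K, 0, 0, a, _,
    Context.rotationBetween_ext C K _ (h.rotationBetween hC), ha,
    (Context.mk_ext_glue C K _).symm, (Context.mk_ext_glue C K _).symm⟩, rfl, rfl⟩, rfl⟩⟩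

/-- The H-move is used backwards, since framedness is known to pass from the unshifted picture to
the shifted one. -/
theorem links_hPicture (ε : Sign) : (hPicture ε [1, -1]).Links (hPicture ε []) :=
  ⟨fun C => hPicture_isFramed_glue ε C, [(.H, false)], fun C _ _ =>
    ⟨_, ⟨_, _, ⟨ε, C, rfl, rfl⟩, rfl, rfl⟩, rfl⟩⟩

end Tangle

/-- The local picture before an MP move. -/
abbrev MPType.left (t : MPType) : Tangle ℤ 3 :=
  Tangle.ofWords t.data.leftSign t.data.leftWord fun _ => []

/-- The local picture after an MP move. -/
abbrev MPType.right (t : MPType) : Tangle ℤ 3 :=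
  Tangle.ofWords t.data.rightSign t.data.rightWord t.data.rightWeight

theorem MPType.links_of_reaches {t : MPType} (h : t.left.Reaches t.right) : t.right.Links t.left :=
  ⟨t.isFramed_glue, h.symm⟩

/-- A framed move comes with integral representatives on both sides, which are framed by definition;
the integral replacement is then projected. -/
theorem MPType.derives_of_reaches {t : MPType} (h : t.left.Reaches t.right) :
    ∃ w : List (Generator × Bool), ∀ Γ Γ' : FramedNormalOGraph,
      FramedMP t Γ Γ' → Derives w Γ Γ' := by
  obtain ⟨w, hw⟩ := h
  refine ⟨w, ?_⟩
  rintro _ _ ⟨G, G', ⟨C, h, h'⟩, rfl, rfl⟩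
  rw [FramedIntegralNormalOGraph.eq_framed h, FramedIntegralNormalOGraph.eq_framed h']
  exact hw C _ _


/-! ### Decision procedures for matching pictures and computing shifts -/

instance Walk.decidable {P L : Type*} [DecidableEq P] (next : P → P) (incl : L → P) :
    ∀ (p : P) (l : List L) (q : P), Decidable (Walk next incl p l q)
  | p, [], q => inferInstanceAs (Decidable (next p = q))
  | p, x :: l, q =>
    have := Walk.decidable next incl (incl x) l q
    inferInstanceAs (Decidable (next p = incl x ∧ Walk next incl (incl x) l q))

/-- Membership in a list is decidable, with the decidable equality at hand. -/
def decidableMemList {α : Type*} [DecidableEq α] (x : α) (l : List α) : Decidable (x ∈ l) :=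
  inferInstance

namespace Tangle

variable {n : ℕ}

/-- The points passed on the way from a port to a distinguished point. -/
def trace {A : Type} (T : Tangle A n) :
    ℕ → Port T.X (T.M ⊕ Fin n) → List (T.X × Strand ⊕ T.M)
  | 0, _ => []
  | N + 1, p => match T.next p with
    | Sum.inl x => Sum.inl x :: T.trace N (Sum.inl x)
    | Sum.inr (Sum.inl m) => Sum.inr m :: T.trace N (Sum.inr (Sum.inl m))
    | Sum.inr (Sum.inr _) => []

/-- The strands of two local pictures pass through the same crossings, renamed by `f`, with the same
weights. -/
def Matches (N : ℕ) (T T' : Tangle ℤ n) (f : T.X → T'.X) : Prop :=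
  f.Bijective ∧ (∀ x, T'.sign (f x) = T.sign x) ∧ (T.Reads fun k => T.trace N (T.hole k)) ∧
    (T'.Reads fun k => T'.trace N (T'.hole k)) ∧
    ∀ k, (T.strandData k (T.trace N (T.hole k))).map f = T'.strandData k (T'.trace N (T'.hole k))

/-- The strand data read off from `T'` serve as the common presentation; the bound `N` is harmless,
since `Reads` certifies that the traces are complete. -/
theorem Matches.mk_glue_eq {N : ℕ} {T T' : Tangle ℤ n} {f : T.X → T'.X} (h : Matches N T T' f)
    (C : Tangle ℤ n) : NormalOGraph.mk (C.glue T) = NormalOGraph.mk (C.glue T') := by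
  obtain ⟨hf, hs, h1, h2, h3⟩ := h
  have hT : T.Presents T'.sign fun k => T'.strandData k (T'.trace N (T'.hole k)) :=
    ⟨Equiv.ofBijective f hf, hs, _, h1, h3⟩
  have hT' : T'.Presents T'.sign fun k => T'.strandData k (T'.trace N (T'.hole k)) := by
    refine ⟨Equiv.refl _, fun _ => rfl, _, h2, fun k => ?_⟩
    simp [StrandData.map]
  exact hT.mk_glue_eq hT' C

theorem Matches.links {N : ℕ} {T T' : Tangle ℤ n} {f : T.X → T'.X} (h : Matches N T T' f) :
    T.Links T' :=
  Links.of_mk_eq h.mk_glue_eq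

instance {A : Type} (T : Tangle A n) [DecidableEq T.X] [DecidableEq T.M] [Fintype T.X] [Fintype T.M]
    (W : Fin n → List (T.X × Strand ⊕ T.M)) : Decidable (T.Reads W) :=
  have (x : T.X × Strand ⊕ T.M) (k : Fin n) : Decidable (x ∈ W k) := decidableMemList x (W k)
  decidable_of_iff ((∀ k, Walk T.next incl (T.hole k) (W k) (T.hole k)) ∧ ∀ x, ∃ k, x ∈ W k)
    ⟨fun h => ⟨h.1, h.2⟩, fun h => ⟨h.1, h.2⟩⟩

set_option synthInstance.maxSize 1000 in
instance (N : ℕ) (T T' : Tangle ℤ n) (f : T.X → T'.X) [DecidableEq T.X] [DecidableEq T.M]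
    [Fintype T.X] [Fintype T.M] [DecidableEq T'.X] [DecidableEq T'.M] [Fintype T'.X] [Fintype T'.M] :
    Decidable (Matches N T T' f) := by
  unfold Matches
  infer_instance

set_option synthInstance.maxSize 1000 in
instance (T : Tangle ℤ n) [DecidableEq T.X] [DecidableEq T.M] (N : ℕ) (forward : Bool)
    (a b : T.Pos) : Decidable (T.IsRun N forward a b) := by
  unfold IsRun
  infer_instance

end Tangle

instance (t : SlideType) (p : ℚ) (a : ℤ) : Decidable (t.IsShift p a) := by
  cases t <;> unfold SlideType.IsShift <;> infer_instance

instance (k l : ℤ) : Fintype (slideLeft k l).X := inferInstanceAs (Fintype (Fin 0))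
instance (k l : ℤ) : DecidableEq (slideLeft k l).X := inferInstanceAs (DecidableEq (Fin 0))
instance (k l : ℤ) : Fintype (slideLeft k l).M := inferInstanceAs (Fintype Empty)
instance (k l : ℤ) : DecidableEq (slideLeft k l).M := inferInstanceAs (DecidableEq Empty)
instance (ε : Sign) (w : List ℤ) : Fintype (hPicture ε w).X := inferInstanceAs (Fintype (Fin 1))
instance (ε : Sign) (w : List ℤ) : DecidableEq (hPicture ε w).X :=
  inferInstanceAs (DecidableEq (Fin 1))
instance (ε : Sign) (w : List ℤ) : Fintype (hPicture ε w).M := inferInstanceAs (Fintype Empty)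
instance (ε : Sign) (w : List ℤ) : DecidableEq (hPicture ε w).M :=
  inferInstanceAs (DecidableEq Empty)
instance (t : SlideType) (k l a : ℤ) : Fintype (slideRight t k l a).X := by
  cases t <;> exact inferInstanceAs (Fintype (Fin 2))
instance (t : SlideType) (k l a : ℤ) : DecidableEq (slideRight t k l a).X := by
  cases t <;> exact inferInstanceAs (DecidableEq (Fin 2))
instance (t : SlideType) (k l a : ℤ) : Fintype (slideRight t k l a).M := by
  cases t <;> exact inferInstanceAs (Fintype Empty)
instance (t : SlideType) (k l a : ℤ) : DecidableEq (slideRight t k l a).M := by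
  cases t <;> exact inferInstanceAs (DecidableEq Empty)

namespace Context

variable {n m : ℕ}

instance (K : Context n m) (L : Tangle ℤ m) [Fintype K.X] [Fintype L.X] : Fintype (K.comp L).X :=
  inferInstanceAs (Fintype (K.X ⊕ L.X))
instance (K : Context n m) (L : Tangle ℤ m) [DecidableEq K.X] [DecidableEq L.X] :
    DecidableEq (K.comp L).X :=
  inferInstanceAs (DecidableEq (K.X ⊕ L.X))
instance (K : Context n m) (L : Tangle ℤ m) [Fintype L.M] : Fintype (K.comp L).M :=
  inferInstanceAs (Fintype (Fin m ⊕ (L.M ⊕ Fin m)))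
instance (K : Context n m) (L : Tangle ℤ m) [DecidableEq L.M] : DecidableEq (K.comp L).M :=
  inferInstanceAs (DecidableEq (Fin m ⊕ (L.M ⊕ Fin m)))

/-- The context with `c` crossings of the given signs and `n` strands, the `k`-th of which runs
successively through the crossings and holes listed in `word k`; the successive segments carry the
weights listed in `wt k` (missing entries are `0`). -/
def ofWords {c : ℕ} (sign : Fin c → Sign) (word : Fin n → List (Fin c × Strand ⊕ Fin m))
    (wt : Fin n → List ℤ) : Context n m where
  X := Fin c
  finX := inferInstance
  sign := sign
  next := (List.ofFn fun k : Fin n =>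
    List.formPerm (Sum.inr (Sum.inr k) :: (word k).map (Sum.map id Sum.inl) :
      List (Port (Fin c) (Fin m ⊕ Fin n)))).prod
  weight p := ∑ k, (wt k).getD ((Sum.inr (Sum.inr k) :: (word k).map (Sum.map id Sum.inl) :
      List (Port (Fin c) (Fin m ⊕ Fin n))).idxOf p) 0

end Context

/-- The crossings of the picture after a pure sliding move. -/
def SlideType.crossing (s : SlideType) (k l a : ℤ) : (slideRight s k l a).X → Fin 2 := by
  cases s <;> exact id

/-! ### The scheme: a slide, an inverse MP move, possibly an inverse H-move -/

section

variable (t u : MPType) (s : SlideType) (a : ℤ) (forward : Bool)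
  (word₁ : Fin 3 → List (Fin 2 × Strand ⊕ Fin 2)) (ε : Sign)
  (word₂ : Fin 3 → List (Fin 1 × Strand ⊕ Fin 3)) (wt₂ : Fin 3 → List ℤ)
  (f : Fin 2 ⊕ Fin 2 → Fin 1 ⊕ Fin 3)

/-- The left picture of an MP move, with two holes on segments. -/
def slideContext : Context 3 2 := Context.ofWords t.data.leftSign word₁ fun _ => []

/-- A picture with one crossing and with holes for an MP move. -/
def moveContext : Context 3 3 := Context.ofWords (fun _ : Fin 1 => ε) word₂ wt₂

instance : Fintype (slideContext t word₁).X := inferInstanceAs (Fintype (Fin 2))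
instance : DecidableEq (slideContext t word₁).X := inferInstanceAs (DecidableEq (Fin 2))
instance : Fintype (moveContext ε word₂ wt₂).X := inferInstanceAs (Fintype (Fin 1))
instance : DecidableEq (moveContext ε word₂ wt₂).X := inferInstanceAs (DecidableEq (Fin 1))

/-- The crossings of the left picture of an MP move, as crossings of the picture with two additional
segments. -/
def leftCrossing : t.left.X → ((slideContext t word₁).comp (slideLeft 0 0)).X :=
  (Sum.inl : Fin 2 → Fin 2 ⊕ Fin 0)

/-- A correspondence of the crossings of the pictures after a pure sliding move and before an
inverse MP move. -/
def middleCrossing : ((slideContext t word₁).comp (slideRight s 0 0 a)).X →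
    ((moveContext ε word₂ wt₂).comp u.right).X :=
  fun x => f (Sum.map (id : Fin 2 → Fin 2) (s.crossing 0 0 a) x)

/-- A pure sliding move transforms the left picture of the MP move `t` into a picture containing the
right picture of the MP move `u`. -/
def SlideCheck : Prop :=
  Tangle.Matches 8 t.left ((slideContext t word₁).comp (slideLeft 0 0)) (leftCrossing t word₁) ∧
  Tangle.Matches 12 ((slideContext t word₁).comp (slideRight s 0 0 a))
    ((moveContext ε word₂ wt₂).comp u.right) (middleCrossing t u s a word₁ ε word₂ wt₂ f) ∧
  ((slideContext t word₁).comp (slideLeft 0 0)).IsRun 4 forward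
    ((slideContext t word₁).start (slideLeft 0 0) 0, s.leftLine)
    ((slideContext t word₁).start (slideLeft 0 0) 1, s.rightLine) ∧
  s.IsShift (((slideContext t word₁).comp (slideLeft 0 0)).rotation 4 forward
    ((slideContext t word₁).start (slideLeft 0 0) 0, s.leftLine)
    ((slideContext t word₁).start (slideLeft 0 0) 1, s.rightLine)) a

set_option synthInstance.maxSize 1000 in
instance : Decidable (SlideCheck t u s a forward word₁ ε word₂ wt₂ f) := by
  unfold SlideCheck
  infer_instance

/-- A correspondence of crossings of the pictures after an inverse MP move and after another MP
move. -/
def rightCrossing (g : Fin 1 ⊕ Fin 2 → Fin 3) :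
    ((moveContext ε word₂ wt₂).comp u.left).X → t.right.X := g

/-- A picture with two crossings, and a hole for a third one. -/
def crossingContext (sign₃ : Fin 2 → Sign) (word₃ : Fin 3 → List (Fin 2 × Strand ⊕ Fin 2))
    (wt₃ : Fin 3 → List ℤ) : Context 3 2 :=
  Context.ofWords sign₃ word₃ wt₃

instance (sign₃ : Fin 2 → Sign) (word₃) (wt₃) : Fintype (crossingContext sign₃ word₃ wt₃).X :=
  inferInstanceAs (Fintype (Fin 2))
instance (sign₃ : Fin 2 → Sign) (word₃) (wt₃) : DecidableEq (crossingContext sign₃ word₃ wt₃).X :=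
  inferInstanceAs (DecidableEq (Fin 2))

/-- A correspondence of crossings of the pictures after an inverse MP move and after an H-move. -/
def separateCrossing (sign₃ : Fin 2 → Sign) (word₃ : Fin 3 → List (Fin 2 × Strand ⊕ Fin 2))
    (wt₃ : Fin 3 → List ℤ) (ε' : Sign) (g : Fin 1 ⊕ Fin 2 → Fin 2 ⊕ Fin 1) :
    ((moveContext ε word₂ wt₂).comp u.left).X →
      ((crossingContext sign₃ word₃ wt₃).comp (hPicture ε' [1, -1])).X := g

/-- A correspondence of crossings of the pictures before an H-move and after an MP move. -/
def joinCrossing (sign₃ : Fin 2 → Sign) (word₃ : Fin 3 → List (Fin 2 × Strand ⊕ Fin 2))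
    (wt₃ : Fin 3 → List ℤ) (ε' : Sign) (g : Fin 2 ⊕ Fin 1 → Fin 3) :
    ((crossingContext sign₃ word₃ wt₃).comp (hPicture ε' [])).X → t.right.X := g

end

namespace MPType

variable {t u : MPType} {s : SlideType} {a : ℤ} {forward : Bool}
  {word₁ : Fin 3 → List (Fin 2 × Strand ⊕ Fin 2)} {ε : Sign}
  {word₂ : Fin 3 → List (Fin 1 × Strand ⊕ Fin 3)} {wt₂ : Fin 3 → List ℤ}
  {f : Fin 2 ⊕ Fin 2 → Fin 1 ⊕ Fin 3}

/-- The slide turns the left picture of `t` into one containing the right picture of `u`, and `u` is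
then undone. The picture after the slide is framed because `u`, read forwards, preserves framedness.
-/
theorem reaches_moveContext (hu : u.left.Reaches u.right)
    (h : SlideCheck t u s a forward word₁ ε word₂ wt₂ f) :
    t.left.Reaches ((moveContext ε word₂ wt₂).comp u.left) := by
  obtain ⟨h1, h2, h3, h4⟩ := h
  have h5 := Tangle.Reaches.comp_slide (slideContext t word₁) s a h3 h4
  exact ((h5.congr_left h1.mk_glue_eq).trans h2.links).trans ((links_of_reaches hu).comp _)

theorem reaches_of_slide (hu : u.left.Reaches u.right)
    (h : SlideCheck t u s a forward word₁ ε word₂ wt₂ f) {g : Fin 1 ⊕ Fin 2 → Fin 3}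
    (hg : Tangle.Matches 12 ((moveContext ε word₂ wt₂).comp u.left) t.right
      (rightCrossing t u ε word₂ wt₂ g)) : t.left.Reaches t.right :=
  (reaches_moveContext hu h).trans hg.links

/-- Here the slide puts its weights on the other strand of the new crossing than `t` requires. The
two choices differ by an H-move at this crossing, which `hg` isolates in a hole. -/
theorem reaches_of_slide_of_H (hu : u.left.Reaches u.right)
    (h : SlideCheck t u s a forward word₁ ε word₂ wt₂ f)
    {sign₃ : Fin 2 → Sign} {word₃ : Fin 3 → List (Fin 2 × Strand ⊕ Fin 2)} {wt₃ : Fin 3 → List ℤ}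
    {ε' : Sign} {g : Fin 1 ⊕ Fin 2 → Fin 2 ⊕ Fin 1} {g' : Fin 2 ⊕ Fin 1 → Fin 3}
    (hg : Tangle.Matches 12 ((moveContext ε word₂ wt₂).comp u.left)
      ((crossingContext sign₃ word₃ wt₃).comp (hPicture ε' [1, -1]))
      (separateCrossing u ε word₂ wt₂ sign₃ word₃ wt₃ ε' g))
    (hg' : Tangle.Matches 12 ((crossingContext sign₃ word₃ wt₃).comp (hPicture ε' [])) t.right
      (joinCrossing t sign₃ word₃ wt₃ ε' g')) : t.left.Reaches t.right :=
  (reaches_moveContext hu h).trans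
    (hg.links.trans (((Tangle.links_hPicture ε').comp _).trans hg'.links))

end MPType

/-! ### The primary move is `D2` -/

/-- The local picture before the primary MP move. -/
abbrev primaryLeft : Tangle ℤ 3 :=
  Tangle.ofWords (n := 3) (c := 2) (fun _ => Sign.pos)
    ![[(0, .upper)], [(1, .upper), (0, .lower)], [(1, .lower)]] fun _ => []

/-- The local picture after the primary MP move. -/
abbrev primaryRight : Tangle ℤ 3 :=
  Tangle.ofWords (n := 3) (c := 3) (fun _ => Sign.pos)
    ![[(0, .upper), (1, .upper)], [(0, .lower), (2, .upper)], [(1, .lower), (2, .lower)]]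
    fun _ => []

/-- The exchange of the first and the third of three strands. -/
def reverseContext : Context 3 3 :=
  Context.ofWords (Fin.elim0 : Fin 0 → Sign) ![[.inr 2], [.inr 1], [.inr 0]] fun _ => []

instance : Fintype reverseContext.X := inferInstanceAs (Fintype (Fin 0))
instance : DecidableEq reverseContext.X := inferInstanceAs (DecidableEq (Fin 0))

/-- The correspondence of crossings for the left pictures of `D2` and the primary move. -/
def reverseLeft : (reverseContext.comp primaryLeft).X → MPType.D2.left.X :=
  (Sum.elim Fin.elim0 id : Fin 0 ⊕ Fin 2 → Fin 2)

/-- The correspondence of crossings for the right pictures of `D2` and the primary move. -/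
def reverseRight : (reverseContext.comp primaryRight).X → MPType.D2.right.X :=
  (Sum.elim Fin.elim0 id : Fin 0 ⊕ Fin 3 → Fin 3)

/-- The two moves differ only in the numbering of the strands, so a context without crossings that
permutes them is enough. -/
theorem MPType.reaches_D2 : MPType.D2.left.Reaches MPType.D2.right := by
  have hl : Tangle.Matches 12 (reverseContext.comp primaryLeft) MPType.D2.left reverseLeft := by
    decide +kernel
  have hr : Tangle.Matches 12 (reverseContext.comp primaryRight) MPType.D2.right reverseRight := by
    decide +kernel
  exact ⟨[(.primaryMP, true)], fun C hC hC' => ⟨_, ⟨_, _, ⟨Context.ext C reverseContext,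
    (hl.mk_glue_eq C).symm.trans (Context.mk_ext_glue C _ primaryLeft).symm,
    (hr.mk_glue_eq C).symm.trans (Context.mk_ext_glue C _ primaryRight).symm⟩, rfl, rfl⟩, rfl⟩⟩


/-! ### The other fifteen moves, in order of dependence -/

/-- The slide makes strand 1, after its passage under crossing 0, pass over strand 0, after its
passage under crossing 1, twice. The first new crossing completes the right picture of `D2`, and the
second is the negative crossing of `A1`. The path inside the picture meets one dot, so `p = -1/2`
and `a = 0`. -/
theorem MPType.reaches_A1 : MPType.A1.left.Reaches MPType.A1.right :=
  MPType.reaches_of_slide MPType.reaches_D2 (t := .A1) (s := .I) (a := 0)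
    (forward := true) (ε := .neg)
    (word₁ := ![[.inl (1, .lower), .inr 1], [.inl (0, .lower), .inr 0],
      [.inl (0, .upper), .inl (1, .upper)]])
    (word₂ := ![[.inr 0, .inl (0, .lower)], [.inr 1, .inl (0, .upper)], [.inr 2]])
    (wt₂ := fun _ => [])
    (f := Sum.elim ![.inr 0, .inr 1] ![.inr 2, .inl 0]) (by decide +kernel)
    (g := Sum.elim ![2] ![0, 1]) (by decide +kernel)

/-- The path runs from the right strand to the left one with one dot. The complementary arc again
has `p = -1/2`, so for slides I and II the shift is `0` in either direction. -/
theorem MPType.reaches_B3 : MPType.B3.left.Reaches MPType.B3.right :=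
  MPType.reaches_of_slide MPType.reaches_D2 (t := .B3) (s := .II) (a := 0)
    (forward := false) (ε := .neg)
    (word₁ := ![[.inl (0, .lower), .inl (1, .lower)], [.inr 0, .inl (1, .upper)],
      [.inr 1, .inl (0, .upper)]])
    (word₂ := ![[.inr 0], [.inl (0, .lower), .inr 1], [.inl (0, .upper), .inr 2]])
    (wt₂ := fun _ => [])
    (f := Sum.elim ![.inr 1, .inr 2] ![.inl 0, .inr 0]) (by decide +kernel)
    (g := Sum.elim ![0] ![1, 2]) (by decide +kernel)

theorem MPType.reaches_C1 : MPType.C1.left.Reaches MPType.C1.right :=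
  MPType.reaches_of_slide MPType.reaches_B3 (t := .C1) (s := .I) (a := 0)
    (forward := true) (ε := .neg)
    (word₁ := ![[.inl (1, .lower)], [.inl (0, .lower), .inl (1, .upper), .inr 1],
      [.inl (0, .upper), .inr 0]])
    (word₂ := ![[.inr 0], [.inr 1, .inl (0, .lower)], [.inr 2, .inl (0, .upper)]])
    (wt₂ := fun _ => [])
    (f := Sum.elim ![.inr 0, .inr 2] ![.inr 1, .inl 0]) (by decide +kernel)
    (g := Sum.elim ![0] ![1, 2]) (by decide +kernel)

/-- For slides III and IV the path inside the picture meets two dots. Read backwards, as here, it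
gives `p = 0` and `a = -1`; read forwards it gives `p = -1` and `a = 0`. -/
theorem MPType.reaches_C3 : MPType.C3.left.Reaches MPType.C3.right :=
  MPType.reaches_of_slide MPType.reaches_D2 (t := .C3) (s := .III) (a := (-1))
    (forward := false) (ε := .neg)
    (word₁ := ![[.inr 1, .inl (1, .lower)], [.inl (0, .lower), .inl (1, .upper)],
      [.inl (0, .upper), .inr 0]])
    (word₂ := ![[.inl (0, .lower), .inr 0], [.inr 1], [.inr 2, .inl (0, .upper)]])
    -- The weights `a, 1, -1 - a` of slide III for `a = -1`; they are already those of `C3`.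
    (wt₂ := ![[-1, 1, 0], [], []])
    (f := Sum.elim ![.inr 0, .inr 2] ![.inl 0, .inr 1]) (by decide +kernel)
    (g := Sum.elim ![1] ![0, 2]) (by decide +kernel)

theorem MPType.reaches_C4 : MPType.C4.left.Reaches MPType.C4.right :=
  MPType.reaches_of_slide MPType.reaches_A1 (t := .C4) (s := .II) (a := 0)
    (forward := false) (ε := .neg)
    (word₁ := ![[.inr 0, .inl (1, .lower)], [.inr 1, .inl (0, .lower), .inl (1, .upper)],
      [.inl (0, .upper)]])
    (word₂ := ![[.inl (0, .lower), .inr 0], [.inl (0, .upper), .inr 1], [.inr 2]])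
    (wt₂ := fun _ => [])
    (f := Sum.elim ![.inr 0, .inr 2] ![.inl 0, .inr 1]) (by decide +kernel)
    (g := Sum.elim ![2] ![0, 1]) (by decide +kernel)

theorem MPType.reaches_D1 : MPType.D1.left.Reaches MPType.D1.right :=
  MPType.reaches_of_slide MPType.reaches_C4 (t := .D1) (s := .I) (a := 0)
    (forward := true) (ε := .neg)
    (word₁ := ![[.inl (1, .lower), .inr 1], [.inl (1, .upper), .inl (0, .lower)],
      [.inl (0, .upper), .inr 0]])
    (word₂ := ![[.inr 0, .inl (0, .lower)], [.inr 1], [.inr 2, .inl (0, .upper)]])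
    (wt₂ := fun _ => [])
    (f := Sum.elim ![.inr 0, .inr 2] ![.inr 1, .inl 0]) (by decide +kernel)
    (g := Sum.elim ![1] ![0, 2]) (by decide +kernel)

theorem MPType.reaches_D4 : MPType.D4.left.Reaches MPType.D4.right :=
  MPType.reaches_of_slide MPType.reaches_C1 (t := .D4) (s := .II) (a := 0)
    (forward := false) (ε := .neg)
    (word₁ := ![[.inr 0, .inl (1, .lower)], [.inr 1, .inl (0, .upper)],
      [.inl (1, .upper), .inl (0, .lower)]])
    (word₂ := ![[.inl (0, .lower), .inr 0], [.inl (0, .upper), .inr 2], [.inr 1]])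
    (wt₂ := fun _ => [])
    (f := Sum.elim ![.inr 0, .inr 2] ![.inl 0, .inr 1]) (by decide +kernel)
    (g := Sum.elim ![1] ![0, 2]) (by decide +kernel)

theorem MPType.reaches_A2 : MPType.A2.left.Reaches MPType.A2.right :=
  MPType.reaches_of_slide MPType.reaches_D1 (t := .A2) (s := .IV) (a := (-1))
    (forward := false) (ε := .pos)
    (word₁ := ![[.inr 0, .inl (1, .lower)], [.inl (0, .lower), .inr 1],
      [.inl (0, .upper), .inl (1, .upper)]])
    (word₂ := ![[.inl (0, .lower), .inr 0], [.inr 1, .inl (0, .upper)], [.inr 2]])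
    -- The weights `1 + a, -1, -a` of slide IV for `a = -1`, as required by `A2`.
    (wt₂ := ![[], [0, -1, 1], []])
    (f := Sum.elim ![.inr 0, .inr 1] ![.inl 0, .inr 2]) (by decide +kernel)
    (g := Sum.elim ![2] ![0, 1]) (by decide +kernel)

theorem MPType.reaches_A3 : MPType.A3.left.Reaches MPType.A3.right :=
  MPType.reaches_of_slide MPType.reaches_D4 (t := .A3) (s := .I) (a := 0)
    (forward := true) (ε := .neg)
    (word₁ := ![[.inl (1, .lower), .inr 1], [.inl (1, .upper), .inl (0, .upper)],
      [.inl (0, .lower), .inr 0]])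
    (word₂ := ![[.inr 0, .inl (0, .lower)], [.inr 1], [.inr 2, .inl (0, .upper)]])
    (wt₂ := fun _ => [])
    (f := Sum.elim ![.inr 0, .inr 1] ![.inr 2, .inl 0]) (by decide +kernel)
    (g := Sum.elim ![1] ![0, 2]) (by decide +kernel)

theorem MPType.reaches_A4 : MPType.A4.left.Reaches MPType.A4.right :=
  MPType.reaches_of_slide_of_H MPType.reaches_C1 (t := .A4) (s := .IV) (a := 0)
    (forward := true) (ε := .neg)
    (word₁ := ![[.inl (1, .lower), .inr 0], [.inr 1, .inl (0, .lower)],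
      [.inl (1, .upper), .inl (0, .upper)]])
    (word₂ := ![[.inr 0, .inl (0, .lower)], [.inl (0, .upper), .inr 1], [.inr 2]])
    -- The weights of slide IV for `a = 0`. They lie on the over-strand of the new crossing, while
    -- `A4` has weights on the under-strand.
    (wt₂ := ![[], [1, -1, 0], []])
    (f := Sum.elim ![.inr 0, .inr 1] ![.inr 2, .inl 0]) (by decide +kernel)
    (sign₃ := ![.neg, .pos]) (ε' := .neg)
    (word₃ := ![[.inl (1, .lower), .inr 1], [.inr 0, .inl (0, .lower), .inl (1, .upper)],
      [.inl (0, .upper)]])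
    -- The weights required by `A4`. Adding `1, -1` on both strands of the new crossing cancels them
    -- here and creates `1, -1` on the over-strand, which is `wt₂`.
    (wt₃ := ![[0, -1, 1], [], []])
    (g := Sum.elim ![.inr 0] ![.inl 0, .inl 1])
    (g' := Sum.elim ![0, 1] ![2]) (by decide +kernel) (by decide +kernel)

theorem MPType.reaches_B1 : MPType.B1.left.Reaches MPType.B1.right :=
  MPType.reaches_of_slide MPType.reaches_D1 (t := .B1) (s := .II) (a := 0)
    (forward := false) (ε := .neg)
    (word₁ := ![[.inl (1, .lower), .inl (0, .lower)], [.inr 0, .inl (1, .upper)],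
      [.inr 1, .inl (0, .upper)]])
    (word₂ := ![[.inr 0], [.inl (0, .lower), .inr 1], [.inl (0, .upper), .inr 2]])
    (wt₂ := fun _ => [])
    (f := Sum.elim ![.inr 1, .inr 2] ![.inl 0, .inr 0]) (by decide +kernel)
    (g := Sum.elim ![1] ![0, 2]) (by decide +kernel)

theorem MPType.reaches_B2 : MPType.B2.left.Reaches MPType.B2.right :=
  MPType.reaches_of_slide_of_H MPType.reaches_C4 (t := .B2) (s := .IV) (a := 0)
    (forward := true) (ε := .neg)
    (word₁ := ![[.inl (1, .lower), .inl (0, .lower)], [.inl (1, .upper), .inr 0],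
      [.inr 1, .inl (0, .upper)]])
    (word₂ := ![[.inr 0], [.inr 1, .inl (0, .lower)], [.inl (0, .upper), .inr 2]])
    -- Slide IV with `a = 0` again weights the over-strand; the H-move transfers this to the
    -- under-strand, where `B2` has its weights.
    (wt₂ := ![[], [], [1, -1, 0]])
    (f := Sum.elim ![.inr 1, .inr 2] ![.inr 0, .inl 0]) (by decide +kernel)
    (sign₃ := ![.pos, .neg]) (ε' := .neg)
    (word₃ := ![[.inl (1, .lower)], [.inl (0, .lower), .inl (1, .upper), .inr 1],
      [.inr 0, .inl (0, .upper)]])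
    (wt₃ := ![[], [0, 0, -1, 1], []])
    (g := Sum.elim ![.inr 0] ![.inl 0, .inl 1])
    (g' := Sum.elim ![1, 2] ![0]) (by decide +kernel) (by decide +kernel)

theorem MPType.reaches_B4 : MPType.B4.left.Reaches MPType.B4.right :=
  MPType.reaches_of_slide MPType.reaches_D4 (t := .B4) (s := .IV) (a := (-1))
    (forward := false) (ε := .pos)
    (word₁ := ![[.inl (0, .lower), .inl (1, .lower)], [.inl (0, .upper), .inr 1],
      [.inr 0, .inl (1, .upper)]])
    (word₂ := ![[.inr 0], [.inr 1, .inl (0, .upper)], [.inl (0, .lower), .inr 2]])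
    (wt₂ := ![[], [0, -1, 1], []])
    (f := Sum.elim ![.inr 1, .inr 2] ![.inl 0, .inr 0]) (by decide +kernel)
    (g := Sum.elim ![0] ![1, 2]) (by decide +kernel)

theorem MPType.reaches_C2 : MPType.C2.left.Reaches MPType.C2.right :=
  MPType.reaches_of_slide MPType.reaches_A3 (t := .C2) (s := .II) (a := 0)
    (forward := false) (ε := .neg)
    (word₁ := ![[.inr 0, .inl (1, .lower)], [.inr 1, .inl (0, .lower), .inl (1, .upper)],
      [.inl (0, .upper)]])
    (word₂ := ![[.inl (0, .lower), .inr 0], [.inl (0, .upper), .inr 2], [.inr 1]])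
    (wt₂ := fun _ => [])
    (f := Sum.elim ![.inr 0, .inr 1] ![.inl 0, .inr 2]) (by decide +kernel)
    (g := Sum.elim ![2] ![0, 1]) (by decide +kernel)

theorem MPType.reaches_D3 : MPType.D3.left.Reaches MPType.D3.right :=
  MPType.reaches_of_slide_of_H MPType.reaches_C2 (t := .D3) (s := .III) (a := 0)
    (forward := true) (ε := .pos)
    (word₁ := ![[.inl (1, .lower), .inr 1], [.inl (1, .upper), .inl (0, .lower)],
      [.inr 0, .inl (0, .upper)]])
    (word₂ := ![[.inr 0, .inl (0, .lower)], [.inr 1], [.inl (0, .upper), .inr 2]])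
    -- The weights `a, 1, -1 - a` of slide III for `a = 0`, on the under-strand of the new crossing;
    -- the H-move replaces them by `-1, 1` on the over-strand.
    (wt₂ := ![[0, 1, -1], [], []])
    (f := Sum.elim ![.inr 0, .inr 2] ![.inr 1, .inl 0]) (by decide +kernel)
    (sign₃ := ![.neg, .neg]) (ε' := .pos)
    (word₃ := ![[.inl (1, .lower), .inr 1], [.inl (0, .lower), .inl (1, .upper)],
      [.inr 0, .inl (0, .upper)]])
    (wt₃ := ![[], [], [-1, 1, 0]])
    (g := Sum.elim ![.inr 0] ![.inl 0, .inl 1])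
    (g' := Sum.elim ![0, 2] ![1]) (by decide +kernel) (by decide +kernel)

theorem MPType.reaches (t : MPType) : t.left.Reaches t.right := by
  cases t
  · exact reaches_A1
  · exact reaches_A2
  · exact reaches_A3
  · exact reaches_A4
  · exact reaches_B1
  · exact reaches_B2
  · exact reaches_B3
  · exact reaches_B4
  · exact reaches_C1
  · exact reaches_C2
  · exact reaches_C3
  · exact reaches_C4
  · exact reaches_D1
  · exact reaches_D2
  · exact reaches_D3
  · exact reaches_D4

end OGraph

/-- Each of the 16 framed MP moves is derived as a sequence (depending only on the type of the
move) of the primary framed MP move, the framed pure sliding moves, the framed H-move, and their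
inverses. -/
theorem mainTheorem10 (t : OGraph.MPType) :
    ∃ w : List (OGraph.Generator × Bool), ∀ Γ Γ' : OGraph.FramedNormalOGraph,
      OGraph.FramedMP t Γ Γ' → OGraph.Derives w Γ Γ' := t.derives_of_reaches t.reaches
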